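/- Let $n_1,n_2\ge 0$ be integers, $n=n_1+n_2+1$, and let $\varrho>0$. On $\mathbb{C}^{n+1}$ put $(z,w)=\sum_{i=1}^{n} z_i\bar w_i-z_{n+1}\bar w_{n+1}$. Let $\mathbb{H}^{2n+1}_1=\{z\in\mathbb{C}^{n+1}: (z,z)=-1\}$, and let $\mathbb{C}\mathbb{H}^n$ be the complex hyperbolic space, the quotient of $\mathbb{H}^{2n+1}_1$ by the action of the unit complex numbers, with projection $z\mapsto[z]$, its usual complex structure $J$, the Kähler metric of constant holomorphic sectional curvature $-4$ (for which $z\mapsto [z]$ is a semi-Riemannian submersion from $\mathbb{H}^{2n+1}_1$ with the metric $\mathrm{Re}(\cdot,\cdot)$), and the Kähler form $\omega(u,v)=\langle Ju,v\rangle$. Let $\mathbb{S}^{n_1}\subset\mathbb{R}^{n_1+1}$ be the unit sphere and $\mathbb{R}\mathbb{H}^{n_2}=\{y\in\mathbb{R}^{n_2+1}: y_1^2+\dots+y_{n_2}^2-y_{n_2+1}^2=-1,\ y_{n_2+1}>0\}$. Put $c=\sinh^{n_1+1}\varrho\,\cosh^{n_2+1}\varrho$ and, for $s\in\mathbb{R}$,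 \[ \theta_1(s)=\int_0^s\frac{c\,|x|\,dx}{(x^2+\sinh^2\varrho)\sqrt{(x^2+\sinh^2\varrho)^{n_1+1}(x^2+\cosh^2\varrho)^{n_2+1}-c^2}}, \] \[ \theta_2(s)=\int_0^s\frac{c\,|x|\,dx}{(x^2+\cosh^2\varrho)\sqrt{(x^2+\sinh^2\varrho)^{n_1+1}(x^2+\cosh^2\varrho)^{n_2+1}-c^2}}. \] Then the map \[ \mathbb{R}\times\mathbb{S}^{n_1}\times\mathbb{R}\mathbb{H}^{n_2}\longrightarrow\mathbb{C}\mathbb{H}^n,\qquad (s,x,y)\longmapsto\Big[\big(\sqrt{s^2+\sinh^2\varrho}\;e^{i\theta_1(s)}\,x,\ \sqrt{s^2+\cosh^2\varrho}\;e^{i\theta_2(s)}\,y\big)\Big] \] is a minimal Lagrangian embedding: it is a smooth embedding (an immersion that is a homeomorphism onto its image), $2\dim(\mathbb{R}\times\mathbb{S}^{n_1}\times\mathbb{R}\mathbb{H}^{n_2})=\dim_{\mathbb{R}}\mathbb{C}\mathbb{H}^n$, the pull-back of $\omega$ is zero, and the mean curvature vector is zero at every point. -/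

import Mathlib

open scoped Manifold ContDiff
open Metric

noncomputable section

/-! ## Submanifold geometry in a Riemannian manifold

`N` is a manifold without boundary modelled on `E'`, with a Riemannian metric `g` on its tangent
bundle. -/

section Riemannian

variable {E' : Type*} [NormedAddCommGroup E'] [NormedSpace ℝ E']
  {N : Type*} [TopologicalSpace N] [ChartedSpace E' N]
  (g : Bundle.RiemannianMetric (fun q : N => TangentSpace 𝓘(ℝ, E') q))

/-- The components `g_y(u, v)` of the metric in the preferred chart around `q`, at the point with
coordinate `y`; `u`, `v` are coordinate vectors. -/
def metricInChart (q : N) (y u v : E') : ℝ :=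
  g.inner ((extChartAt 𝓘(ℝ, E') q).symm y)
    (mfderiv 𝓘(ℝ, E') 𝓘(ℝ, E') (extChartAt 𝓘(ℝ, E') q).symm y u)
    (mfderiv 𝓘(ℝ, E') 𝓘(ℝ, E') (extChartAt 𝓘(ℝ, E') q).symm y v)

/-- The Christoffel symbols of the first kind in the preferred chart around `q`: the number
`g(∇_a b, c)` at `y`, where `∇` is the Levi-Civita connection and `a`, `b`, `c` are regarded as
coordinate vector fields with constant coefficients. -/
def christoffel (q : N) (y a b c : E') : ℝ :=
  (fderiv ℝ (fun y' => metricInChart g q y' b c) y a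
    + fderiv ℝ (fun y' => metricInChart g q y' a c) y b
    - fderiv ℝ (fun y' => metricInChart g q y' a b) y c) / 2

variable {E : Type*} [NormedAddCommGroup E] [NormedSpace ℝ E]
  {H : Type*} [TopologicalSpace H] (I : ModelWithCorners ℝ E H)
  {M : Type*} [TopologicalSpace M] [ChartedSpace H M]

/-- For `F : M → N`, `p : M`, `a b ∈ T_p M` and `ν ∈ T_{F p} N`: the number `g(∇_A dF(B), ν)`, where
`A`, `B` extend `a`, `b` with constant coefficients in the preferred chart of `M` around `p`, and
`∇` is the pull-back of the Levi-Civita connection of `N`. (The vectors `a`, `b`, `ν` agree with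
their coordinates in the preferred charts around `p` and `F p`.) When `F` is an immersion and `ν` is
normal to `F`, this is `⟨σ(a, b), ν⟩`, where `σ` is the second fundamental form of `F`. -/
def secondFundamentalForm (F : M → N) (p : M) (a b : TangentSpace I p)
    (ν : TangentSpace 𝓘(ℝ, E') (F p)) : ℝ :=
  let f : E → E' := writtenInExtChartAt I 𝓘(ℝ, E') p F
  let x : E := extChartAt I p p
  metricInChart g (F p) (f x) (fderiv ℝ (fun x' => fderiv ℝ f x' b) x a) ν
    + christoffel g (F p) (f x) (fderiv ℝ f x a) (fderiv ℝ f x b) ν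

/-- `ν` is normal to `F` at `p`. -/
def IsNormalAt (F : M → N) (p : M) (ν : TangentSpace 𝓘(ℝ, E') (F p)) : Prop :=
  ∀ v : TangentSpace I p, g.inner (F p) (mfderiv I 𝓘(ℝ, E') F p v) ν = 0

/-- `e` is an orthonormal frame of `T_p M` for the induced metric `F^* g`. -/
def IsOrthonormalFrameAt (F : M → N) (p : M)
    (e : Fin (Module.finrank ℝ E) → TangentSpace I p) : Prop :=
  ∀ i j, g.inner (F p) (mfderiv I 𝓘(ℝ, E') F p (e i)) (mfderiv I 𝓘(ℝ, E') F p (e j))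
    = if i = j then 1 else 0

/-- `h` is the mean curvature vector of the immersion `F` at `p`: it is normal to `F` and
`m h = ∑ σ(e_i, e_i)`, with `m = dim M`, for orthonormal frames `e` of `T_p M`. -/
def IsMeanCurvatureVectorAt (F : M → N) (p : M) (h : TangentSpace 𝓘(ℝ, E') (F p)) : Prop :=
  IsNormalAt g I F p h ∧
    ∀ e : Fin (Module.finrank ℝ E) → TangentSpace I p, IsOrthonormalFrameAt g I F p e →
      ∀ ν : TangentSpace 𝓘(ℝ, E') (F p), IsNormalAt g I F p ν →
        (Module.finrank ℝ E : ℝ) * g.inner (F p) h ν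
          = ∑ i, secondFundamentalForm g I F p (e i) (e i) ν

/-- The immersion `F` is minimal: its mean curvature vector is zero at every point. -/
def IsMinimalMap (F : M → N) : Prop :=
  ∀ p : M, IsMeanCurvatureVectorAt g I F p 0

/-- The immersion `F` is Lagrangian with respect to the Kähler form `ω(u, v) = g(J u, v)`:
`2 dim M = dim N` and `F^* ω = 0`. -/
def IsLagrangianMap
    (J : ∀ q : N, TangentSpace 𝓘(ℝ, E') q → TangentSpace 𝓘(ℝ, E') q) (F : M → N) : Prop :=
  2 * Module.finrank ℝ E = Module.finrank ℝ E' ∧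
    ∀ (p : M) (u v : TangentSpace I p),
      g.inner (F p) (J (F p) (mfderiv I 𝓘(ℝ, E') F p u)) (mfderiv I 𝓘(ℝ, E') F p v) = 0

end Riemannian

/-! ## Anti-de Sitter space and complex hyperbolic space -/

/-- The Hermitian form `(z, w) = ∑_{i ≤ n} z_i \bar w_i - z_{n+1} \bar w_{n+1}` on `ℂ^{n+1}`. -/
def hermForm {n : ℕ} (z w : Fin (n + 1) → ℂ) : ℂ :=
  ∑ i : Fin n, z i.castSucc * star (w i.castSucc) - z (Fin.last n) * star (w (Fin.last n))

/-- The anti-de Sitter space `ℍ₁^{2n+1} = {z ∈ ℂ^{n+1} : (z, z) = -1}`. -/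
def AntiDeSitter (n : ℕ) : Type := {z : Fin (n + 1) → ℂ // hermForm z z = -1}

instance (n : ℕ) : TopologicalSpace (AntiDeSitter n) :=
  inferInstanceAs (TopologicalSpace {z : Fin (n + 1) → ℂ // hermForm z z = -1})

/-- Two points are in the same fibre of the Hopf fibration when they differ by a unit complex
factor. -/
instance hopfSetoid (n : ℕ) : Setoid (AntiDeSitter n) where
  r z w := ∃ c : ℂ, ‖c‖ = 1 ∧ w.1 = c • z.1
  iseqv :=
    { refl := fun z => ⟨1, by simp, by simp⟩
      symm := by
        rintro z w ⟨c, hc, h⟩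
        have hc0 : c ≠ 0 := by rintro rfl; simp at hc
        exact ⟨c⁻¹, by simp [hc], by rw [h, smul_smul, inv_mul_cancel₀ hc0, one_smul]⟩
      trans := by
        rintro z w v ⟨c, hc, h⟩ ⟨d, hd, h'⟩
        exact ⟨d * c, by simp [hc, hd], by rw [h', h, smul_smul]⟩ }

/-- Complex hyperbolic space, the quotient of anti-de Sitter space by the circle action. -/
def ComplexHyperbolicSpace (n : ℕ) : Type := Quotient (hopfSetoid n)

instance (n : ℕ) : TopologicalSpace (ComplexHyperbolicSpace n) :=
  inferInstanceAs (TopologicalSpace (Quotient (hopfSetoid n)))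

/-- The Hopf fibration `Π : z ↦ [z]`. -/
def hopf {n : ℕ} (z : AntiDeSitter n) : ComplexHyperbolicSpace n := Quotient.mk (hopfSetoid n) z

/-- The affine coordinate `(z_1 / z_{n+1}, …, z_n / z_{n+1})`. -/
def affineCoord {n : ℕ} (z : Fin (n + 1) → ℂ) : EuclideanSpace ℂ (Fin n) :=
  WithLp.toLp 2 fun i => z i.castSucc / z (Fin.last n)

lemma AntiDeSitter.normSq_last {n : ℕ} (z : AntiDeSitter n) :
    ‖z.1 (Fin.last n)‖ ^ 2 = 1 + ∑ i : Fin n, ‖z.1 i.castSucc‖ ^ 2 := by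
  have h := z.2
  simp only [hermForm, Complex.star_def, Complex.mul_conj, Complex.normSq_eq_norm_sq] at h
  have h' : (∑ i : Fin n, ‖z.1 i.castSucc‖ ^ 2 - ‖z.1 (Fin.last n)‖ ^ 2 : ℝ) = -1 := by
    exact_mod_cast h
  linarith

lemma AntiDeSitter.last_ne_zero {n : ℕ} (z : AntiDeSitter n) : z.1 (Fin.last n) ≠ 0 := by
  intro h
  have := z.normSq_last
  have h2 : 0 ≤ ∑ i : Fin n, ‖z.1 i.castSucc‖ ^ 2 := by positivity
  rw [h] at this
  norm_num at this
  linarith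

lemma AntiDeSitter.one_sub_norm_affineCoord_sq {n : ℕ} (z : AntiDeSitter n) :
    1 - ‖affineCoord z.1‖ ^ 2 = (‖z.1 (Fin.last n)‖⁻¹) ^ 2 := by
  have hl' : 0 < ‖z.1 (Fin.last n)‖ := norm_pos_iff.2 z.last_ne_zero
  rw [EuclideanSpace.norm_sq_eq]
  simp only [affineCoord, norm_div, div_pow]
  rw [← Finset.sum_div]
  have := z.normSq_last
  field_simp
  linarith

lemma AntiDeSitter.norm_affineCoord_lt {n : ℕ} (z : AntiDeSitter n) : ‖affineCoord z.1‖ < 1 := by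
  have h0 : 0 < ‖z.1 (Fin.last n)‖ := norm_pos_iff.2 z.last_ne_zero
  have h : 0 < 1 - ‖affineCoord z.1‖ ^ 2 := by
    rw [z.one_sub_norm_affineCoord_sq]
    positivity
  nlinarith [norm_nonneg (affineCoord z.1)]

/-- The affine coordinate as a function on complex hyperbolic space; it takes its values in the open
unit ball of `ℂ^n`. -/
def ComplexHyperbolicSpace.toBall {n : ℕ} :
    ComplexHyperbolicSpace n → EuclideanSpace ℂ (Fin n) :=
  Quotient.lift (fun z : AntiDeSitter n => affineCoord z.1) (by
    rintro z w ⟨c, hc, h⟩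
    have hc0 : c ≠ 0 := by rintro rfl; simp at hc
    simp only [affineCoord, h, Pi.smul_apply, smul_eq_mul]
    congr 1
    funext i
    rw [mul_div_mul_left _ _ hc0])

lemma ballLift_mem {n : ℕ} {w : EuclideanSpace ℂ (Fin n)} (hw : ‖w‖ < 1) :
    hermForm (n := n)
      (fun i => ((Real.sqrt (1 - ‖w‖ ^ 2))⁻¹ : ℂ) * Fin.snoc (α := fun _ => ℂ) w.ofLp 1 i)
      (fun i => ((Real.sqrt (1 - ‖w‖ ^ 2))⁻¹ : ℂ) * Fin.snoc (α := fun _ => ℂ) w.ofLp 1 i) = -1 := by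
  have h1 : 0 < 1 - ‖w‖ ^ 2 := by nlinarith [norm_nonneg w]
  simp only [hermForm, Fin.snoc_castSucc, Fin.snoc_last, Complex.star_def, Complex.mul_conj,
    Complex.normSq_eq_norm_sq, norm_mul, mul_pow, norm_inv, Complex.norm_real, Real.norm_eq_abs,
    inv_pow, sq_abs, Real.sq_sqrt h1.le, norm_one]
  have h2 : ∑ i, ‖w.ofLp i‖ ^ 2 = ‖w‖ ^ 2 := (EuclideanSpace.norm_sq_eq w).symm
  norm_cast
  rw [← Finset.mul_sum, h2]
  push_cast
  field_simp
  ring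

/-- The inverse of `toBall`: `w ↦ [(w, 1) / √(1 - |w|²)]` on the unit ball, with an arbitrary value
outside of it. -/
def ComplexHyperbolicSpace.ofBall {n : ℕ} (w : EuclideanSpace ℂ (Fin n)) :
    ComplexHyperbolicSpace n :=
  if hw : ‖w‖ < 1 then hopf ⟨_, ballLift_mem hw⟩
  else hopf ⟨_, ballLift_mem (n := n) (w := 0) (by simp)⟩

lemma ComplexHyperbolicSpace.norm_toBall_lt {n : ℕ} (p : ComplexHyperbolicSpace n) :
    ‖p.toBall‖ < 1 := by
  induction p using Quotient.inductionOn with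
  | h z => exact z.norm_affineCoord_lt

lemma ComplexHyperbolicSpace.toBall_ofBall {n : ℕ} {w : EuclideanSpace ℂ (Fin n)}
    (hw : ‖w‖ < 1) : (ofBall w).toBall = w := by
  have h1 : 0 < 1 - ‖w‖ ^ 2 := by nlinarith [norm_nonneg w]
  have h2 : ((Real.sqrt (1 - ‖w‖ ^ 2))⁻¹ : ℂ) ≠ 0 := by
    simpa using (Real.sqrt_pos.2 h1).ne'
  rw [ofBall, dif_pos hw]
  ext i
  change _ * _ / (_ * _) = _
  rw [Fin.snoc_castSucc, Fin.snoc_last, mul_div_mul_left _ _ h2, div_one]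

lemma ComplexHyperbolicSpace.ofBall_toBall {n : ℕ} (p : ComplexHyperbolicSpace n) :
    ofBall p.toBall = p := by
  induction p using Quotient.inductionOn with
  | h z =>
    have hw := z.norm_affineCoord_lt
    change ofBall (affineCoord z.1) = _
    rw [ofBall, dif_pos hw]
    refine Quotient.sound ?_
    have hl := z.last_ne_zero
    have hl' : 0 < ‖z.1 (Fin.last n)‖ := norm_pos_iff.2 hl
    have h1 := z.one_sub_norm_affineCoord_sq
    refine ⟨z.1 (Fin.last n) * (‖z.1 (Fin.last n)‖⁻¹ : ℝ), ?_, ?_⟩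
    · simp [hl]
    · funext i
      change z.1 i = (z.1 (Fin.last n) * ((‖z.1 (Fin.last n)‖⁻¹ : ℝ) : ℂ)) *
        (((Real.sqrt (1 - ‖affineCoord z.1‖ ^ 2) : ℝ) : ℂ)⁻¹ *
          Fin.snoc (α := fun _ => ℂ) (affineCoord z.1).ofLp 1 i)
      rw [h1, Real.sqrt_sq (by positivity)]
      have h3 : (‖z.1 (Fin.last n)‖ : ℂ) ≠ 0 := by exact_mod_cast hl'.ne'
      refine Fin.lastCases ?_ (fun j => ?_) i
      · rw [Fin.snoc_last]
        push_cast
        field_simp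
      · rw [Fin.snoc_castSucc]
        simp only [affineCoord]
        push_cast
        field_simp

lemma ComplexHyperbolicSpace.continuous_toBall {n : ℕ} :
    Continuous (toBall : ComplexHyperbolicSpace n → EuclideanSpace ℂ (Fin n)) := by
  refine Continuous.quotient_lift ?_ _
  refine (PiLp.continuous_toLp 2 _).comp (continuous_pi fun i => ?_)
  exact ((continuous_apply _).comp continuous_subtype_val).div
    ((continuous_apply _).comp continuous_subtype_val) fun z => AntiDeSitter.last_ne_zero z

lemma ComplexHyperbolicSpace.continuousOn_ofBall {n : ℕ} :
    ContinuousOn (ofBall : EuclideanSpace ℂ (Fin n) → ComplexHyperbolicSpace n) (ball 0 1) := by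
  rw [continuousOn_iff_continuous_domRestrict]
  have hb : ∀ w : ball (0 : EuclideanSpace ℂ (Fin n)) 1, ‖w.1‖ < 1 := fun w =>
    mem_ball_zero_iff.1 w.2
  have h : Continuous fun w : ball (0 : EuclideanSpace ℂ (Fin n)) 1 =>
      (⟨_, ballLift_mem (hb w)⟩ : AntiDeSitter n) := by
    refine Continuous.subtype_mk (continuous_pi fun i => ?_) _
    have hn : Continuous fun w : ball (0 : EuclideanSpace ℂ (Fin n)) 1 => ‖w.1‖ :=
      continuous_norm.comp continuous_subtype_val
    refine Continuous.mul (Continuous.inv₀ (Complex.continuous_ofReal.comp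
      (Real.continuous_sqrt.comp (continuous_const.sub (hn.pow 2)))) fun w => ?_) ?_
    · have h1 : 0 < 1 - ‖w.1‖ ^ 2 := by nlinarith [norm_nonneg w.1, hb w]
      simpa using (Real.sqrt_pos.2 h1).ne'
    · refine Fin.lastCases ?_ (fun j => ?_) i
      · simp only [Fin.snoc_last]
        exact continuous_const
      · simp only [Fin.snoc_castSucc]
        exact (PiLp.continuous_apply 2 _ j).comp continuous_subtype_val
  have hq : Continuous (hopf : AntiDeSitter n → ComplexHyperbolicSpace n) :=
    continuous_quotient_mk'
  refine (hq.comp h).congr fun w => ?_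
  simp only [Set.domRestrict_apply, ofBall, dif_pos (hb w)]
  rfl

/-- The global holomorphic chart of complex hyperbolic space: it identifies it with the open unit
ball of `ℂ^n`. -/
def ComplexHyperbolicSpace.chart (n : ℕ) :
    OpenPartialHomeomorph (ComplexHyperbolicSpace n) (EuclideanSpace ℂ (Fin n)) where
  toFun := toBall
  invFun := ofBall
  source := Set.univ
  target := ball 0 1
  map_source' p _ := by simpa using p.norm_toBall_lt
  map_target' _ _ := Set.mem_univ _
  left_inv' p _ := p.ofBall_toBall
  right_inv' w hw := toBall_ofBall (by simpa using hw)
  open_source := isOpen_univ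
  open_target := isOpen_ball
  continuousOn_toFun := continuous_toBall.continuousOn
  continuousOn_invFun := continuousOn_ofBall

instance (n : ℕ) : ChartedSpace (EuclideanSpace ℂ (Fin n)) (ComplexHyperbolicSpace n) :=
  (ComplexHyperbolicSpace.chart n).singletonChartedSpace rfl

instance (n : ℕ) : IsManifold 𝓘(ℝ, EuclideanSpace ℂ (Fin n)) ω (ComplexHyperbolicSpace n) :=
  (ComplexHyperbolicSpace.chart n).isManifold_singleton rfl

/-- The Bergman-type metric `Re [⟨u, v⟩ / (1 - |w|²) + ⟨u, w⟩ ⟨w, v⟩ / (1 - |w|²)²]` at the point `w`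
of the unit ball of `ℂ^n`, where `⟨ , ⟩` is the standard Hermitian product, linear in its first
entry here (so that `⟨u, v⟩` is Mathlib's `inner ℂ v u`). -/
def ballMetric {n : ℕ} (w : EuclideanSpace ℂ (Fin n)) :
    EuclideanSpace ℂ (Fin n) →L[ℝ] EuclideanSpace ℂ (Fin n) →L[ℝ] ℝ :=
  (LinearMap.mk₂ ℝ
    (fun u v => (inner ℂ v u / (1 - ‖w‖ ^ 2 : ℂ)
      + inner ℂ w u * inner ℂ v w / (1 - ‖w‖ ^ 2 : ℂ) ^ 2).re)
    (fun u u' v => by simp only [inner_add_right, ← Complex.add_re]; congr 1; ring)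
    (fun c u v => by
      simp only [← Complex.coe_smul, inner_smul_right, smul_eq_mul]
      rw [← Complex.re_ofReal_mul]; congr 1; ring)
    (fun u v v' => by simp only [inner_add_left, ← Complex.add_re]; congr 1; ring)
    (fun c u v => by
      simp only [← Complex.coe_smul, inner_smul_left, smul_eq_mul, Complex.conj_ofReal]
      rw [← Complex.re_ofReal_mul]; congr 1; ring)).toContinuousBilinearMap

lemma ballMetric_apply {n : ℕ} (w u v : EuclideanSpace ℂ (Fin n)) :
    ballMetric w u v = (inner ℂ v u / (1 - ‖w‖ ^ 2 : ℂ)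
      + inner ℂ w u * inner ℂ v w / (1 - ‖w‖ ^ 2 : ℂ) ^ 2).re := rfl

lemma ballMetric_self {n : ℕ} (w u : EuclideanSpace ℂ (Fin n)) :
    ballMetric w u u = ‖u‖ ^ 2 / (1 - ‖w‖ ^ 2) + ‖inner ℂ w u‖ ^ 2 / (1 - ‖w‖ ^ 2) ^ 2 := by
  have h : inner ℂ u u = ((‖u‖ ^ 2 : ℝ) : ℂ) := by
    rw [inner_self_eq_norm_sq_to_K]; push_cast; rfl
  rw [ballMetric_apply, h, ← inner_conj_symm u w, Complex.mul_conj, Complex.normSq_eq_norm_sq]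
  norm_cast

lemma ballMetric_symm {n : ℕ} (w u v : EuclideanSpace ℂ (Fin n)) :
    ballMetric w u v = ballMetric w v u := by
  rw [ballMetric_apply, ballMetric_apply, ← Complex.conj_re]
  congr 1
  simp only [map_add, map_div₀, map_mul, map_pow, map_sub, map_one, Complex.conj_ofReal,
    inner_conj_symm]
  ring

lemma fderiv_affineCoord {n : ℕ} (z : AntiDeSitter n) (u : Fin (n + 1) → ℂ) :
    fderiv ℝ affineCoord z.1 u = WithLp.toLp 2 (fun i : Fin n =>
      (u i.castSucc * z.1 (Fin.last n) - z.1 i.castSucc * u (Fin.last n))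
        / z.1 (Fin.last n) ^ 2) := by
  have hl := z.last_ne_zero
  have h : ∀ i : Fin n, HasFDerivAt (𝕜 := ℝ)
      (fun y : Fin (n + 1) → ℂ => y i.castSucc * (y (Fin.last n))⁻¹) _ z.1 := fun i =>
    (hasFDerivAt_apply (𝕜 := ℝ) i.castSucc z.1).mul'
      ((hasFDerivAt_inv hl).restrictScalars ℝ |>.comp z.1 (hasFDerivAt_apply (Fin.last n) z.1))
  have h2 : fderiv ℝ affineCoord z.1 = _ :=
    ((PiLp.hasFDerivAt_toLp (𝕜 := ℝ) 2 _).comp z.1 (hasFDerivAt_pi.2 h)).fderiv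
  rw [h2]
  ext i
  simp
  field_simp
  ring

/-- At `z` with `(z, z) = -1`, the differential of the Hopf fibration (in the affine coordinate) is
isometric on the horizontal vectors `u`, `(u, z) = 0`: the Hopf fibration is a Riemannian submersion
for `ballMetric` and the metric `Re (u, v)` of anti-de Sitter space. -/
theorem ballMetric_submersion {n : ℕ} (z : AntiDeSitter n) (u v : Fin (n + 1) → ℂ)
    (hu : hermForm u z.1 = 0) (hv : hermForm v z.1 = 0) :
    ballMetric (affineCoord z.1) (fderiv ℝ affineCoord z.1 u) (fderiv ℝ affineCoord z.1 v)
      = (hermForm u v).re := by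
  have hl := z.last_ne_zero
  have hd := fderiv_affineCoord z
  obtain ⟨c, hc⟩ : ∃ c, c = z.1 (Fin.last n) := ⟨_, rfl⟩
  simp only [← hc] at hd hl
  have hc' : (starRingEnd ℂ) c ≠ 0 := by simpa using hl
  have hB : ∑ i : Fin n, u i.castSucc * (starRingEnd ℂ) (z.1 i.castSucc)
      = u (Fin.last n) * (starRingEnd ℂ) c := hc ▸ sub_eq_zero.1 hu
  have hC : ∑ i : Fin n, z.1 i.castSucc * (starRingEnd ℂ) (v i.castSucc)
      = c * (starRingEnd ℂ) (v (Fin.last n)) := by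
    have h := congrArg (starRingEnd ℂ) (sub_eq_zero.1 hv)
    simpa [map_sum, mul_comm, hc] using h
  have hD : ∑ i : Fin n, z.1 i.castSucc * (starRingEnd ℂ) (z.1 i.castSucc)
      = c * (starRingEnd ℂ) c - 1 := by
    have h := z.2
    simp only [hermForm, Complex.star_def, ← hc] at h
    linear_combination h
  have hr : (1 - ‖affineCoord z.1‖ ^ 2 : ℂ) = (c * (starRingEnd ℂ) c)⁻¹ := by
    have h := congrArg (Complex.ofReal) z.one_sub_norm_affineCoord_sq
    push_cast at h
    rw [h, ← hc, Complex.mul_conj, Complex.normSq_eq_norm_sq]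
    push_cast
    rw [inv_pow]
  have hw : ∀ u : Fin (n + 1) → ℂ,
      ∑ i : Fin n, u i.castSucc * (starRingEnd ℂ) (z.1 i.castSucc)
        = u (Fin.last n) * (starRingEnd ℂ) c →
      inner ℂ (affineCoord z.1) (fderiv ℝ affineCoord z.1 u)
        = u (Fin.last n) / (c ^ 2 * (starRingEnd ℂ) c) := by
    intro u hB
    rw [hd, PiLp.inner_apply]
    have h : ∀ i : Fin n, inner ℂ ((affineCoord z.1).ofLp i)
        ((u i.castSucc * c - z.1 i.castSucc * u (Fin.last n)) / c ^ 2)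
        = (c ^ 2 * (starRingEnd ℂ) c)⁻¹ * (c * (u i.castSucc * (starRingEnd ℂ) (z.1 i.castSucc))
          - u (Fin.last n) * (z.1 i.castSucc * (starRingEnd ℂ) (z.1 i.castSucc))) := by
      intro i
      simp only [affineCoord, RCLike.inner_apply, map_div₀, ← hc]
      field_simp
    rw [Finset.sum_congr rfl fun i _ => h i, ← Finset.mul_sum, Finset.sum_sub_distrib,
      ← Finset.mul_sum, ← Finset.mul_sum, hB, hD]
    field_simp
    ring
  have huv : inner ℂ (fderiv ℝ affineCoord z.1 v) (fderiv ℝ affineCoord z.1 u)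
      = (c ^ 2 * (starRingEnd ℂ) c ^ 2)⁻¹ * (c * (starRingEnd ℂ) c * hermForm u v
        - u (Fin.last n) * (starRingEnd ℂ) (v (Fin.last n))) := by
    rw [hd, hd, PiLp.inner_apply]
    have h : ∀ i : Fin n, inner ℂ ((v i.castSucc * c - z.1 i.castSucc * v (Fin.last n)) / c ^ 2)
        ((u i.castSucc * c - z.1 i.castSucc * u (Fin.last n)) / c ^ 2)
        = (c ^ 2 * (starRingEnd ℂ) c ^ 2)⁻¹ *
          (c * (starRingEnd ℂ) c * (u i.castSucc * (starRingEnd ℂ) (v i.castSucc))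
          - c * (starRingEnd ℂ) (v (Fin.last n))
            * (u i.castSucc * (starRingEnd ℂ) (z.1 i.castSucc))
          - (starRingEnd ℂ) c * u (Fin.last n)
            * (z.1 i.castSucc * (starRingEnd ℂ) (v i.castSucc))
          + u (Fin.last n) * (starRingEnd ℂ) (v (Fin.last n))
            * (z.1 i.castSucc * (starRingEnd ℂ) (z.1 i.castSucc))) := by
      intro i
      simp only [RCLike.inner_apply, map_div₀, map_sub, map_mul, map_pow]
      field_simp
      ring
    rw [Finset.sum_congr rfl fun i _ => h i, ← Finset.mul_sum, Finset.sum_add_distrib,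
      Finset.sum_sub_distrib, Finset.sum_sub_distrib, ← Finset.mul_sum, ← Finset.mul_sum,
      ← Finset.mul_sum, ← Finset.mul_sum, hB, hC, hD]
    simp only [hermForm, Complex.star_def]
    ring
  rw [ballMetric_apply, ← inner_conj_symm (fderiv ℝ affineCoord z.1 v) (affineCoord z.1), hr,
    hw u hB, hw v (hc ▸ sub_eq_zero.1 hv), huv]
  congr 1
  simp only [map_div₀, map_mul, map_pow, Complex.conj_conj]
  field_simp
  ring

/-- The metric of complex hyperbolic space (constant holomorphic sectional curvature `-4`), in the
global chart. It makes the Hopf fibration a Riemannian submersion, by `ballMetric_submersion`. -/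
def complexHyperbolicMetric (n : ℕ) :
    Bundle.RiemannianMetric
      (fun p : ComplexHyperbolicSpace n => TangentSpace 𝓘(ℝ, EuclideanSpace ℂ (Fin n)) p) where
  inner p := ballMetric p.toBall
  symm p u v := ballMetric_symm _ u v
  pos p u hu := by
    have h1 : 0 < 1 - ‖p.toBall‖ ^ 2 := by nlinarith [norm_nonneg p.toBall, p.norm_toBall_lt]
    have hu' : 0 < ‖(show EuclideanSpace ℂ (Fin n) from u)‖ := norm_pos_iff.2 hu
    refine lt_of_lt_of_eq ?_ (ballMetric_self _ (show EuclideanSpace ℂ (Fin n) from u)).symm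
    positivity
  continuousAt p := by
    have h : Continuous fun v : EuclideanSpace ℂ (Fin n) => ballMetric p.toBall v v :=
      (ballMetric p.toBall).continuous.clm_apply continuous_id
    exact h.continuousAt
  isVonNBounded p := by
    have h1 : 0 < 1 - ‖p.toBall‖ ^ 2 := by nlinarith [norm_nonneg p.toBall, p.norm_toBall_lt]
    have h : Bornology.IsVonNBounded ℝ
        {v : EuclideanSpace ℂ (Fin n) | ballMetric p.toBall v v < 1} := by
      refine (NormedSpace.isVonNBounded_ball ℝ (EuclideanSpace ℂ (Fin n)) 1).subset fun v hv => ?_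
      rw [Set.mem_ofPred_eq, ballMetric_self] at hv
      have h2 : 0 ≤ ‖inner ℂ p.toBall v‖ ^ 2 / (1 - ‖p.toBall‖ ^ 2) ^ 2 := by positivity
      have h3 : ‖v‖ ^ 2 / (1 - ‖p.toBall‖ ^ 2) < 1 := by linarith
      rw [div_lt_one h1] at h3
      have h4 : ‖v‖ < 1 := by nlinarith [norm_nonneg v, sq_nonneg ‖p.toBall‖]
      simpa using h4
    exact h

/-- The complex structure of complex hyperbolic space: multiplication by `i` in the holomorphic
chart. -/
def complexHyperbolicJ (n : ℕ) (p : ComplexHyperbolicSpace n) :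
    TangentSpace 𝓘(ℝ, EuclideanSpace ℂ (Fin n)) p →
      TangentSpace 𝓘(ℝ, EuclideanSpace ℂ (Fin n)) p :=
  fun u => Complex.I • (show EuclideanSpace ℂ (Fin n) from u)

/-! ## Real hyperbolic space -/

/-- The real hyperbolic space
`ℝℍ^n = {y ∈ ℝ^{n+1} : y_1² + … + y_n² - y_{n+1}² = -1, y_{n+1} > 0}`. -/
def RealHyperbolicSpace (n : ℕ) : Type :=
  {y : EuclideanSpace ℝ (Fin (n + 1)) //
    ∑ i : Fin n, y i.castSucc ^ 2 - y (Fin.last n) ^ 2 = -1 ∧ 0 < y (Fin.last n)}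

instance (n : ℕ) : TopologicalSpace (RealHyperbolicSpace n) :=
  inferInstanceAs (TopologicalSpace {y : EuclideanSpace ℝ (Fin (n + 1)) //
    ∑ i : Fin n, y i.castSucc ^ 2 - y (Fin.last n) ^ 2 = -1 ∧ 0 < y (Fin.last n)})

/-- The global chart `(y_1, …, y_{n+1}) ↦ (y_1, …, y_n)` of the hyperboloid, whose inverse is
`u ↦ (u, √(1 + |u|²))`. -/
def RealHyperbolicSpace.chart (n : ℕ) : RealHyperbolicSpace n ≃ₜ EuclideanSpace ℝ (Fin n) where
  toFun y := WithLp.toLp 2 fun i => y.1 i.castSucc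
  invFun u := ⟨WithLp.toLp 2 (Fin.snoc (α := fun _ => ℝ) u.ofLp (Real.sqrt (1 + ‖u‖ ^ 2))), by
    simp only [Fin.snoc_castSucc, Fin.snoc_last]
    rw [Real.sq_sqrt (by positivity), EuclideanSpace.norm_sq_eq]
    simp only [Real.norm_eq_abs, sq_abs]
    exact ⟨by ring, by positivity⟩⟩
  left_inv y := by
    refine Subtype.ext (PiLp.ext fun i => ?_)
    refine Fin.lastCases ?_ (fun j => ?_) i
    · simp only [Fin.snoc_last]
      rw [EuclideanSpace.norm_sq_eq]
      simp only [Real.norm_eq_abs, sq_abs]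
      rw [show 1 + ∑ i : Fin n, y.1 i.castSucc ^ 2 = y.1 (Fin.last n) ^ 2 by linarith [y.2.1],
        Real.sqrt_sq y.2.2.le]
    · simp only [Fin.snoc_castSucc]
  right_inv u := by
    ext i
    simp only [Fin.snoc_castSucc]
  continuous_toFun := (PiLp.continuous_toLp 2 _).comp (continuous_pi fun i =>
    (PiLp.continuous_apply 2 _ i.castSucc).comp continuous_subtype_val)
  continuous_invFun := by
    refine Continuous.subtype_mk ((PiLp.continuous_toLp 2 _).comp (continuous_pi fun i => ?_)) _
    refine Fin.lastCases ?_ (fun j => ?_) i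
    · simp only [Fin.snoc_last]
      fun_prop
    · simp only [Fin.snoc_castSucc]
      exact PiLp.continuous_apply 2 _ j

instance (n : ℕ) : ChartedSpace (EuclideanSpace ℝ (Fin n)) (RealHyperbolicSpace n) :=
  (RealHyperbolicSpace.chart n).toOpenPartialHomeomorph.singletonChartedSpace rfl

instance (n : ℕ) : IsManifold (𝓡 n) ω (RealHyperbolicSpace n) :=
  (RealHyperbolicSpace.chart n).toOpenPartialHomeomorph.isManifold_singleton rfl

/-! ## The explicit map -/

/-- `c = sinh^{n₁+1} ϱ · cosh^{n₂+1} ϱ`. -/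
def curveConst (n₁ n₂ : ℕ) (ϱ : ℝ) : ℝ := Real.sinh ϱ ^ (n₁ + 1) * Real.cosh ϱ ^ (n₂ + 1)

/-- `√((x² + sinh² ϱ)^{n₁+1} (x² + cosh² ϱ)^{n₂+1} - c²)`. -/
def curveRoot (n₁ n₂ : ℕ) (ϱ x : ℝ) : ℝ :=
  Real.sqrt ((x ^ 2 + Real.sinh ϱ ^ 2) ^ (n₁ + 1) * (x ^ 2 + Real.cosh ϱ ^ 2) ^ (n₂ + 1)
    - curveConst n₁ n₂ ϱ ^ 2)

/-- The angle `θ₁`. The integrand is even, so `θ₁` is odd. -/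
def theta₁ (n₁ n₂ : ℕ) (ϱ s : ℝ) : ℝ :=
  ∫ x in (0 : ℝ)..s, curveConst n₁ n₂ ϱ * |x| / ((x ^ 2 + Real.sinh ϱ ^ 2) * curveRoot n₁ n₂ ϱ x)

/-- The angle `θ₂`. The integrand is even, so `θ₂` is odd. -/
def theta₂ (n₁ n₂ : ℕ) (ϱ s : ℝ) : ℝ :=
  ∫ x in (0 : ℝ)..s, curveConst n₁ n₂ ϱ * |x| / ((x ^ 2 + Real.cosh ϱ ^ 2) * curveRoot n₁ n₂ ϱ x)

/-- The components of the map into `ℂ^{n₁+1} × ℂ^{n₂+1} = ℂ^{n+1}`, `n = n₁ + n₂ + 1` (written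
`n₁ + 1 + n₂` here, so that the two factors are consecutive blocks of coordinates). -/
def explicitLiftFun (n₁ n₂ : ℕ) (ϱ : ℝ)
    (p : ℝ × sphere (0 : EuclideanSpace ℝ (Fin (n₁ + 1))) 1 × RealHyperbolicSpace n₂) :
    Fin (n₁ + 1 + n₂ + 1) → ℂ :=
  Fin.append (m := n₁ + 1) (n := n₂ + 1)
    (fun i => Real.sqrt (p.1 ^ 2 + Real.sinh ϱ ^ 2)
      * Complex.exp (Complex.I * theta₁ n₁ n₂ ϱ p.1) * (p.2.1.1 i : ℂ))
    (fun j => Real.sqrt (p.1 ^ 2 + Real.cosh ϱ ^ 2)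
      * Complex.exp (Complex.I * theta₂ n₁ n₂ ϱ p.1) * (p.2.2.1 j : ℂ))

lemma explicitLiftFun_mem (n₁ n₂ : ℕ) (ϱ : ℝ)
    (p : ℝ × sphere (0 : EuclideanSpace ℝ (Fin (n₁ + 1))) 1 × RealHyperbolicSpace n₂) :
    hermForm (explicitLiftFun n₁ n₂ ϱ p) (explicitLiftFun n₁ n₂ ϱ p) = -1 := by
  have he : ∀ t : ℝ, ‖Complex.exp (Complex.I * t)‖ = 1 := fun t => by
    rw [mul_comm]; exact Complex.norm_exp_ofReal_mul_I t
  have hx : ∑ i, (p.2.1.1 i) ^ 2 = 1 := by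
    have h := p.2.1.2
    rw [mem_sphere_zero_iff_norm] at h
    have h2 := EuclideanSpace.norm_sq_eq p.2.1.1
    rw [h] at h2
    simpa using h2.symm
  have hy := p.2.2.2.1
  have hl : ∀ i : Fin (n₁ + 1),
      explicitLiftFun n₁ n₂ ϱ p (Fin.castSucc (Fin.castAdd n₂ i))
        = Real.sqrt (p.1 ^ 2 + Real.sinh ϱ ^ 2)
          * Complex.exp (Complex.I * theta₁ n₁ n₂ ϱ p.1) * (p.2.1.1 i : ℂ) := fun i =>
    Fin.append_left (m := n₁ + 1) (n := n₂ + 1) _ _ i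
  have hr : ∀ j : Fin n₂,
      explicitLiftFun n₁ n₂ ϱ p (Fin.castSucc (Fin.natAdd (n₁ + 1) j))
        = Real.sqrt (p.1 ^ 2 + Real.cosh ϱ ^ 2)
          * Complex.exp (Complex.I * theta₂ n₁ n₂ ϱ p.1) * (p.2.2.1 j.castSucc : ℂ) := fun j =>
    Fin.append_right (m := n₁ + 1) (n := n₂ + 1) _ _ j.castSucc
  have hrl : explicitLiftFun n₁ n₂ ϱ p (Fin.last (n₁ + 1 + n₂))
        = Real.sqrt (p.1 ^ 2 + Real.cosh ϱ ^ 2)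
          * Complex.exp (Complex.I * theta₂ n₁ n₂ ϱ p.1) * (p.2.2.1 (Fin.last n₂) : ℂ) :=
    Fin.append_right (m := n₁ + 1) (n := n₂ + 1) _ _ (Fin.last n₂)
  rw [hermForm, Fin.sum_univ_add]
  simp only [hl, hr, hrl, Complex.star_def, Complex.mul_conj, Complex.normSq_eq_norm_sq,
    norm_mul, he, mul_one, mul_pow, Complex.norm_real, Real.norm_eq_abs, sq_abs]
  rw [Real.sq_sqrt (by positivity), Real.sq_sqrt (by positivity)]
  norm_cast
  rw [← Finset.mul_sum, ← Finset.mul_sum, hx]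
  have hc := Real.cosh_sq ϱ
  have : ∑ i : Fin n₂, p.2.2.1 i.castSucc ^ 2 = p.2.2.1 (Fin.last n₂) ^ 2 - 1 := by linarith
  rw [this, hc]
  push_cast
  ring

/-- The map `(s, x, y) ↦ [(√(s² + sinh² ϱ) e^{iθ₁(s)} x, √(s² + cosh² ϱ) e^{iθ₂(s)} y)]`. -/
def explicitMap (n₁ n₂ : ℕ) (ϱ : ℝ)
    (p : ℝ × sphere (0 : EuclideanSpace ℝ (Fin (n₁ + 1))) 1 × RealHyperbolicSpace n₂) :
    ComplexHyperbolicSpace (n₁ + 1 + n₂) :=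
  hopf ⟨explicitLiftFun n₁ n₂ ϱ p, explicitLiftFun_mem n₁ n₂ ϱ p⟩

end

noncomputable section

/-! ## The profile curve -/

/-! Write γ₁ = r₁ e^{iθ₁}, γ₂ = r₂ e^{iθ₂} with r₁² = s² + sinh² ϱ, r₂² = s² + cosh² ϱ, and Z(s, ξ,
η) = (γ₁ X(ξ), γ₂ Y(η)), where X and Y parametrize the sphere and the hyperboloid. In the global
holomorphic chart the map is the affine coordinate of Z, so each claim becomes a computation with Z
in ℂ^{n+1}.

Regularity: p(t) = (t + sinh² ϱ)^{n₁+1} (t + cosh² ϱ)^{n₂+1} satisfies p(0) = c², so p(t) - c² = t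
Q(t) with a polynomial Q that is positive for t ≥ 0. The root in the integrands is |x| q(x) with
q(x) = √Q(x²); the factor |x| cancels, and r_j² θ_j' = c / q is smooth.

Lagrangian immersion: both curves satisfy γ_j' conj(γ_j) = μ with the same μ = s + i c / q. As X has
square 1 and Y has square -1, this gives (dZ, Z) = μ - μ = 0 in the direction of s, and the other
directions are orthogonal to Z as well: Z is a horizontal lift. The products (dZ a, dZ b) are real
(`hermForm_fderiv_fderiv_horizontalLift`). They are the induced metric, and multiplying one entry by
i leaves real part zero, which is the vanishing of the pull-back of ω.

Minimality: for a horizontal lift the Christoffel terms of the ball cancel against the derivative of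
the projection, so the second fundamental form is the projection of the flat D²Z
(`fderiv_fderiv_affineCoord_comp`). In a frame adapted to the product, the trace of D²Z is α Z +
dZ(v) with α complex. The first term projects to 0 and the second is tangent. This rests on an ODE
for γ₁, γ₂ (`exists_profile_minimal`), which amounts to the derivative of s² q² + c² = p(s²).

Embedding: (n₁ + 1) θ₁ + (n₂ + 1) θ₂ = arctan(s q / c), and θ₁, θ₂ have the same sign, so θ₁ - θ₂
stays in (-π/2, π/2); it is also strictly increasing in s. The affine coordinate then determines θ₁
- θ₂, x and y continuously (`ballRetraction`), which gives injectivity and the homeomorphism onto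
the image together. -/

/-- The polynomial `(t + sinh² ϱ)^{n₁+1} (t + cosh² ϱ)^{n₂+1}`. -/
def profilePoly (n₁ n₂ : ℕ) (ϱ : ℝ) : Polynomial ℝ :=
  (Polynomial.X + Polynomial.C (Real.sinh ϱ ^ 2)) ^ (n₁ + 1)
    * (Polynomial.X + Polynomial.C (Real.cosh ϱ ^ 2)) ^ (n₂ + 1)

/-- The value of `profilePoly`. -/
def profileVal (n₁ n₂ : ℕ) (ϱ t : ℝ) : ℝ :=
  (t + Real.sinh ϱ ^ 2) ^ (n₁ + 1) * (t + Real.cosh ϱ ^ 2) ^ (n₂ + 1)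

/-- The difference quotient `(p(t) - p(0)) / t` of `profilePoly`, as a polynomial. -/
def profileQuot (n₁ n₂ : ℕ) (ϱ t : ℝ) : ℝ := (profilePoly n₁ n₂ ϱ).divX.eval t

/-- The smooth function with `curveRoot = |s| profileRoot s`. -/
def profileRoot (n₁ n₂ : ℕ) (ϱ s : ℝ) : ℝ := Real.sqrt (profileQuot n₁ n₂ ϱ (s ^ 2))

section Profile

variable (n₁ n₂ : ℕ) (ϱ : ℝ)

lemma profilePoly_eval (t : ℝ) :
    (profilePoly n₁ n₂ ϱ).eval t = profileVal n₁ n₂ ϱ t := by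
  simp [profilePoly, profileVal]

lemma profileVal_zero : profileVal n₁ n₂ ϱ 0 = curveConst n₁ n₂ ϱ ^ 2 := by
  simp only [profileVal, curveConst]; ring

lemma mul_profileQuot (t : ℝ) :
    t * profileQuot n₁ n₂ ϱ t = profileVal n₁ n₂ ϱ t - curveConst n₁ n₂ ϱ ^ 2 := by
  have h := congrArg (Polynomial.eval t) (Polynomial.divX_mul_X_add (profilePoly n₁ n₂ ϱ))
  rw [← profileVal_zero, ← profilePoly_eval, ← profilePoly_eval]
  simp only [Polynomial.eval_add, Polynomial.eval_mul, Polynomial.eval_X, Polynomial.eval_C] at h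
  rw [profileQuot, ← Polynomial.coeff_zero_eq_eval_zero]
  linarith

variable {ϱ} (hϱ : 0 < ϱ)
include hϱ

lemma sinh_sq_pos : 0 < Real.sinh ϱ ^ 2 := by
  have := Real.sinh_pos_iff.2 hϱ
  positivity

lemma curveConst_pos : 0 < curveConst n₁ n₂ ϱ := by
  have := Real.sinh_pos_iff.2 hϱ
  have := Real.cosh_pos ϱ
  unfold curveConst
  positivity

lemma profileVal_pos {t : ℝ} (ht : 0 ≤ t) : 0 < profileVal n₁ n₂ ϱ t := by
  have := sinh_sq_pos hϱ
  have := Real.cosh_pos ϱ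
  unfold profileVal
  positivity

lemma hasDerivAt_profileVal {t : ℝ} (ht : 0 ≤ t) :
    HasDerivAt (profileVal n₁ n₂ ϱ) (profileVal n₁ n₂ ϱ t *
      ((n₁ + 1) / (t + Real.sinh ϱ ^ 2) + (n₂ + 1) / (t + Real.cosh ϱ ^ 2))) t := by
  have h1 := sinh_sq_pos hϱ
  have h2 := Real.cosh_pos ϱ
  have h := (((hasDerivAt_id t).add_const (Real.sinh ϱ ^ 2)).pow (n₁ + 1)).mul
    (((hasDerivAt_id t).add_const (Real.cosh ϱ ^ 2)).pow (n₂ + 1))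
  refine h.congr_deriv ?_
  have h3 : t + Real.sinh ϱ ^ 2 ≠ 0 := by positivity
  have h4 : t + Real.cosh ϱ ^ 2 ≠ 0 := by positivity
  simp only [profileVal, id, Pi.pow_apply, Nat.cast_add, Nat.cast_one, Nat.add_sub_cancel, pow_succ]
  field_simp

/-- The product rule applied to t Q(t) = p(t) - c²; the right-hand side is p'(t) written as a
logarithmic derivative. -/
lemma profileQuot_add {t : ℝ} (ht : 0 ≤ t) :
    profileQuot n₁ n₂ ϱ t + t * (profilePoly n₁ n₂ ϱ).divX.derivative.eval t
      = profileVal n₁ n₂ ϱ t *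
      ((n₁ + 1) / (t + Real.sinh ϱ ^ 2) + (n₂ + 1) / (t + Real.cosh ϱ ^ 2)) := by
  have h1 := hasDerivAt_profileVal n₁ n₂ hϱ ht
  have h2 : HasDerivAt (fun t => t * profileQuot n₁ n₂ ϱ t) _ t :=
    (hasDerivAt_id t).mul ((profilePoly n₁ n₂ ϱ).divX.hasDerivAt t)
  have h3 := (h2.congr_of_eventuallyEq (Filter.Eventually.of_forall
    fun t => (mul_profileQuot n₁ n₂ ϱ t).symm)).unique (h1.sub_const _)
  simp only [id, one_mul] at h3
  exact h3

lemma profileQuot_pos {t : ℝ} (ht : 0 ≤ t) : 0 < profileQuot n₁ n₂ ϱ t := by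
  have h1 := sinh_sq_pos hϱ
  have h2 := Real.cosh_pos ϱ
  rcases ht.eq_or_lt with rfl | h
  -- At t = 0 the difference quotient is the derivative p'(0); for t > 0 its sign comes from the
  -- monotonicity of p.
  · have h := profileQuot_add n₁ n₂ hϱ le_rfl
    rw [zero_mul, add_zero] at h
    rw [h]
    have := profileVal_pos n₁ n₂ hϱ le_rfl
    positivity
  · have h' := mul_profileQuot n₁ n₂ ϱ t
    have : profileVal n₁ n₂ ϱ 0 < profileVal n₁ n₂ ϱ t := by
      unfold profileVal
      gcongr
    rw [profileVal_zero] at this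
    by_contra hc
    nlinarith

lemma profileRoot_pos (s : ℝ) : 0 < profileRoot n₁ n₂ ϱ s :=
  Real.sqrt_pos.2 (profileQuot_pos n₁ n₂ hϱ (sq_nonneg s))

lemma profileRoot_sq (s : ℝ) : profileRoot n₁ n₂ ϱ s ^ 2 = profileQuot n₁ n₂ ϱ (s ^ 2) :=
  Real.sq_sqrt (profileQuot_pos n₁ n₂ hϱ (sq_nonneg s)).le

/-- `s² q² + c² = (s² + sinh² ϱ)^{n₁+1} (s² + cosh² ϱ)^{n₂+1}`. -/
lemma sq_mul_profileRoot_sq (s : ℝ) :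
    s ^ 2 * profileRoot n₁ n₂ ϱ s ^ 2 + curveConst n₁ n₂ ϱ ^ 2 = profileVal n₁ n₂ ϱ (s ^ 2) := by
  rw [profileRoot_sq n₁ n₂ hϱ, mul_profileQuot]; ring

lemma curveRoot_eq (s : ℝ) : curveRoot n₁ n₂ ϱ s = |s| * profileRoot n₁ n₂ ϱ s := by
  have h := sq_mul_profileRoot_sq n₁ n₂ hϱ s
  have h' : (s ^ 2 + Real.sinh ϱ ^ 2) ^ (n₁ + 1) * (s ^ 2 + Real.cosh ϱ ^ 2) ^ (n₂ + 1)
      - curveConst n₁ n₂ ϱ ^ 2 = (|s| * profileRoot n₁ n₂ ϱ s) ^ 2 := by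
    rw [mul_pow, sq_abs]
    simp only [profileVal] at h
    linarith
  rw [curveRoot, h', Real.sqrt_sq (mul_nonneg (abs_nonneg s) (profileRoot_pos n₁ n₂ hϱ s).le)]

lemma contDiff_profileRoot : ContDiff ℝ ω (profileRoot n₁ n₂ ϱ) := by
  rw [contDiff_iff_contDiffAt]
  intro s
  refine ContDiffAt.sqrt ?_ (profileQuot_pos n₁ n₂ hϱ (sq_nonneg s)).ne'
  have h : ContDiff ℝ ω fun s : ℝ => ((profilePoly n₁ n₂ ϱ).divX).eval (s ^ 2) :=
    (by simpa using (profilePoly n₁ n₂ ϱ).divX.contDiff_aeval (𝕜 := ℝ) ω :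
      ContDiff ℝ ω fun t : ℝ => ((profilePoly n₁ n₂ ϱ).divX).eval t).comp (contDiff_id.pow 2)
  exact h.contDiffAt

/-- This is the derivative of s² q² = p(s²) - c² with the factor 2s cancelled. It is obtained from
Q, not by division, so it also holds at s = 0. Both the angle formula and the minimal surface
equation reduce to it. -/
lemma exists_hasDerivAt_profileRoot (s : ℝ) : ∃ d, HasDerivAt (profileRoot n₁ n₂ ϱ) d s ∧
    profileRoot n₁ n₂ ϱ s * (profileRoot n₁ n₂ ϱ s + s * d) = profileVal n₁ n₂ ϱ (s ^ 2) *
      ((n₁ + 1) / (s ^ 2 + Real.sinh ϱ ^ 2) + (n₂ + 1) / (s ^ 2 + Real.cosh ϱ ^ 2)) := by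
  have h0 := profileQuot_pos n₁ n₂ hϱ (sq_nonneg s)
  have h1 : HasDerivAt (fun s : ℝ => profileQuot n₁ n₂ ϱ (s ^ 2)) _ s :=
    HasDerivAt.comp (h₂ := fun t => (profilePoly n₁ n₂ ϱ).divX.eval t) s
      ((profilePoly n₁ n₂ ϱ).divX.hasDerivAt (s ^ 2)) (hasDerivAt_pow 2 s)
  refine ⟨_, h1.sqrt h0.ne', ?_⟩
  rw [← profileQuot_add n₁ n₂ hϱ (sq_nonneg s), mul_add, ← sq, profileRoot_sq n₁ n₂ hϱ]
  have := profileRoot_pos n₁ n₂ hϱ s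
  change _ + profileRoot n₁ n₂ ϱ s * (s * (_ / (2 * profileRoot n₁ n₂ ϱ s))) = _
  field_simp
  push_cast
  ring

lemma continuous_thetaIntegrand {m : ℝ} (hm : 0 < m) : Continuous fun x : ℝ =>
    curveConst n₁ n₂ ϱ / ((x ^ 2 + m) * profileRoot n₁ n₂ ϱ x) := by
  refine continuous_const.div (((continuous_id.pow 2).add continuous_const).mul
    (contDiff_profileRoot n₁ n₂ hϱ).continuous) fun x => ?_
  have := profileRoot_pos n₁ n₂ hϱ x
  have : 0 < x ^ 2 + m := by positivity
  positivity

/-- After cancelling |x| the integrand is continuous, so the fundamental theorem of calculus applies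
at every s, including 0. -/
lemma hasDerivAt_thetaIntegral {m : ℝ} (hm : 0 < m) (s : ℝ) :
    HasDerivAt (fun s => ∫ x in (0 : ℝ)..s,
      curveConst n₁ n₂ ϱ * |x| / ((x ^ 2 + m) * curveRoot n₁ n₂ ϱ x))
      (curveConst n₁ n₂ ϱ / ((s ^ 2 + m) * profileRoot n₁ n₂ ϱ s)) s := by
  have hc := continuous_thetaIntegrand n₁ n₂ hϱ hm
  have h := intervalIntegral.integral_hasDerivAt_right (hc.intervalIntegrable 0 s)
    (hc.stronglyMeasurableAtFilter _ _) hc.continuousAt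
  refine h.congr_of_eventuallyEq (Filter.Eventually.of_forall fun s => ?_)
  refine intervalIntegral.integral_congr_ae ?_
  -- At x = 0 the original integrand is a division by zero, read as 0, while the smooth one is
  -- positive there; the two agree off this null set.
  have h0 : ∀ᵐ x : ℝ, x ≠ 0 := by simp [MeasureTheory.ae_iff]
  filter_upwards [h0] with x hx _
  rw [curveRoot_eq n₁ n₂ hϱ]
  have : |x| ≠ 0 := abs_ne_zero.2 hx
  have := profileRoot_pos n₁ n₂ hϱ x
  have : 0 < x ^ 2 + m := by positivity
  field_simp

lemma hasDerivAt_theta₁ (s : ℝ) : HasDerivAt (theta₁ n₁ n₂ ϱ)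
    (curveConst n₁ n₂ ϱ / ((s ^ 2 + Real.sinh ϱ ^ 2) * profileRoot n₁ n₂ ϱ s)) s :=
  hasDerivAt_thetaIntegral n₁ n₂ hϱ (sinh_sq_pos hϱ) s

lemma hasDerivAt_theta₂ (s : ℝ) : HasDerivAt (theta₂ n₁ n₂ ϱ)
    (curveConst n₁ n₂ ϱ / ((s ^ 2 + Real.cosh ϱ ^ 2) * profileRoot n₁ n₂ ϱ s)) s :=
  hasDerivAt_thetaIntegral n₁ n₂ hϱ (by have := Real.cosh_pos ϱ; positivity) s

lemma contDiff_of_hasDerivAt_theta {m : ℝ} (hm : 0 < m) {f : ℝ → ℝ} (hf : ∀ s, HasDerivAt f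
    (curveConst n₁ n₂ ϱ / ((s ^ 2 + m) * profileRoot n₁ n₂ ϱ s)) s) : ContDiff ℝ ∞ f := by
  rw [contDiff_infty_iff_deriv]
  refine ⟨fun s => (hf s).differentiableAt, ?_⟩
  rw [show deriv f = _ from funext fun s => (hf s).deriv]
  refine contDiff_const.div (((contDiff_id.pow 2).add contDiff_const).mul
    ((contDiff_profileRoot n₁ n₂ hϱ).of_le le_top)) fun x => ?_
  have := profileRoot_pos n₁ n₂ hϱ x
  have : 0 < x ^ 2 + m := by positivity
  positivity

lemma contDiff_theta₁ : ContDiff ℝ ∞ (theta₁ n₁ n₂ ϱ) :=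
  contDiff_of_hasDerivAt_theta n₁ n₂ hϱ (sinh_sq_pos hϱ) (hasDerivAt_theta₁ n₁ n₂ hϱ)

lemma contDiff_theta₂ : ContDiff ℝ ∞ (theta₂ n₁ n₂ ϱ) :=
  contDiff_of_hasDerivAt_theta n₁ n₂ hϱ (by have := Real.cosh_pos ϱ; positivity)
    (hasDerivAt_theta₂ n₁ n₂ hϱ)

/-- The Lagrangian angle: `(n₁ + 1) θ₁ + (n₂ + 1) θ₂ = arctan (s q / c)`. -/
lemma theta_eq_arctan (s : ℝ) :
    (n₁ + 1) * theta₁ n₁ n₂ ϱ s + (n₂ + 1) * theta₂ n₁ n₂ ϱ s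
      = Real.arctan (s * profileRoot n₁ n₂ ϱ s / curveConst n₁ n₂ ϱ) := by
  have hc := curveConst_pos n₁ n₂ hϱ
  have hd : ∀ s, HasDerivAt (fun s => (n₁ + 1) * theta₁ n₁ n₂ ϱ s + (n₂ + 1) * theta₂ n₁ n₂ ϱ s
      - Real.arctan (s * profileRoot n₁ n₂ ϱ s / curveConst n₁ n₂ ϱ)) 0 s := by
    intro s
    obtain ⟨d, hd, he⟩ := exists_hasDerivAt_profileRoot n₁ n₂ hϱ s
    have h := (((hasDerivAt_theta₁ n₁ n₂ hϱ s).const_mul (n₁ + 1 : ℝ)).add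
      ((hasDerivAt_theta₂ n₁ n₂ hϱ s).const_mul (n₂ + 1 : ℝ))).sub
      ((((hasDerivAt_id s).mul hd).div_const (curveConst n₁ n₂ ϱ)).arctan)
    refine h.congr_deriv ?_
    have hP := sq_mul_profileRoot_sq n₁ n₂ hϱ s
    have hP0 := profileVal_pos n₁ n₂ hϱ (sq_nonneg s)
    have hq := profileRoot_pos n₁ n₂ hϱ s
    have h1 : 0 < s ^ 2 + Real.sinh ϱ ^ 2 := by have := sinh_sq_pos hϱ; positivity
    have h2 : 0 < s ^ 2 + Real.cosh ϱ ^ 2 := by have := Real.cosh_pos ϱ; positivity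
    -- c² + s² q² = p(s²) turns the denominator of the derivative of arctan into p / c².
    have h3 : 1 + (s * profileRoot n₁ n₂ ϱ s / curveConst n₁ n₂ ϱ) ^ 2
        = profileVal n₁ n₂ ϱ (s ^ 2) / curveConst n₁ n₂ ϱ ^ 2 := by
      rw [← hP]; field_simp; ring
    have h4 : profileRoot n₁ n₂ ϱ s + s * d = profileVal n₁ n₂ ϱ (s ^ 2) *
      ((n₁ + 1) / (s ^ 2 + Real.sinh ϱ ^ 2) + (n₂ + 1) / (s ^ 2 + Real.cosh ϱ ^ 2))
        / profileRoot n₁ n₂ ϱ s := by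
      rw [← he]; field_simp
    simp only [id, Pi.mul_apply, one_mul]
    rw [h3, h4]
    field_simp
    ring
  -- Both sides vanish at s = 0, so equal derivatives suffice.
  have h := is_const_of_deriv_eq_zero (fun s => (hd s).differentiableAt) (fun s => (hd s).deriv) s 0
  simp [theta₁, theta₂] at h
  simp only [theta₁, theta₂]
  linarith

/-- The two fractions combine by cosh² ϱ - sinh² ϱ = 1. -/
lemma hasDerivAt_thetaDiff (s : ℝ) : HasDerivAt (fun s => theta₁ n₁ n₂ ϱ s - theta₂ n₁ n₂ ϱ s)
    (curveConst n₁ n₂ ϱ / ((s ^ 2 + Real.sinh ϱ ^ 2) * (s ^ 2 + Real.cosh ϱ ^ 2)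
      * profileRoot n₁ n₂ ϱ s)) s := by
  refine ((hasDerivAt_theta₁ n₁ n₂ hϱ s).sub (hasDerivAt_theta₂ n₁ n₂ hϱ s)).congr_deriv ?_
  have hq := profileRoot_pos n₁ n₂ hϱ s
  have h1 : 0 < s ^ 2 + Real.sinh ϱ ^ 2 := by have := sinh_sq_pos hϱ; positivity
  have h2 : 0 < s ^ 2 + Real.cosh ϱ ^ 2 := by have := Real.cosh_pos ϱ; positivity
  have h3 := Real.cosh_sq ϱ
  field_simp
  linear_combination curveConst n₁ n₂ ϱ * h3

lemma strictMono_thetaDiff : StrictMono fun s => theta₁ n₁ n₂ ϱ s - theta₂ n₁ n₂ ϱ s := by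
  refine strictMono_of_deriv_pos fun s => ?_
  rw [(hasDerivAt_thetaDiff n₁ n₂ hϱ s).deriv]
  have hc := curveConst_pos n₁ n₂ hϱ
  have hq := profileRoot_pos n₁ n₂ hϱ s
  have h1 : 0 < s ^ 2 + Real.sinh ϱ ^ 2 := by have := sinh_sq_pos hϱ; positivity
  have h2 : 0 < s ^ 2 + Real.cosh ϱ ^ 2 := by have := Real.cosh_pos ϱ; positivity
  positivity

lemma strictMono_theta₁ : StrictMono (theta₁ n₁ n₂ ϱ) := by
  refine strictMono_of_deriv_pos fun s => ?_
  rw [(hasDerivAt_theta₁ n₁ n₂ hϱ s).deriv]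
  have hc := curveConst_pos n₁ n₂ hϱ
  have hq := profileRoot_pos n₁ n₂ hϱ s
  have h1 : 0 < s ^ 2 + Real.sinh ϱ ^ 2 := by have := sinh_sq_pos hϱ; positivity
  positivity

lemma strictMono_theta₂ : StrictMono (theta₂ n₁ n₂ ϱ) := by
  refine strictMono_of_deriv_pos fun s => ?_
  rw [(hasDerivAt_theta₂ n₁ n₂ hϱ s).deriv]
  have hc := curveConst_pos n₁ n₂ hϱ
  have hq := profileRoot_pos n₁ n₂ hϱ s
  have h2 : 0 < s ^ 2 + Real.cosh ϱ ^ 2 := by have := Real.cosh_pos ϱ; positivity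
  positivity

/-- For s ≥ 0 all angles are nonnegative and θ₁ - θ₂ ≤ θ₁ ≤ (n₁ + 1) θ₁ + (n₂ + 1) θ₂, which is an
arctangent; the case s ≤ 0 is symmetric. The bound keeps cos(θ₁ - θ₂) positive, so that a point x of
the sphere cannot be confused with its antipode after a phase shift by π. -/
lemma abs_thetaDiff_lt (s : ℝ) : |theta₁ n₁ n₂ ϱ s - theta₂ n₁ n₂ ϱ s| < Real.pi / 2 := by
  have h := theta_eq_arctan n₁ n₂ hϱ s
  have hu := Real.arctan_lt_pi_div_two (s * profileRoot n₁ n₂ ϱ s / curveConst n₁ n₂ ϱ)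
  have hl := Real.neg_pi_div_two_lt_arctan (s * profileRoot n₁ n₂ ϱ s / curveConst n₁ n₂ ϱ)
  rw [← h] at hu hl
  have hm1 := (strictMono_theta₁ n₁ n₂ hϱ).monotone
  have hm2 := (strictMono_theta₂ n₁ n₂ hϱ).monotone
  have z1 : theta₁ n₁ n₂ ϱ 0 = 0 := by simp [theta₁]
  have z2 : theta₂ n₁ n₂ ϱ 0 = 0 := by simp [theta₂]
  have c1 : (0 : ℝ) ≤ n₁ := Nat.cast_nonneg _
  have c2 : (0 : ℝ) ≤ n₂ := Nat.cast_nonneg _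
  rcases le_total 0 s with hs | hs
  · have a1 := hm1 hs
    have a2 := hm2 hs
    have a3 := (strictMono_thetaDiff n₁ n₂ hϱ).monotone hs
    simp only [z1, z2, sub_zero] at a1 a2 a3
    rw [abs_of_nonneg a3]
    nlinarith [mul_nonneg c1 a1, mul_nonneg c2 a2]
  · have a1 := hm1 hs
    have a2 := hm2 hs
    have a3 := (strictMono_thetaDiff n₁ n₂ hϱ).monotone hs
    simp only [z1, z2, sub_zero] at a1 a2 a3
    rw [abs_of_nonpos a3]
    nlinarith [mul_nonneg c1 (neg_nonneg.2 a1), mul_nonneg c2 (neg_nonneg.2 a2)]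

end Profile

/-! ## Complex hyperbolic space in its global chart -/

section Ball

variable {n : ℕ}

lemma extChartAt_complexHyperbolic_target (q : ComplexHyperbolicSpace n) :
    (extChartAt 𝓘(ℝ, EuclideanSpace ℂ (Fin n)) q).target = ball 0 1 := by
  rw [extChartAt_target]
  simp
  rfl

/-- All preferred charts are the same global one, so in coordinates the inverse chart is the
identity near any point of the ball. -/
lemma mfderiv_ofBall (q : ComplexHyperbolicSpace n) {y : EuclideanSpace ℂ (Fin n)} (hy : ‖y‖ < 1)
    (u : EuclideanSpace ℂ (Fin n)) :
    mfderiv 𝓘(ℝ, EuclideanSpace ℂ (Fin n)) 𝓘(ℝ, EuclideanSpace ℂ (Fin n))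
      (extChartAt 𝓘(ℝ, EuclideanSpace ℂ (Fin n)) q).symm y u = u := by
  have hy' : y ∈ ball (0 : EuclideanSpace ℂ (Fin n)) 1 := by simpa using hy
  have hd : MDifferentiableAt 𝓘(ℝ, EuclideanSpace ℂ (Fin n)) 𝓘(ℝ, EuclideanSpace ℂ (Fin n))
      (extChartAt 𝓘(ℝ, EuclideanSpace ℂ (Fin n)) q).symm y := by
    have h := (contMDiffOn_extChartAt_symm (I := 𝓘(ℝ, EuclideanSpace ℂ (Fin n))) (n := ω) q)
    rw [extChartAt_complexHyperbolic_target] at h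
    exact (h.contMDiffAt (isOpen_ball.mem_nhds hy')).mdifferentiableAt (by simp)
  rw [hd.mfderiv]
  have he : writtenInExtChartAt 𝓘(ℝ, EuclideanSpace ℂ (Fin n)) 𝓘(ℝ, EuclideanSpace ℂ (Fin n)) y
      (extChartAt 𝓘(ℝ, EuclideanSpace ℂ (Fin n)) q).symm =ᶠ[nhds y] id := by
    filter_upwards [isOpen_ball.mem_nhds hy'] with w hw
    exact ComplexHyperbolicSpace.toBall_ofBall (w := w) (mem_ball_zero_iff.1 hw)
  simp only [modelWithCornersSelf_coe, Set.range_id, fderivWithin_univ, extChartAt_model_space_eq_id,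
    PartialEquiv.refl_coe, id]
  rw [he.fderiv_eq, fderiv_id]
  rfl

lemma metricInChart_complexHyperbolic (q : ComplexHyperbolicSpace n)
    {y : EuclideanSpace ℂ (Fin n)} (hy : ‖y‖ < 1) (u v : EuclideanSpace ℂ (Fin n)) :
    metricInChart (complexHyperbolicMetric n) q y u v = ballMetric y u v := by
  rw [metricInChart, mfderiv_ofBall q hy, mfderiv_ofBall q hy]
  change ballMetric (ComplexHyperbolicSpace.ofBall y).toBall u v = _
  rw [ComplexHyperbolicSpace.toBall_ofBall hy]

/-- The Christoffel correction `∇_a b` of constant vector fields on the unit ball. -/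
def ballChristoffel (w a b : EuclideanSpace ℂ (Fin n)) : EuclideanSpace ℂ (Fin n) :=
  (1 - ‖w‖ ^ 2 : ℂ)⁻¹ • (inner ℂ w a • b + inner ℂ w b • a)

/-- The derivative of `ballMetric w b c` with respect to `w` in the direction `a`. -/
lemma fderiv_ballMetric {w : EuclideanSpace ℂ (Fin n)} (hw : ‖w‖ < 1)
    (a b c : EuclideanSpace ℂ (Fin n)) :
    fderiv ℝ (fun w' => ballMetric w' b c) w a
      = (inner ℂ c b * (2 * (inner ℂ w a).re : ℝ) / (1 - ‖w‖ ^ 2 : ℂ) ^ 2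
        + (inner ℂ a b * inner ℂ c w + inner ℂ w b * inner ℂ c a) / (1 - ‖w‖ ^ 2 : ℂ) ^ 2
        + inner ℂ w b * inner ℂ c w * (4 * (inner ℂ w a).re : ℝ)
          / (1 - ‖w‖ ^ 2 : ℂ) ^ 3).re := by
  have h1 : 0 < 1 - ‖w‖ ^ 2 := by nlinarith [norm_nonneg w]
  have h1' : (1 - ‖w‖ ^ 2 : ℂ) ≠ 0 := by exact_mod_cast h1.ne'
  -- The derivative is computed along the line w + t a, where the one-variable quotient rule
  -- applies; differentiability in w is checked separately, and uniqueness identifies the two.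
  have hn : HasDerivAt (fun t : ℝ => ‖w + t • a‖ ^ 2) (2 * (inner ℂ w a).re) 0 := by
    have h : HasDerivAt (fun t : ℝ => w + t • a) a 0 := by
      simpa using ((hasDerivAt_id (0 : ℝ)).smul_const a).const_add w
    have hi : inner ℝ w a = (inner ℂ w a).re := by
      simp [PiLp.inner_apply, Complex.inner]
    simpa [hi] using h.norm_sq
  have hp : HasDerivAt (fun t : ℝ => (1 - ‖w + t • a‖ ^ 2 : ℂ)) (-(2 * (inner ℂ w a).re : ℝ)) 0 := by
    have := hn.ofReal_comp.const_sub 1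
    simpa using this
  have hl : HasDerivAt (fun t : ℝ => w + t • a) a 0 := by
    simpa using ((hasDerivAt_id (0 : ℝ)).smul_const a).const_add w
  have hA : HasDerivAt (fun t : ℝ => inner ℂ (w + t • a) b) (inner ℂ a b) 0 := by
    have h := hl.inner ℂ (hasDerivAt_const (0 : ℝ) b)
    rwa [inner_zero_right, zero_add] at h
  have hB : HasDerivAt (fun t : ℝ => inner ℂ c (w + t • a)) (inner ℂ c a) 0 := by
    have h := (hasDerivAt_const (0 : ℝ) c).inner ℂ hl
    rwa [inner_zero_left, add_zero] at h
  have hz : (1 - ‖w + (0 : ℝ) • a‖ ^ 2 : ℂ) ≠ 0 := by simpa using h1'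
  have hF := (((hasDerivAt_const (0 : ℝ) (inner ℂ c b)).div hp hz).add
    ((hA.mul hB).div (hp.pow 2) (pow_ne_zero 2 hz)))
  have hR := Complex.reCLM.hasFDerivAt.comp_hasDerivAt (0 : ℝ) hF
  have hd : DifferentiableAt ℝ (fun w' => ballMetric w' b c) w := by
    simp only [ballMetric_apply]
    refine Complex.reCLM.differentiableAt.comp w (f := fun w' => inner ℂ c b / (1 - ‖w'‖ ^ 2 : ℂ)
      + inner ℂ w' b * inner ℂ c w' / (1 - ‖w'‖ ^ 2 : ℂ) ^ 2) ?_
    have hp : DifferentiableAt ℝ (fun w' : EuclideanSpace ℂ (Fin n) => (1 - ‖w'‖ ^ 2 : ℂ)) w := by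
      have h : DifferentiableAt ℝ (fun w' : EuclideanSpace ℂ (Fin n) => ((‖w'‖ ^ 2 : ℝ) : ℂ)) w :=
        Complex.ofRealCLM.differentiableAt.comp w (differentiableAt_id.norm_sq ℝ)
      simpa using h.const_sub 1
    simp only [div_eq_mul_inv]
    have hp2 : DifferentiableAt ℝ
        (fun w' : EuclideanSpace ℂ (Fin n) => ((1 - ‖w'‖ ^ 2 : ℂ) ^ 2)⁻¹) w :=
      (hp.pow 2).fun_inv (pow_ne_zero 2 h1')
    refine ((hp.fun_inv h1').const_mul _).add (DifferentiableAt.mul ?_ hp2)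
    exact (differentiableAt_id.inner ℂ (differentiableAt_const _)).mul
      ((differentiableAt_const _).inner ℂ differentiableAt_id)
  have hc := hd.hasFDerivAt
  have hc' : HasFDerivAt (fun w' => ballMetric w' b c) (fderiv ℝ (fun w' => ballMetric w' b c) w)
    (w + (0 : ℝ) • a) := by simpa using hc
  have hu := (hc'.comp_hasDerivAt (0 : ℝ) hl).unique hR
  rw [hu]
  simp only [Complex.reCLM_apply]
  congr 1
  simp only [zero_smul, add_zero, Pi.mul_apply, Pi.pow_apply]
  field_simp
  push_cast
  ring

lemma christoffel_complexHyperbolic (q : ComplexHyperbolicSpace n)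
    {w : EuclideanSpace ℂ (Fin n)} (hw : ‖w‖ < 1) (a b c : EuclideanSpace ℂ (Fin n)) :
    christoffel (complexHyperbolicMetric n) q w a b c = ballMetric w (ballChristoffel w a b) c := by
  have hw' : w ∈ ball (0 : EuclideanSpace ℂ (Fin n)) 1 := by simpa using hw
  have he : ∀ u v : EuclideanSpace ℂ (Fin n),
      (fun y' => metricInChart (complexHyperbolicMetric n) q y' u v)
        =ᶠ[nhds w] fun y' => ballMetric y' u v := by
    intro u v
    filter_upwards [isOpen_ball.mem_nhds hw'] with y hy
    exact metricInChart_complexHyperbolic q (by simpa using hy) u v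
  have h1 : 0 < 1 - ‖w‖ ^ 2 := by nlinarith [norm_nonneg w]
  rw [christoffel, (he b c).fderiv_eq, (he a c).fderiv_eq, (he a b).fderiv_eq,
    fderiv_ballMetric hw, fderiv_ballMetric hw, fderiv_ballMetric hw, ballMetric_apply,
    ballChristoffel]
  simp only [inner_smul_right, inner_add_right]
  -- Up to conjugation only six inner products occur. Treating them as independent complex numbers
  -- makes the claim an identity between real and imaginary parts.
  rw [← inner_conj_symm a b, ← inner_conj_symm b w, ← inner_conj_symm b c, ← inner_conj_symm c w]
  generalize inner ℂ b a = x1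
  generalize inner ℂ w a = x2
  generalize inner ℂ w b = x3
  generalize inner ℂ c a = x4
  generalize inner ℂ c b = x5
  generalize inner ℂ w c = x6
  obtain ⟨p, hp⟩ : ∃ p, p = 1 - ‖w‖ ^ 2 := ⟨_, rfl⟩
  have hpr : (1 - ‖w‖ ^ 2 : ℂ) = (p : ℂ) := by rw [hp]; push_cast; rfl
  rw [← hp] at h1
  rw [hpr]
  simp only [← Complex.ofReal_pow, Complex.div_ofReal_re, Complex.add_re, Complex.mul_re,
    ← Complex.ofReal_inv, Complex.mul_im, Complex.ofReal_re, Complex.ofReal_im, Complex.conj_re,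
    Complex.conj_im, Complex.add_im]
  field_simp
  ring

/-- The differential of the affine coordinate. -/
def affineDiff (z u : Fin (n + 1) → ℂ) : EuclideanSpace ℂ (Fin n) :=
  WithLp.toLp 2 fun i =>
    (u i.castSucc * z (Fin.last n) - z i.castSucc * u (Fin.last n)) / z (Fin.last n) ^ 2

lemma affineDiff_add (z u v : Fin (n + 1) → ℂ) :
    affineDiff z (u + v) = affineDiff z u + affineDiff z v := by
  ext i; simp [affineDiff]; ring

lemma affineDiff_smul (z u : Fin (n + 1) → ℂ) (c : ℂ) :
    affineDiff z (c • u) = c • affineDiff z u := by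
  ext i; simp [affineDiff]; ring

lemma affineDiff_self (z : Fin (n + 1) → ℂ) : affineDiff z z = 0 := by
  ext i; simp [affineDiff]

/-- `affineDiff z` as a linear map. -/
def affineDiffₗ (z : Fin (n + 1) → ℂ) : (Fin (n + 1) → ℂ) →ₗ[ℂ] EuclideanSpace ℂ (Fin n) where
  toFun := affineDiff z
  map_add' := affineDiff_add z
  map_smul' c u := affineDiff_smul z u c

lemma ballMetric_affineDiff (z : AntiDeSitter n) (u v : Fin (n + 1) → ℂ)
    (hu : hermForm u z.1 = 0) (hv : hermForm v z.1 = 0) :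
    ballMetric (affineCoord z.1) (affineDiff z.1 u) (affineDiff z.1 v) = (hermForm u v).re := by
  have h := ballMetric_submersion z u v hu hv
  rwa [fderiv_affineCoord, fderiv_affineCoord] at h

/-- The factor 1 - |w|² cancels the one in `ballChristoffel`, so on horizontal vectors the
Christoffel coefficients become the plain ratios u_{n+1} / z_{n+1}. -/
lemma inner_affineCoord_affineDiff (z : AntiDeSitter n) (u : Fin (n + 1) → ℂ)
    (hu : hermForm u z.1 = 0) :
    inner ℂ (affineCoord z.1) (affineDiff z.1 u)
      = (1 - ‖affineCoord z.1‖ ^ 2 : ℂ) * (u (Fin.last n) / z.1 (Fin.last n)) := by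
  have hl := z.last_ne_zero
  have h1 : (1 - ‖affineCoord z.1‖ ^ 2 : ℂ)
      = (z.1 (Fin.last n) * (starRingEnd ℂ) (z.1 (Fin.last n)))⁻¹ := by
    have h := congrArg (Complex.ofReal) z.one_sub_norm_affineCoord_sq
    push_cast at h
    rw [h, Complex.mul_conj, Complex.normSq_eq_norm_sq]
    push_cast
    rw [inv_pow]
  have hD : ∑ i : Fin n, z.1 i.castSucc * (starRingEnd ℂ) (z.1 i.castSucc)
      = z.1 (Fin.last n) * (starRingEnd ℂ) (z.1 (Fin.last n)) - 1 := by
    have h := z.2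
    simp only [hermForm, Complex.star_def] at h
    linear_combination h
  have hB : ∑ i : Fin n, u i.castSucc * (starRingEnd ℂ) (z.1 i.castSucc)
      = u (Fin.last n) * (starRingEnd ℂ) (z.1 (Fin.last n)) := sub_eq_zero.1 hu
  rw [h1, PiLp.inner_apply]
  generalize hc : z.1 (Fin.last n) = c at *
  have hc' : (starRingEnd ℂ) c ≠ 0 := by simpa using hl
  have h : ∀ i : Fin n, inner ℂ ((affineCoord z.1).ofLp i) ((affineDiff z.1 u).ofLp i)
        = (c ^ 2 * (starRingEnd ℂ) c)⁻¹ * (c * (u i.castSucc * (starRingEnd ℂ) (z.1 i.castSucc))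
          - u (Fin.last n) * (z.1 i.castSucc * (starRingEnd ℂ) (z.1 i.castSucc))) := by
    intro i
    simp only [affineCoord, affineDiff, RCLike.inner_apply, map_div₀, hc]
    field_simp
  rw [Finset.sum_congr rfl fun i _ => h i, ← Finset.mul_sum, Finset.sum_sub_distrib,
    ← Finset.mul_sum, ← Finset.mul_sum, hB, hD]
  field_simp
  ring

/-! ### The Gauss formula for horizontal lifts -/

section Lift

variable {E : Type*} [NormedAddCommGroup E] [NormedSpace ℝ E] {Z : E → Fin (n + 1) → ℂ}

lemma hasFDerivAt_affineCoord_comp {x : E} {Z' : E →L[ℝ] Fin (n + 1) → ℂ}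
    (hZ : HasFDerivAt Z Z' x) (hz : hermForm (Z x) (Z x) = -1) :
    HasFDerivAt (fun x => affineCoord (Z x))
      ((affineDiffₗ (Z x)).restrictScalars ℝ |>.toContinuousLinearMap |>.comp Z') x := by
  have hl := AntiDeSitter.last_ne_zero ⟨Z x, hz⟩
  have h : ∀ i : Fin n, HasFDerivAt (𝕜 := ℝ)
      (fun y : Fin (n + 1) → ℂ => y i.castSucc * (y (Fin.last n))⁻¹) _ (Z x) := fun i =>
    (hasFDerivAt_apply (𝕜 := ℝ) i.castSucc (Z x)).mul'
      ((hasFDerivAt_inv hl).restrictScalars ℝ |>.comp (Z x) (hasFDerivAt_apply (Fin.last n) (Z x)))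
  have hd : DifferentiableAt ℝ affineCoord (Z x) :=
    ((PiLp.hasFDerivAt_toLp (𝕜 := ℝ) 2 _).comp (Z x) (hasFDerivAt_pi.2 h)).differentiableAt
  refine (hd.hasFDerivAt.comp x hZ).congr_fderiv ?_
  ext1 u
  exact fderiv_affineCoord ⟨Z x, hz⟩ (Z' u)

lemma fderiv_affineCoord_comp {x : E} (hZ : DifferentiableAt ℝ Z x)
    (hz : hermForm (Z x) (Z x) = -1) (a : E) :
    fderiv ℝ (fun x => affineCoord (Z x)) x a = affineDiff (Z x) (fderiv ℝ Z x a) := by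
  rw [(hasFDerivAt_affineCoord_comp hZ.hasFDerivAt hz).fderiv]
  rfl

/-- The Gauss formula for a horizontal lift `Z`: the second covariant derivative of
`affineCoord ∘ Z` is the projection of the flat second derivative of `Z`. -/
lemma fderiv_fderiv_affineCoord_comp (hZ : ContDiff ℝ 2 Z)
    (hz : ∀ x, hermForm (Z x) (Z x) = -1) (hh : ∀ x a, hermForm (fderiv ℝ Z x a) (Z x) = 0)
    (x a b : E) :
    fderiv ℝ (fun x' => fderiv ℝ (fun x => affineCoord (Z x)) x' b) x a
      + ballChristoffel (affineCoord (Z x)) (fderiv ℝ (fun x => affineCoord (Z x)) x a)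
          (fderiv ℝ (fun x => affineCoord (Z x)) x b)
      = affineDiff (Z x) (fderiv ℝ (fderiv ℝ Z) x a b) := by
  have hZd : Differentiable ℝ Z := hZ.differentiable (by norm_num)
  have hl : ∀ x, Z x (Fin.last n) ≠ 0 := fun x => AntiDeSitter.last_ne_zero ⟨Z x, hz x⟩
  have hZ1 : Differentiable ℝ (fderiv ℝ Z) :=
    (hZ.fderiv_right (m := 1) (by norm_num)).differentiable (by norm_num)
  have h2 : HasFDerivAt (fun x' => fderiv ℝ Z x' b) ((fderiv ℝ (fderiv ℝ Z) x).flip b) x := by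
    simpa using (hZ1 x).hasFDerivAt.clm_apply (hasFDerivAt_const b x)
  have hcoord : ∀ (W : E → Fin (n + 1) → ℂ) (W' : E →L[ℝ] Fin (n + 1) → ℂ) (i : Fin (n + 1)),
      HasFDerivAt W W' x → HasDerivAt (fun t : ℝ => W (x + t • a) i) (W' a i) 0 := by
    intro W W' i h
    have h1 : HasDerivAt (fun t : ℝ => x + t • a) a 0 := by
      simpa using ((hasDerivAt_id (0 : ℝ)).smul_const a).const_add x
    have h' : HasFDerivAt W W' (x + (0 : ℝ) • a) := by simpa using h
    exact hasDerivAt_pi.1 (h'.comp_hasDerivAt (0 : ℝ) h1) i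
  have hf : ∀ x' c, fderiv ℝ (fun x => affineCoord (Z x)) x' c
      = affineDiff (Z x') (fderiv ℝ Z x' c) := fun x' c =>
    fderiv_affineCoord_comp (hZd x') (hz x') c
  have hf' : (fun x' => fderiv ℝ (fun x => affineCoord (Z x)) x' b)
      = fun x' => affineDiff (Z x') (fderiv ℝ Z x' b) := funext fun x' => hf x' b
  rw [hf', hf, hf]
  -- With these ratios as coefficients, the Christoffel term cancels exactly what differentiating
  -- the base point z of `affineDiff` produces, leaving only the second derivative of Z.
  have hlast : ∀ u : Fin (n + 1) → ℂ, hermForm u (Z x) = 0 →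
      (1 - ‖affineCoord (Z x)‖ ^ 2 : ℂ)⁻¹ * inner ℂ (affineCoord (Z x)) (affineDiff (Z x) u)
        = u (Fin.last n) / Z x (Fin.last n) := by
    intro u hu
    rw [inner_affineCoord_affineDiff ⟨Z x, hz x⟩ u hu, inv_mul_cancel_left₀]
    have h := AntiDeSitter.norm_affineCoord_lt ⟨Z x, hz x⟩
    have h1 : 0 < 1 - ‖affineCoord (Z x)‖ ^ 2 := by nlinarith [norm_nonneg (affineCoord (Z x))]
    exact_mod_cast h1.ne'
  rw [ballChristoffel, smul_add, smul_smul, smul_smul, hlast _ (hh x a), hlast _ (hh x b)]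
  have hdiff : DifferentiableAt ℝ (fun x' => affineDiff (Z x') (fderiv ℝ Z x' b)) x := by
    rw [differentiableAt_piLp]
    intro i
    have hz' : ∀ j, DifferentiableAt ℝ (fun x' => Z x' j) x := differentiableAt_pi.1 (hZd x)
    have hb' : ∀ j, DifferentiableAt ℝ (fun x' => fderiv ℝ Z x' b j) x :=
      differentiableAt_pi.1 h2.differentiableAt
    simp only [affineDiff, div_eq_mul_inv]
    exact (((hb' _).mul (hz' _)).sub ((hz' _).mul (hb' _))).mul
      (((hz' _).pow 2).fun_inv (pow_ne_zero 2 (hl x)))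
  ext i
  have hline : HasDerivAt
      (fun t : ℝ => (affineDiff (Z (x + t • a)) (fderiv ℝ Z (x + t • a) b)).ofLp i)
      ((fderiv ℝ (fun x' => affineDiff (Z x') (fderiv ℝ Z x' b)) x a).ofLp i) 0 := by
    have h1 : HasDerivAt (fun t : ℝ => x + t • a) a 0 := by
      simpa using ((hasDerivAt_id (0 : ℝ)).smul_const a).const_add x
    have h' := (PiLp.hasFDerivAt_apply (𝕜 := ℝ) 2 _ i).comp x hdiff.hasFDerivAt
    exact HasFDerivAt.comp_hasDerivAt_of_eq (0 : ℝ) h' h1 (by simp)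
  have hzc := fun j => hcoord Z _ j (hZd x).hasFDerivAt
  have hbc := fun j => hcoord _ _ j h2
  have hx0 : x + (0 : ℝ) • a = x := by simp
  have hexp := (((hbc i.castSucc).mul (hzc (Fin.last n))).sub
    ((hzc i.castSucc).mul (hbc (Fin.last n)))).div ((hzc (Fin.last n)).pow 2)
      (by rw [Pi.pow_apply, hx0]; exact pow_ne_zero 2 (hl x))
  have hu := hline.unique hexp
  rw [PiLp.add_apply, hu]
  simp only [hx0, affineDiff, Pi.mul_apply, Pi.sub_apply, Pi.pow_apply, PiLp.add_apply,
    PiLp.smul_apply, smul_eq_mul, ContinuousLinearMap.flip_apply]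
  have := hl x
  field_simp
  ring

end Lift

end Ball

/-! ## Immersions and the inverse function theorem -/

section Immersion

/-- The local inverse of the inverse function theorem, with its domain shrunk so that it is smooth
in both directions. -/
lemma exists_smooth_localInverse {E F : Type*} [NormedAddCommGroup E] [NormedSpace ℝ E]
    [CompleteSpace E] [NormedAddCommGroup F] [NormedSpace ℝ F] {Ψ : E → F} {U : Set E}
    (hU : IsOpen U) (hΨ : ContDiffOn ℝ ∞ Ψ U) {a : E} (ha : a ∈ U) {Ψ' : E ≃L[ℝ] F}
    (hd : HasFDerivAt Ψ (Ψ' : E →L[ℝ] F) a) :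
    ∃ e : OpenPartialHomeomorph E F, a ∈ e.source ∧ e.source ⊆ U ∧ (∀ y, e y = Ψ y) ∧
      ContDiffOn ℝ ∞ e.symm e.target := by
  have hat : ∀ y ∈ U, ContDiffAt ℝ ∞ Ψ y := fun y hy => hΨ.contDiffAt (hU.mem_nhds hy)
  let e := (hat a ha).toOpenPartialHomeomorph Ψ hd (by simp)
  -- Invertible differentials form an open set. Restricting to the points where the differential is
  -- invertible makes the inverse smooth on its whole domain and not only at the image of a.
  have hW : IsOpen (U ∩ fderiv ℝ Ψ ⁻¹' Set.range ((↑) : (E ≃L[ℝ] F) → E →L[ℝ] F)) :=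
    (hΨ.continuousOn_fderiv_of_isOpen hU (by simp)).isOpen_inter_preimage hU
      ContinuousLinearEquiv.isOpen
  refine ⟨e.restrOpen _ hW, ⟨(hat a ha).mem_toOpenPartialHomeomorph_source hd (by simp), ha, Ψ',
    hd.fderiv.symm⟩, fun y hy => hy.2.1, fun y => rfl, fun y hy => ?_⟩
  have hy' := (e.restrOpen _ hW).map_target hy
  obtain ⟨A, hA⟩ := hy'.2.2
  have hc := hat _ hy'.2.1
  have hdy := (hc.differentiableAt (by simp)).hasFDerivAt
  rw [← hA] at hdy
  exact ((e.restrOpen _ hW).contDiffAt_symm hy hdy hc).contDiffWithinAt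

/-- An injective linear map between finite-dimensional spaces extends to an isomorphism from the
product with any space of complementary dimension. -/
lemma exists_equiv_of_injective {E F C : Type*} [NormedAddCommGroup E] [NormedSpace ℝ E]
    [FiniteDimensional ℝ E] [NormedAddCommGroup F] [NormedSpace ℝ F] [FiniteDimensional ℝ F]
    [NormedAddCommGroup C] [NormedSpace ℝ C] [FiniteDimensional ℝ C]
    (hC : Module.finrank ℝ E + Module.finrank ℝ C = Module.finrank ℝ F)
    (A : E →L[ℝ] F) (hA : Function.Injective A) :
    ∃ (L : C →L[ℝ] F) (e : (E × C) ≃L[ℝ] F), ∀ p, e p = A p.1 + L p.2 := by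
  obtain ⟨K, hK⟩ := Submodule.exists_isCompl (LinearMap.range (A : E →ₗ[ℝ] F))
  let l := ((LinearEquiv.ofInjective (A : E →ₗ[ℝ] F) hA).prodCongr (LinearEquiv.refl ℝ K)).trans
    (Submodule.prodEquivOfIsCompl _ K hK)
  have h1 := l.finrank_eq
  rw [Module.finrank_prod] at h1
  let m : C ≃ₗ[ℝ] K := LinearEquiv.ofFinrankEq C K (by omega)
  exact ⟨K.subtypeL.comp (m.toContinuousLinearEquiv : C →L[ℝ] K),
    (((LinearEquiv.refl ℝ E).prodCongr m).trans l).toContinuousLinearEquiv, fun p => rfl⟩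

variable {E E' : Type*} [NormedAddCommGroup E] [NormedSpace ℝ E] [FiniteDimensional ℝ E]
  [NormedAddCommGroup E'] [NormedSpace ℝ E'] [FiniteDimensional ℝ E']
  {C : Type*} [NormedAddCommGroup C] [NormedSpace ℝ C] [FiniteDimensional ℝ C]
  {H : Type*} [TopologicalSpace H] {I : ModelWithCorners ℝ E H} [I.Boundaryless]
  {M : Type*} [TopologicalSpace M] [ChartedSpace H M] [IsManifold I ∞ M]
  {N : Type*} [TopologicalSpace N] [ChartedSpace E' N] [IsManifold 𝓘(ℝ, E') ∞ N]

/-- A smooth map between finite-dimensional manifolds whose differential is injective at a point is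
an immersion there. -/
theorem isImmersionAtOfComplement_of_injective_mfderiv
    (hC : Module.finrank ℝ E + Module.finrank ℝ C = Module.finrank ℝ E') {f : M → N}
    (hf : ContMDiff I 𝓘(ℝ, E') ∞ f) {x : M}
    (hx : Function.Injective (mfderiv I 𝓘(ℝ, E') f x)) :
    Manifold.IsImmersionAtOfComplement C I 𝓘(ℝ, E') ∞ f x := by
  let g : E → E' := writtenInExtChartAt I 𝓘(ℝ, E') x f
  let x₀ : E := extChartAt I x x
  let U : Set E := (extChartAt I x).target ∩
    (extChartAt I x).symm ⁻¹' (f ⁻¹' (chartAt E' (f x)).source)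
  have hUo : IsOpen U := (continuousOn_extChartAt_symm x).isOpen_inter_preimage
    (isOpen_extChartAt_target x) ((chartAt E' (f x)).open_source.preimage hf.continuous)
  have hx₀ : x₀ ∈ U := ⟨mem_extChartAt_target x, by simp [x₀]⟩
  have hg : ContDiffOn ℝ ∞ g U := by
    have := (contMDiff_iff.1 hf).2 x (f x)
    simpa [U, g, writtenInExtChartAt, extChartAt_source] using this
  have hmd : MDifferentiableAt I 𝓘(ℝ, E') f x := (hf x).mdifferentiableAt (by simp)
  let A : E →L[ℝ] E' := mfderiv I 𝓘(ℝ, E') f x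
  have hgd : HasFDerivAt g A x₀ := by
    have h : HasFDerivWithinAt g A (Set.range I) x₀ := hmd.hasMFDerivAt.2
    rwa [I.range_eq_univ, hasFDerivWithinAt_univ] at h
  obtain ⟨B, e, he⟩ := exists_equiv_of_injective hC A hx
  -- The coordinate expression of f is thickened by a complement of the range of its differential,
  -- to which the inverse function theorem applies at (x₀, 0).
  let Ψ : E × C → E' := fun p => g p.1 + B p.2
  have hΨ : ContDiffOn ℝ ∞ Ψ (U ×ˢ Set.univ) :=
    (hg.comp contDiff_fst.contDiffOn fun p hp => hp.1).add
      (B.contDiff.comp contDiff_snd).contDiffOn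
  have hΨd : HasFDerivAt Ψ (e : E × C →L[ℝ] E') (x₀, 0) := by
    have h := (hgd.comp (x₀, (0 : C)) (hasFDerivAt_fst (𝕜 := ℝ) (p := (x₀, (0 : C))))).add
      (B.hasFDerivAt.comp (x₀, (0 : C)) (hasFDerivAt_snd (𝕜 := ℝ)))
    exact h.congr_fderiv (ContinuousLinearMap.ext fun p => (he p).symm)
  obtain ⟨L, haL, hLU, hL, hLs⟩ := exists_smooth_localInverse (hUo.prod isOpen_univ) hΨ
    (⟨hx₀, trivial⟩ : (x₀, (0 : C)) ∈ U ×ˢ Set.univ) hΨd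
  have hLd : ContDiffOn ℝ ∞ L L.source := (hΨ.mono hLU).congr fun p _ => hL p
  -- Following the chart of N by the local inverse of Ψ, and then by the linear identification e,
  -- straightens f to u ↦ e (u, 0), the normal form of an immersion.
  let K : OpenPartialHomeomorph E' E' :=
    L.symm.trans e.toHomeomorph.toOpenPartialHomeomorph
  have hKs : K.source = L.target := by simp [K]
  have hKd : ContDiffOn ℝ ∞ K K.source := by
    rw [hKs]
    exact e.contDiff.comp_contDiffOn hLs
  have hKd' : ContDiffOn ℝ ∞ K.symm K.target := by
    have : K.target = e.symm ⁻¹' L.source := by simp [K]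
    rw [this]
    exact hLd.comp e.symm.contDiff.contDiffOn fun y hy => hy
  let ψ := (chartAt E' (f x)).trans K
  have hψ : ψ ∈ IsManifold.maximalAtlas 𝓘(ℝ, E') ∞ N := by
    refine OpenPartialHomeomorph.mem_maximalAtlas_of_contMDiffOn ψ ?_ ?_
    · exact hKd.contMDiffOn.comp ((contMDiffOn_chart (x := f x)).mono fun y hy => hy.1)
        fun y hy => hy.2
    · exact (contMDiffOn_chart_symm (x := f x)).comp (hKd'.contMDiffOn.mono fun y hy => hy.1)
        fun y hy => hy.2
  -- The source chart is cut down so that (u, 0) lies in the domain on which Ψ is inverted.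
  let D : Set M := (extChartAt I x).source ∩ extChartAt I x ⁻¹' {u | (u, (0 : C)) ∈ L.source}
  have hD : IsOpen D := (continuousOn_extChartAt x).isOpen_inter_preimage
    (isOpen_extChartAt_source x) (L.open_source.preimage (by fun_prop))
  have hsymm : ∀ p ∈ L.source, L.symm (Ψ p) = p := fun p hp => by
    rw [← hL]; exact L.left_inv hp
  have hgx : chartAt E' (f x) (f x) = Ψ (x₀, 0) := by
    simp [Ψ, g, x₀, writtenInExtChartAt]
  refine Manifold.IsImmersionAtOfComplement.mk_of_continuousAt hf.continuous.continuousAt e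
    ((chartAt H x).restr D) ψ ?_ ?_ ?_ hψ ?_
  · rw [OpenPartialHomeomorph.restr_source' _ _ hD]
    exact ⟨mem_chart_source H x, mem_extChartAt_source x, haL⟩
  · refine ⟨mem_chart_source E' (f x), ?_⟩
    change chartAt E' (f x) (f x) ∈ K.source
    rw [hKs, hgx, ← hL]
    exact L.map_source haL
  · exact restr_mem_maximalAtlas _ (IsManifold.chart_mem_maximalAtlas x) hD
  · intro u hu
    have hu' : (u, (0 : C)) ∈ L.source := by
      have h1 := hu
      simp only [OpenPartialHomeomorph.extend_target, Set.mem_inter_iff, Set.mem_preimage,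
        OpenPartialHomeomorph.restr_target, hD.interior_eq] at h1
      have h2 := h1.1.2.2
      simpa [(chartAt H x).right_inv h1.1.1, I.right_inv h1.2] using h2
    change e (L.symm (g u)) = e (u, 0)
    have : g u = Ψ (u, 0) := by simp [Ψ]
    rw [this, hsymm _ hu']

end Immersion

/-! ## Orthonormal frames and parametrized quadrics -/

section Frames

variable {E : Type*} [AddCommGroup E] [Module ℝ E]

lemma eq_sum_of_orthonormal [FiniteDimensional ℝ E] {ι : Type*} [Fintype ι] [DecidableEq ι]
    (g : E →ₗ[ℝ] E →ₗ[ℝ] ℝ) {e : ι → E} (he : ∀ i j, g (e i) (e j) = if i = j then 1 else 0)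
    (hc : Fintype.card ι = Module.finrank ℝ E) (v : E) : v = ∑ i, g v (e i) • e i := by
  have hl : LinearIndependent ℝ e := by
    rw [Fintype.linearIndependent_iff]
    intro c hc i
    have h := congrArg (fun v => g v (e i)) hc
    simpa [he] using h
  let b := basisOfLinearIndependentOfCardEqFinrank' e hl hc
  have hb : ∀ i, b i = e i := fun i => by simp [b]
  have hs : v = ∑ i, b.repr v i • e i := by
    conv_lhs => rw [← b.sum_repr v]
    simp [hb]
  have hv : ∀ i, g v (e i) = b.repr v i := by
    intro i
    conv_lhs => rw [hs]
    simp [he]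
  simp only [hv]
  exact hs

/-- The trace of a bilinear form does not depend on the orthonormal frame. -/
lemma sum_bilin_orthonormal [FiniteDimensional ℝ E] {ι κ : Type*} [Fintype ι] [DecidableEq ι]
    [Fintype κ] [DecidableEq κ]
    (g B : E →ₗ[ℝ] E →ₗ[ℝ] ℝ) (hg : ∀ u v, g u v = g v u) {e : ι → E} {f : κ → E}
    (he : ∀ i j, g (e i) (e j) = if i = j then 1 else 0)
    (hf : ∀ i j, g (f i) (f j) = if i = j then 1 else 0)
    (hι : Fintype.card ι = Module.finrank ℝ E) (hκ : Fintype.card κ = Module.finrank ℝ E) :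
    ∑ i, B (e i) (e i) = ∑ j, B (f j) (f j) := by
  -- Expanding one argument of each trace in the other frame produces the same double sum.
  have h1 : ∀ i, B (e i) (e i) = ∑ j, g (e i) (f j) * B (f j) (e i) := by
    intro i
    have := congrArg (fun v => B v (e i)) (eq_sum_of_orthonormal g hf hκ (e i))
    simpa using this
  have h2 : ∀ j, B (f j) (f j) = ∑ i, g (e i) (f j) * B (f j) (e i) := by
    intro j
    have := congrArg (fun v => B (f j) v) (eq_sum_of_orthonormal g he hι (f j))
    simpa [hg (f j)] using this
  simp only [h1, h2]
  exact Finset.sum_comm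

/-- A positive definite symmetric bilinear form has an orthonormal frame. -/
lemma exists_orthonormal_frame [FiniteDimensional ℝ E] {n : ℕ} (hn : Module.finrank ℝ E = n)
    (g : E →ₗ[ℝ] E →ₗ[ℝ] ℝ) (hg : ∀ u v, g u v = g v u) (hp : ∀ u, u ≠ 0 → 0 < g u u) :
    ∃ f : Fin n → E, ∀ i j, g (f i) (f j) = if i = j then 1 else 0 := by
  subst hn
  have hs : LinearMap.IsSymm (B := g) := ⟨fun u v => by simp [hg u v]⟩
  obtain ⟨v, hv⟩ := LinearMap.BilinForm.exists_orthogonal_basis hs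
  refine ⟨fun i => (Real.sqrt (g (v i) (v i)))⁻¹ • v i, fun i j => ?_⟩
  have hpos := hp (v i) (v.ne_zero i)
  split_ifs with h
  · subst h
    have h1 : 0 < Real.sqrt (g (v i) (v i)) := Real.sqrt_pos.2 hpos
    have h2 := Real.sq_sqrt hpos.le
    simp only [map_smul, LinearMap.smul_apply, smul_eq_mul]
    field_simp
    linarith
  · have h1 : g (v i) (v j) = 0 := hv h
    simp [h1]

/-- The range of a hyperplane inclusion is the orthogonal complement of a normal vector. -/
lemma exists_eq_of_orthogonal {V : Type*} [AddCommGroup V] [Module ℝ V] [FiniteDimensional ℝ E]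
    [FiniteDimensional ℝ V] (hn : Module.finrank ℝ V = Module.finrank ℝ E + 1)
    (φ : V →ₗ[ℝ] ℝ) (hφ : φ ≠ 0) (D : E →ₗ[ℝ] V) (hD : Function.Injective D)
    (hDφ : ∀ u, φ (D u) = 0) {w : V} (hw : φ w = 0) : ∃ u, D u = w := by
  have hle : LinearMap.range D ≤ LinearMap.ker φ := by
    rintro _ ⟨u, rfl⟩
    exact hDφ u
  have hr := LinearMap.finrank_range_of_inj hD
  have hk := Module.Dual.finrank_ker_add_one_of_ne_zero (f := φ) hφ
  have := Submodule.eq_of_le_of_finrank_eq hle (by omega)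
  exact (this ▸ hw : w ∈ LinearMap.range D)

end Frames

section Quadric

variable {E V : Type*} [NormedAddCommGroup E] [NormedSpace ℝ E]
  [NormedAddCommGroup V] [NormedSpace ℝ V]

/-- `X` is a smooth immersed spacelike parametrization of an open part of the quadric
`b(x, x) = ε`. -/
structure IsQuadricParam (b : V →L[ℝ] V →L[ℝ] ℝ) (ε : ℝ) (X : E → V) : Prop where
  contDiff : ContDiff ℝ ∞ X
  symm : ∀ x y, b x y = b y x
  apply_self : ∀ ξ, b (X ξ) (X ξ) = ε
  pos : ∀ ξ u, u ≠ 0 → 0 < b (fderiv ℝ X ξ u) (fderiv ℝ X ξ u)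

namespace IsQuadricParam

variable {b : V →L[ℝ] V →L[ℝ] ℝ} {ε : ℝ} {X : E → V} (h : IsQuadricParam b ε X)
include h

lemma hasFDerivAt (ξ : E) : HasFDerivAt X (fderiv ℝ X ξ) ξ :=
  (h.contDiff.differentiable (by simp) ξ).hasFDerivAt

lemma hasFDerivAt_fderiv (ξ : E) : HasFDerivAt (fderiv ℝ X) (fderiv ℝ (fderiv ℝ X) ξ) ξ :=
  ((h.contDiff.fderiv_right (m := ∞) (by simp)).differentiable (by simp) ξ).hasFDerivAt

lemma hasDerivAt_line (ξ u : E) : HasDerivAt (fun t : ℝ => X (ξ + t • u)) (fderiv ℝ X ξ u) 0 := by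
  have h1 : HasDerivAt (fun t : ℝ => ξ + t • u) u 0 := by
    simpa using ((hasDerivAt_id (0 : ℝ)).smul_const u).const_add ξ
  exact (h.hasFDerivAt ξ).comp_hasDerivAt_of_eq 0 h1 (by simp)

lemma hasDerivAt_fderiv_line (ξ u : E) : HasDerivAt (fun t : ℝ => fderiv ℝ X (ξ + t • u) u)
    (fderiv ℝ (fderiv ℝ X) ξ u u) 0 := by
  have h1 : HasDerivAt (fun t : ℝ => ξ + t • u) u 0 := by
    simpa using ((hasDerivAt_id (0 : ℝ)).smul_const u).const_add ξ
  have h2 := (h.hasFDerivAt_fderiv ξ).comp_hasDerivAt_of_eq 0 h1 (by simp)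
  simpa using h2.clm_apply (hasDerivAt_const (0 : ℝ) u)

/-- Differentiate b(X, X) = ε along a line and use the symmetry of b. -/
lemma fderiv_orthogonal (ξ u : E) : b (fderiv ℝ X ξ u) (X ξ) = 0 := by
  have h1 := h.hasDerivAt_line ξ u
  have h2 := (b.hasFDerivAt.comp_hasDerivAt (0 : ℝ) h1).clm_apply h1
  have h3 : HasDerivAt (fun t : ℝ => b (X (ξ + t • u)) (X (ξ + t • u))) 0 0 := by
    simp only [h.apply_self]
    exact hasDerivAt_const _ _
  have h4 := h2.unique h3
  simp only [Function.comp, zero_smul, add_zero] at h4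
  rw [h.symm (X ξ)] at h4
  linarith

/-- Differentiate the orthogonality b(dX u, X) = 0 once more in the direction u. -/
lemma fderiv_fderiv_apply (ξ u : E) : b (fderiv ℝ (fderiv ℝ X) ξ u u) (X ξ)
    = -b (fderiv ℝ X ξ u) (fderiv ℝ X ξ u) := by
  have h1 := h.hasDerivAt_line ξ u
  have h0 := h.hasDerivAt_fderiv_line ξ u
  have h2 := (b.hasFDerivAt.comp_hasDerivAt (0 : ℝ) h0).clm_apply h1
  have h3 : HasDerivAt (fun t : ℝ => b (fderiv ℝ X (ξ + t • u) u) (X (ξ + t • u))) 0 0 := by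
    simp only [h.fderiv_orthogonal]
    exact hasDerivAt_const _ _
  have h4 := h2.unique h3
  simp only [Function.comp, zero_smul, add_zero] at h4
  linarith

lemma injective_fderiv (ξ : E) : Function.Injective (fderiv ℝ X ξ) := by
  rw [injective_iff_map_eq_zero]
  intro u hu
  by_contra hne
  have := h.pos ξ u hne
  simp [hu] at this

/-- The Gauss formula of a quadric. -/
lemma exists_gauss [FiniteDimensional ℝ E] [FiniteDimensional ℝ V]
    (hn : Module.finrank ℝ V = Module.finrank ℝ E + 1) (hε : ε ^ 2 = 1) (ξ u : E) :
    ∃ u', fderiv ℝ (fderiv ℝ X) ξ u u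
      = fderiv ℝ X ξ u' - (ε * b (fderiv ℝ X ξ u) (fderiv ℝ X ξ u)) • X ξ := by
  have hφ : ∀ v, (b.flip (X ξ) : V →ₗ[ℝ] ℝ) v = b v (X ξ) := fun v => rfl
  -- Since ε² = 1, adding ε b(dX u, dX u) X makes the second derivative orthogonal to X. By
  -- dimension it is then tangent. The functional b(·, X) is nonzero because its value at X is ε.
  obtain ⟨u', hu'⟩ := exists_eq_of_orthogonal hn (b.flip (X ξ) : V →ₗ[ℝ] ℝ)
    (fun h0 => by
      have h1 := congrArg (fun φ : V →ₗ[ℝ] ℝ => φ (X ξ)) h0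
      simp only [hφ, h.apply_self, LinearMap.zero_apply] at h1
      simp [h1] at hε)
    (fderiv ℝ X ξ : E →ₗ[ℝ] V) (h.injective_fderiv ξ) (fun u => h.fderiv_orthogonal ξ u)
    (w := fderiv ℝ (fderiv ℝ X) ξ u u + (ε * b (fderiv ℝ X ξ u) (fderiv ℝ X ξ u)) • X ξ) (by
      rw [hφ]
      simp only [map_add, map_smul, add_apply, smul_apply,
        smul_eq_mul, h.apply_self, h.fderiv_fderiv_apply]
      linear_combination b (fderiv ℝ X ξ u) (fderiv ℝ X ξ u) * hε)
  refine ⟨u', ?_⟩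
  rw [show fderiv ℝ X ξ u' = _ from hu']
  abel

lemma exists_orthonormal [FiniteDimensional ℝ E] {n : ℕ} (hn : Module.finrank ℝ E = n) (ξ : E) :
    ∃ f : Fin n → E, ∀ i j, b (fderiv ℝ X ξ (f i)) (fderiv ℝ X ξ (f j)) = if i = j then 1 else 0 :=
  exists_orthonormal_frame hn (LinearMap.mk₂ ℝ (fun u v => b (fderiv ℝ X ξ u) (fderiv ℝ X ξ v))
    (by simp) (by simp) (by simp) (by simp)) (fun _ _ => h.symm _ _) (h.pos ξ)

end IsQuadricParam

/-! ### The sphere and the hyperboloid -/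

lemma fact_finrank_euclideanSpace (n : ℕ) :
    Fact (Module.finrank ℝ (EuclideanSpace ℝ (Fin (n + 1))) = n + 1) :=
  ⟨finrank_euclideanSpace_fin⟩

attribute [local instance] fact_finrank_euclideanSpace

/-- The inverse of the stereographic chart, as a map to the ambient space. -/
def sphereParam (n : ℕ) (v : sphere (0 : EuclideanSpace ℝ (Fin (n + 1))) 1)
    (ξ : EuclideanSpace ℝ (Fin n)) : EuclideanSpace ℝ (Fin (n + 1)) :=
  ((stereographic' n v).symm ξ : sphere (0 : EuclideanSpace ℝ (Fin (n + 1))) 1)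

lemma isQuadricParam_sphereParam (n : ℕ) (v : sphere (0 : EuclideanSpace ℝ (Fin (n + 1))) 1) :
    IsQuadricParam (innerSL ℝ) 1 (sphereParam n v) := by
  have hcd : ContDiff ℝ ∞ (sphereParam n v) := by
    let U := (OrthonormalBasis.fromOrthogonalSpanSingleton (𝕜 := ℝ) n
      (ne_zero_of_mem_unit_sphere v)).repr
    have h1 : sphereParam n v = fun ξ => stereoInvFunAux v.1 (U.symm ξ : EuclideanSpace ℝ _) := by
      funext ξ
      rfl
    rw [h1]
    exact contDiff_stereoInvFunAux.comp
      ((Submodule.subtypeL _).contDiff.comp U.symm.contDiff)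
  refine ⟨hcd, fun x y => real_inner_comm y x, fun ξ => ?_, fun ξ u hu => ?_⟩
  · have h := ((stereographic' n v).symm ξ).2
    rw [mem_sphere_zero_iff_norm] at h
    change inner ℝ (sphereParam n v ξ) (sphereParam n v ξ) = 1
    rw [real_inner_self_eq_norm_sq, sphereParam, h, one_pow]
  · change 0 < inner ℝ (fderiv ℝ (sphereParam n v) ξ u) (fderiv ℝ (sphereParam n v) ξ u)
    rw [real_inner_self_eq_norm_sq]
    suffices h : fderiv ℝ (sphereParam n v) ξ u ≠ 0 by
      have := norm_pos_iff.2 h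
      positivity
    intro h0
    apply hu
    let U := (OrthonormalBasis.fromOrthogonalSpanSingleton (𝕜 := ℝ) n
      (ne_zero_of_mem_unit_sphere v)).repr
    let L : EuclideanSpace ℝ (Fin (n + 1)) → EuclideanSpace ℝ (Fin n) :=
      fun x => U (stereoToFun v.1 x)
    -- Stereographic projection is a left inverse of the parametrization; the chain rule makes the
    -- differential of the latter injective.
    have hLX : L ∘ sphereParam n v = id := by
      funext ξ
      exact (stereographic' n v).right_inv (by simp)
    -- The projection is smooth only away from the pole v, which the parametrization misses.
    have hmem : sphereParam n v ξ ∈ {x : EuclideanSpace ℝ (Fin (n + 1)) | innerSL ℝ v.1 x ≠ 1} := by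
      have hs := (stereographic' n v).map_target (x := ξ) (by simp)
      rw [stereographic'_source] at hs
      intro h
      have hn : ∀ w : sphere (0 : EuclideanSpace ℝ (Fin (n + 1))) 1, ‖w.1‖ = 1 := fun w =>
        mem_sphere_zero_iff_norm.1 w.2
      exact hs (Subtype.ext ((inner_eq_one_iff_of_norm_eq_one (𝕜 := ℝ) (hn v) (hn _)).1 h).symm)
    have hL : DifferentiableAt ℝ L (sphereParam n v ξ) := by
      have ho : IsOpen {x : EuclideanSpace ℝ (Fin (n + 1)) | innerSL ℝ v.1 x ≠ 1} :=
        isOpen_ne_fun (innerSL ℝ v.1).continuous continuous_const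
      have h2 := ((contDiffOn_stereoToFun (v := v.1) (n := 1)).contDiffAt
        (ho.mem_nhds hmem)).differentiableAt (by simp)
      exact U.differentiableAt.comp _ h2
    have hd := (hL.hasFDerivAt.comp ξ (hcd.differentiable (by simp) ξ).hasFDerivAt).fderiv
    rw [hLX, fderiv_id] at hd
    have := congrArg (fun A : EuclideanSpace ℝ (Fin n) →L[ℝ] EuclideanSpace ℝ (Fin n) => A u) hd
    simpa [h0] using this

/-- The Lorentzian form of `ℝ^{n+1}`. -/
def lorentzForm (n : ℕ) :
    EuclideanSpace ℝ (Fin (n + 1)) →L[ℝ] EuclideanSpace ℝ (Fin (n + 1)) →L[ℝ] ℝ :=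
  (LinearMap.mk₂ ℝ
    (fun x y => ∑ i : Fin n, x i.castSucc * y i.castSucc - x (Fin.last n) * y (Fin.last n))
    (fun x x' y => by simp only [PiLp.add_apply, add_mul, Finset.sum_add_distrib]; ring)
    (fun c x y => by simp only [PiLp.smul_apply, smul_eq_mul, mul_assoc, ← Finset.mul_sum]; ring)
    (fun x y y' => by simp only [PiLp.add_apply, mul_add, Finset.sum_add_distrib]; ring)
    (fun c x y => by
      simp only [PiLp.smul_apply, smul_eq_mul, mul_left_comm _ c, ← Finset.mul_sum]
      ring)).toContinuousBilinearMap

lemma lorentzForm_apply (n : ℕ) (x y : EuclideanSpace ℝ (Fin (n + 1))) : lorentzForm n x y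
    = ∑ i : Fin n, x i.castSucc * y i.castSucc - x (Fin.last n) * y (Fin.last n) := rfl

/-- The inverse of the global chart of the hyperboloid, as a map to the ambient space. -/
def hyperboloidParam (n : ℕ) (η : EuclideanSpace ℝ (Fin n)) : EuclideanSpace ℝ (Fin (n + 1)) :=
  ((RealHyperbolicSpace.chart n).symm η).1

lemma isQuadricParam_hyperboloidParam (n : ℕ) :
    IsQuadricParam (lorentzForm n) (-1) (hyperboloidParam n) := by
  have hcast : ∀ (η : EuclideanSpace ℝ (Fin n)) (i : Fin n),
      hyperboloidParam n η i.castSucc = η i := fun η i => by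
    change Fin.snoc (α := fun _ => ℝ) _ _ _ = _
    rw [Fin.snoc_castSucc]
  have hlast : ∀ η : EuclideanSpace ℝ (Fin n),
      hyperboloidParam n η (Fin.last n) = Real.sqrt (1 + ‖η‖ ^ 2) := fun η => by
    change Fin.snoc (α := fun _ => ℝ) _ _ _ = _
    rw [Fin.snoc_last]
  have hcd : ContDiff ℝ ∞ (hyperboloidParam n) := by
    rw [contDiff_piLp]
    intro i
    refine Fin.lastCases ?_ (fun j => ?_) i
    · simp only [hlast]
      exact (contDiff_const.add (contDiff_norm_sq ℝ)).sqrt fun η => by positivity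
    · simp only [hcast]
      fun_prop
  refine ⟨hcd, fun x y => ?_, fun η => ?_, fun η u hu => ?_⟩
  · simp only [lorentzForm_apply, mul_comm]
  · have := ((RealHyperbolicSpace.chart n).symm η).2.1
    rw [lorentzForm_apply]
    simpa [hyperboloidParam, sq] using this
  · have hd := (hcd.differentiable (by simp) η).hasFDerivAt
    have hdi : ∀ i, HasFDerivAt (fun η => hyperboloidParam n η i)
        ((PiLp.proj 2 _ i).comp (fderiv ℝ (hyperboloidParam n) η)) η := fun i =>
      (PiLp.hasFDerivAt_apply (𝕜 := ℝ) 2 (hyperboloidParam n η) i).comp η hd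
    have h1 : ∀ i : Fin n, fderiv ℝ (hyperboloidParam n) η u i.castSucc = u i := by
      intro i
      have h := hdi i.castSucc
      simp only [hcast] at h
      have := h.unique (PiLp.hasFDerivAt_apply (𝕜 := ℝ) 2 η i)
      exact congrArg (fun A : EuclideanSpace ℝ (Fin n) →L[ℝ] ℝ => A u) this
    have h2 : fderiv ℝ (hyperboloidParam n) η u (Fin.last n)
        = inner ℝ η u / Real.sqrt (1 + ‖η‖ ^ 2) := by
      have h := hdi (Fin.last n)
      simp only [hlast] at h
      have h' := (((hasFDerivAt_id η).norm_sq).const_add 1).sqrt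
        (by simp only [id]; positivity : (1 + ‖id η‖ ^ 2 : ℝ) ≠ 0)
      have := congrArg (fun A : EuclideanSpace ℝ (Fin n) →L[ℝ] ℝ => A u) (h.unique h')
      refine Eq.trans this ?_
      have : 0 < Real.sqrt (1 + ‖η‖ ^ 2) := Real.sqrt_pos.2 (by positivity)
      simp
      field_simp
    rw [lorentzForm_apply]
    simp only [h1, h2]
    have h3 : ∑ i, u i * u i = ‖u‖ ^ 2 := by
      rw [EuclideanSpace.norm_sq_eq]; simp [sq]
    have h4 : inner ℝ η u / Real.sqrt (1 + ‖η‖ ^ 2) * (inner ℝ η u / Real.sqrt (1 + ‖η‖ ^ 2))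
        = inner ℝ η u ^ 2 / (1 + ‖η‖ ^ 2) := by
      rw [← sq, div_pow, Real.sq_sqrt (by positivity)]
    rw [h3, h4, sub_pos, div_lt_iff₀ (by positivity)]
    -- By Cauchy–Schwarz, ⟨η, u⟩² ≤ |η|² |u|² < (1 + |η|²) |u|², so the hyperboloid is spacelike.
    have h5 : 0 < ‖u‖ := norm_pos_iff.2 hu
    have h6 : inner ℝ η u ^ 2 ≤ (‖η‖ * ‖u‖) ^ 2 := sq_le_sq' (by
      have := abs_le.1 (abs_real_inner_le_norm η u); linarith [this.1]) (real_inner_le_norm η u)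
    nlinarith [sq_pos_of_pos h5]

end Quadric

/-! ## The horizontal lift -/

section ProfileCurve

variable (n₁ n₂ : ℕ) (ϱ : ℝ)

/-- `√(s² + m) e^{iθ(s)}`. -/
def profileCurve (m : ℝ) (θ : ℝ → ℝ) (s : ℝ) : ℂ :=
  Real.sqrt (s ^ 2 + m) * Complex.exp (Complex.I * θ s)

/-- `μ = s + i c / q`; both profile curves satisfy `γ' = μ γ / |γ|²`. -/
def profileSlope (s : ℝ) : ℂ := s + Complex.I * (curveConst n₁ n₂ ϱ / profileRoot n₁ n₂ ϱ s : ℝ)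

lemma profileCurve_mul_conj {m : ℝ} (hm : 0 < m) (θ : ℝ → ℝ) (s : ℝ) :
    profileCurve m θ s * (starRingEnd ℂ) (profileCurve m θ s) = ((s ^ 2 + m : ℝ) : ℂ) := by
  have he : ‖Complex.exp (Complex.I * θ s)‖ = 1 := by
    rw [mul_comm]; exact Complex.norm_exp_ofReal_mul_I _
  rw [Complex.mul_conj, Complex.normSq_eq_norm_sq, profileCurve, norm_mul, he, mul_one,
    Complex.norm_real, Real.norm_eq_abs, sq_abs, Real.sq_sqrt (by positivity)]

lemma contDiff_profileCurve {m : ℝ} (hm : 0 < m) {θ : ℝ → ℝ} (hθ : ContDiff ℝ ∞ θ) :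
    ContDiff ℝ ∞ (profileCurve m θ) := by
  have h1 : ContDiff ℝ ∞ fun s : ℝ => Real.sqrt (s ^ 2 + m) :=
    ((contDiff_id.pow 2).add contDiff_const).sqrt fun s => by simp only [id]; positivity
  exact (Complex.ofRealCLM.contDiff.comp h1).mul
    (contDiff_const.mul (Complex.ofRealCLM.contDiff.comp hθ)).cexp

variable {ϱ} (hϱ : 0 < ϱ)
include hϱ

/-- With r² = s² + m one has r r' = s and r² θ' = c / q, so r² γ' / γ = s + i c / q, which does not
depend on m. -/
lemma hasDerivAt_profileCurve {m : ℝ} (hm : 0 < m) {θ : ℝ → ℝ} {s : ℝ} (hθ : HasDerivAt θ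
    (curveConst n₁ n₂ ϱ / ((s ^ 2 + m) * profileRoot n₁ n₂ ϱ s)) s) :
    HasDerivAt (profileCurve m θ)
      (profileSlope n₁ n₂ ϱ s * profileCurve m θ s / (s ^ 2 + m : ℝ)) s := by
  have hq := profileRoot_pos n₁ n₂ hϱ s
  have hp : 0 < s ^ 2 + m := by positivity
  have h1 := ((((hasDerivAt_id s).pow 2).add_const m).sqrt hp.ne').ofReal_comp
  have h2 := (hθ.ofReal_comp.const_mul Complex.I).cexp
  refine (h1.mul h2).congr_deriv ?_
  have hr : 0 < Real.sqrt (s ^ 2 + m) := Real.sqrt_pos.2 hp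
  have hr2 : (Real.sqrt (s ^ 2 + m) : ℂ) ^ 2 = ((s ^ 2 + m : ℝ) : ℂ) := by
    exact_mod_cast Real.sq_sqrt hp.le
  have hr0 : (Real.sqrt (s ^ 2 + m) : ℂ) ≠ 0 := by exact_mod_cast hr.ne'
  have hq0 : (profileRoot n₁ n₂ ϱ s : ℂ) ≠ 0 := by exact_mod_cast hq.ne'
  simp only [profileCurve, profileSlope, id, Pi.pow_apply]
  push_cast
  rw [show (s : ℂ) ^ 2 + (m : ℂ) = (Real.sqrt (s ^ 2 + m) : ℂ) ^ 2 by rw [hr2]; push_cast; rfl]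
  generalize (Real.sqrt (s ^ 2 + m) : ℂ) = r at *
  field_simp

lemma hasDerivAt_profileSlope {s d : ℝ} (hd : HasDerivAt (profileRoot n₁ n₂ ϱ) d s) :
    HasDerivAt (profileSlope n₁ n₂ ϱ)
      (1 - Complex.I * (curveConst n₁ n₂ ϱ * d / profileRoot n₁ n₂ ϱ s ^ 2 : ℝ)) s := by
  have hq := profileRoot_pos n₁ n₂ hϱ s
  have h1 := ((hasDerivAt_const s (curveConst n₁ n₂ ϱ)).div hd hq.ne').ofReal_comp
  refine ((hasDerivAt_id s).ofReal_comp.add (h1.const_mul Complex.I)).congr_deriv ?_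
  push_cast
  ring

lemma profileSlope_mul_conj (s : ℝ) :
    profileSlope n₁ n₂ ϱ s * (starRingEnd ℂ) (profileSlope n₁ n₂ ϱ s)
      = ((profileVal n₁ n₂ ϱ (s ^ 2) / profileRoot n₁ n₂ ϱ s ^ 2 : ℝ) : ℂ) := by
  have hq := profileRoot_pos n₁ n₂ hϱ s
  rw [← sq_mul_profileRoot_sq n₁ n₂ hϱ s, Complex.mul_conj, Complex.normSq_apply]
  congr 1
  simp [profileSlope]
  field_simp

lemma hasDerivAt_profileCurve_deriv {m : ℝ} (hm : 0 < m) {θ : ℝ → ℝ} {s : ℝ} (hθ : HasDerivAt θ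
    (curveConst n₁ n₂ ϱ / ((s ^ 2 + m) * profileRoot n₁ n₂ ϱ s)) s) {μ' : ℂ}
    (hμ : HasDerivAt (profileSlope n₁ n₂ ϱ) μ' s) :
    HasDerivAt (fun s => profileSlope n₁ n₂ ϱ s * profileCurve m θ s / (s ^ 2 + m : ℝ))
      ((μ' / (s ^ 2 + m : ℝ)
        - profileSlope n₁ n₂ ϱ s * (starRingEnd ℂ) (profileSlope n₁ n₂ ϱ s) / (s ^ 2 + m : ℝ) ^ 2)
          * profileCurve m θ s) s := by
  have hp : 0 < s ^ 2 + m := by positivity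
  have hp0 : ((s ^ 2 + m : ℝ) : ℂ) ≠ 0 := by exact_mod_cast hp.ne'
  have h1 := (((hasDerivAt_id s).pow 2).add_const m).ofReal_comp
  have h := (hμ.mul (hasDerivAt_profileCurve n₁ n₂ hϱ hm hθ)).div h1 hp0
  refine h.congr_deriv ?_
  -- The term -2s from the denominator combines with μ into μ - 2s = -conj(μ), as s is the real part
  -- of μ.
  have hc : (starRingEnd ℂ) (profileSlope n₁ n₂ ϱ s) = 2 * s - profileSlope n₁ n₂ ϱ s := by
    apply Complex.ext <;> simp [profileSlope]; ring
  rw [hc]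
  simp only [id, Pi.mul_apply, Pi.pow_apply]
  generalize hP : ((s ^ 2 + m : ℝ) : ℂ) = P at *
  push_cast
  field_simp
  ring

end ProfileCurve

/-! ### Block coordinates and sesquilinearity of the Hermitian form -/

section Blocks

variable (n₁ n₂ : ℕ)

/-- The inclusion of `ℝ^{n₁+1}` as the real part of the first block of coordinates. -/
def blockLeft : EuclideanSpace ℝ (Fin (n₁ + 1)) →L[ℝ] (Fin (n₁ + 1 + n₂ + 1) → ℂ) :=
  LinearMap.toContinuousLinearMap
    { toFun := fun x => Fin.append (m := n₁ + 1) (n := n₂ + 1) (fun i => (x i : ℂ)) 0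
      map_add' := fun x y => by
        funext i
        refine Fin.addCases (m := n₁ + 1) (n := n₂ + 1) (fun j => ?_) (fun j => ?_) i <;> simp
      map_smul' := fun c x => by
        funext i
        refine Fin.addCases (m := n₁ + 1) (n := n₂ + 1) (fun j => ?_) (fun j => ?_) i <;> simp }

/-- The inclusion of `ℝ^{n₂+1}` as the real part of the second block of coordinates. -/
def blockRight : EuclideanSpace ℝ (Fin (n₂ + 1)) →L[ℝ] (Fin (n₁ + 1 + n₂ + 1) → ℂ) :=
  LinearMap.toContinuousLinearMap
    { toFun := fun y => Fin.append (m := n₁ + 1) (n := n₂ + 1) 0 (fun i => (y i : ℂ))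
      map_add' := fun x y => by
        funext i
        refine Fin.addCases (m := n₁ + 1) (n := n₂ + 1) (fun j => ?_) (fun j => ?_) i <;> simp
      map_smul' := fun c x => by
        funext i
        refine Fin.addCases (m := n₁ + 1) (n := n₂ + 1) (fun j => ?_) (fun j => ?_) i <;> simp }

variable {n₁ n₂}

lemma blockLeft_eq (x : EuclideanSpace ℝ (Fin (n₁ + 1))) : blockLeft n₁ n₂ x
    = Fin.append (m := n₁ + 1) (n := n₂ + 1) (fun i => (x i : ℂ)) 0 := rfl

lemma blockRight_eq (y : EuclideanSpace ℝ (Fin (n₂ + 1))) : blockRight n₁ n₂ y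
    = Fin.append (m := n₁ + 1) (n := n₂ + 1) 0 (fun i => (y i : ℂ)) := rfl

/-- `hermForm` separates the last coordinate by `castSucc` and `last`, while the blocks come from
`Fin.append`. The two index types agree definitionally, and this lemma and its companions translate
between them. -/
lemma blockLeft_left (x : EuclideanSpace ℝ (Fin (n₁ + 1))) (i : Fin (n₁ + 1)) :
    blockLeft n₁ n₂ x (Fin.castSucc (Fin.castAdd n₂ i)) = (x i : ℂ) :=
  (congrFun (blockLeft_eq x) _).trans <| Fin.append_left (m := n₁ + 1) (n := n₂ + 1) _ _ i

lemma blockLeft_right (x : EuclideanSpace ℝ (Fin (n₁ + 1))) (j : Fin n₂) :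
    blockLeft n₁ n₂ x (Fin.castSucc (Fin.natAdd (n₁ + 1) j)) = 0 :=
  (congrFun (blockLeft_eq x) _).trans <| Fin.append_right (m := n₁ + 1) (n := n₂ + 1) _ _ j.castSucc

lemma blockLeft_last (x : EuclideanSpace ℝ (Fin (n₁ + 1))) :
    blockLeft n₁ n₂ x (Fin.last (n₁ + 1 + n₂)) = 0 :=
  (congrFun (blockLeft_eq x) _).trans <| Fin.append_right (m := n₁ + 1) (n := n₂ + 1) _ _ (Fin.last n₂)

lemma blockRight_left (y : EuclideanSpace ℝ (Fin (n₂ + 1))) (i : Fin (n₁ + 1)) :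
    blockRight n₁ n₂ y (Fin.castSucc (Fin.castAdd n₂ i)) = 0 :=
  (congrFun (blockRight_eq y) _).trans <| Fin.append_left (m := n₁ + 1) (n := n₂ + 1) _ _ i

lemma blockRight_right (y : EuclideanSpace ℝ (Fin (n₂ + 1))) (j : Fin n₂) :
    blockRight n₁ n₂ y (Fin.castSucc (Fin.natAdd (n₁ + 1) j)) = (y j.castSucc : ℂ) :=
  (congrFun (blockRight_eq y) _).trans <| Fin.append_right (m := n₁ + 1) (n := n₂ + 1) _ _ j.castSucc

lemma blockRight_last (y : EuclideanSpace ℝ (Fin (n₂ + 1))) :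
    blockRight n₁ n₂ y (Fin.last (n₁ + 1 + n₂)) = (y (Fin.last n₂) : ℂ) :=
  (congrFun (blockRight_eq y) _).trans <| Fin.append_right (m := n₁ + 1) (n := n₂ + 1) _ _ (Fin.last n₂)

/-- The negative coordinate is the last one and so lies in the second block: the Hermitian form
restricts to the Euclidean form on the real part of the first block and to the Lorentzian one on
that of the second. -/
lemma hermForm_block (a a' b b' : ℂ) (x x' : EuclideanSpace ℝ (Fin (n₁ + 1)))
    (y y' : EuclideanSpace ℝ (Fin (n₂ + 1))) :
    hermForm (a • blockLeft n₁ n₂ x + b • blockRight n₁ n₂ y)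
      (a' • blockLeft n₁ n₂ x' + b' • blockRight n₁ n₂ y')
      = a * (starRingEnd ℂ) a' * (innerSL ℝ x x' : ℝ)
        + b * (starRingEnd ℂ) b' * (lorentzForm n₂ y y' : ℝ) := by
  rw [hermForm, Fin.sum_univ_add, lorentzForm_apply, innerSL_apply_apply, PiLp.inner_apply]
  simp only [Pi.add_apply, Pi.smul_apply, smul_eq_mul, blockLeft_left, blockLeft_right,
    blockLeft_last, blockRight_left, blockRight_right, blockRight_last, mul_zero, add_zero, zero_add,
    Complex.star_def, map_mul, Complex.conj_ofReal, RCLike.inner_apply, conj_trivial]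
  push_cast
  rw [mul_sub, Finset.mul_sum, Finset.mul_sum, add_sub_assoc]
  congr 1
  · exact Finset.sum_congr rfl fun i _ => by ring
  · congr 1
    · exact Finset.sum_congr rfl fun i _ => by ring
    · ring

variable {n : ℕ}

lemma hermForm_add_left (u u' v : Fin (n + 1) → ℂ) :
    hermForm (u + u') v = hermForm u v + hermForm u' v := by
  simp only [hermForm, Pi.add_apply, add_mul, Finset.sum_add_distrib]; ring

lemma hermForm_add_right (u v v' : Fin (n + 1) → ℂ) :
    hermForm u (v + v') = hermForm u v + hermForm u v' := by
  simp only [hermForm, Pi.add_apply, star_add, mul_add, Finset.sum_add_distrib]; ring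

lemma hermForm_smul_left (c : ℂ) (u v : Fin (n + 1) → ℂ) :
    hermForm (c • u) v = c * hermForm u v := by
  simp only [hermForm, Pi.smul_apply, smul_eq_mul, mul_sub, Finset.mul_sum, mul_assoc]

lemma hermForm_smul_right (c : ℂ) (u v : Fin (n + 1) → ℂ) :
    hermForm u (c • v) = (starRingEnd ℂ) c * hermForm u v := by
  simp only [hermForm, Pi.smul_apply, smul_eq_mul, mul_sub, Finset.mul_sum, star_mul',
    Complex.star_def]
  congr 1
  · exact Finset.sum_congr rfl fun i _ => by ring
  · ring

lemma hermForm_blockLeft (x x' : EuclideanSpace ℝ (Fin (n₁ + 1))) :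
    hermForm (blockLeft n₁ n₂ x) (blockLeft n₁ n₂ x') = (innerSL ℝ x x' : ℝ) := by
  simpa using hermForm_block (n₁ := n₁) (n₂ := n₂) 1 1 0 0 x x' 0 0

lemma hermForm_blockRight (y y' : EuclideanSpace ℝ (Fin (n₂ + 1))) :
    hermForm (blockRight n₁ n₂ y) (blockRight n₁ n₂ y') = (lorentzForm n₂ y y' : ℝ) := by
  simpa using hermForm_block (n₁ := n₁) (n₂ := n₂) 0 0 1 1 0 0 y y'

lemma hermForm_blockLeft_blockRight (x : EuclideanSpace ℝ (Fin (n₁ + 1)))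
    (y : EuclideanSpace ℝ (Fin (n₂ + 1))) :
    hermForm (blockLeft n₁ n₂ x) (blockRight n₁ n₂ y) = 0 := by
  simpa using hermForm_block (n₁ := n₁) (n₂ := n₂) 1 0 0 1 x 0 0 y

lemma hermForm_blockRight_blockLeft (x : EuclideanSpace ℝ (Fin (n₁ + 1)))
    (y : EuclideanSpace ℝ (Fin (n₂ + 1))) :
    hermForm (blockRight n₁ n₂ y) (blockLeft n₁ n₂ x) = 0 := by
  simpa using hermForm_block (n₁ := n₁) (n₂ := n₂) 0 1 1 0 0 x y 0

end Blocks

/-! ### The two profile curves and the lift built from them -/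

section HorizontalLift

variable {n₁ n₂ : ℕ} {ϱ : ℝ}

/-- The first profile curve `γ₁`. -/
def profileCurve₁ (n₁ n₂ : ℕ) (ϱ : ℝ) : ℝ → ℂ :=
  profileCurve (Real.sinh ϱ ^ 2) (theta₁ n₁ n₂ ϱ)

/-- The second profile curve `γ₂`. -/
def profileCurve₂ (n₁ n₂ : ℕ) (ϱ : ℝ) : ℝ → ℂ :=
  profileCurve (Real.cosh ϱ ^ 2) (theta₂ n₁ n₂ ϱ)

/-- The derivative of `γ₁`. -/
def profileVel₁ (n₁ n₂ : ℕ) (ϱ s : ℝ) : ℂ :=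
  profileSlope n₁ n₂ ϱ s * profileCurve₁ n₁ n₂ ϱ s / (s ^ 2 + Real.sinh ϱ ^ 2 : ℝ)

/-- The derivative of `γ₂`. -/
def profileVel₂ (n₁ n₂ : ℕ) (ϱ s : ℝ) : ℂ :=
  profileSlope n₁ n₂ ϱ s * profileCurve₂ n₁ n₂ ϱ s / (s ^ 2 + Real.cosh ϱ ^ 2 : ℝ)

/-- The squared speed of the profile curve. -/
def profileSpeed (n₁ n₂ : ℕ) (ϱ s : ℝ) : ℝ :=
  profileVal n₁ n₂ ϱ (s ^ 2) / profileRoot n₁ n₂ ϱ s ^ 2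
    / ((s ^ 2 + Real.sinh ϱ ^ 2) * (s ^ 2 + Real.cosh ϱ ^ 2))

/-- `(s, ξ, η) ↦ (γ₁(s) X(ξ), γ₂(s) Y(η))`. -/
def horizontalLift (n₁ n₂ : ℕ) (ϱ : ℝ)
    (X : EuclideanSpace ℝ (Fin n₁) → EuclideanSpace ℝ (Fin (n₁ + 1)))
    (Y : EuclideanSpace ℝ (Fin n₂) → EuclideanSpace ℝ (Fin (n₂ + 1)))
    (e : ℝ × EuclideanSpace ℝ (Fin n₁) × EuclideanSpace ℝ (Fin n₂)) : Fin (n₁ + 1 + n₂ + 1) → ℂ :=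
  profileCurve₁ n₁ n₂ ϱ e.1 • blockLeft n₁ n₂ (X e.2.1)
    + profileCurve₂ n₁ n₂ ϱ e.1 • blockRight n₁ n₂ (Y e.2.2)

lemma cosh_sq_pos (ϱ : ℝ) : 0 < Real.cosh ϱ ^ 2 := by
  have := Real.cosh_pos ϱ; positivity

variable (hϱ : 0 < ϱ)

section
include hϱ

lemma profileCurve₁_mul_conj (s : ℝ) : profileCurve₁ n₁ n₂ ϱ s *
    (starRingEnd ℂ) (profileCurve₁ n₁ n₂ ϱ s) = ((s ^ 2 + Real.sinh ϱ ^ 2 : ℝ) : ℂ) :=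
  profileCurve_mul_conj (sinh_sq_pos hϱ) _ s

omit hϱ in
lemma profileCurve₂_mul_conj (s : ℝ) : profileCurve₂ n₁ n₂ ϱ s *
    (starRingEnd ℂ) (profileCurve₂ n₁ n₂ ϱ s) = ((s ^ 2 + Real.cosh ϱ ^ 2 : ℝ) : ℂ) :=
  profileCurve_mul_conj (cosh_sq_pos ϱ) _ s

lemma hasDerivAt_profileCurve₁ (s : ℝ) :
    HasDerivAt (profileCurve₁ n₁ n₂ ϱ) (profileVel₁ n₁ n₂ ϱ s) s :=
  hasDerivAt_profileCurve n₁ n₂ hϱ (sinh_sq_pos hϱ) (hasDerivAt_theta₁ n₁ n₂ hϱ s)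

lemma hasDerivAt_profileCurve₂ (s : ℝ) :
    HasDerivAt (profileCurve₂ n₁ n₂ ϱ) (profileVel₂ n₁ n₂ ϱ s) s :=
  hasDerivAt_profileCurve n₁ n₂ hϱ (cosh_sq_pos ϱ) (hasDerivAt_theta₂ n₁ n₂ hϱ s)

/-- The value is the same μ as for γ₂; the two cancel in the indefinite form, which is what makes
the lift horizontal. -/
lemma profileVel₁_mul_conj (s : ℝ) : profileVel₁ n₁ n₂ ϱ s *
    (starRingEnd ℂ) (profileCurve₁ n₁ n₂ ϱ s) = profileSlope n₁ n₂ ϱ s := by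
  have hp : ((s ^ 2 + Real.sinh ϱ ^ 2 : ℝ) : ℂ) ≠ 0 := by
    have := sinh_sq_pos hϱ
    exact_mod_cast (by positivity : s ^ 2 + Real.sinh ϱ ^ 2 ≠ 0)
  rw [profileVel₁, div_mul_eq_mul_div, mul_assoc, profileCurve₁_mul_conj hϱ, mul_div_cancel_right₀ _ hp]

omit hϱ in
lemma profileVel₂_mul_conj (s : ℝ) : profileVel₂ n₁ n₂ ϱ s *
    (starRingEnd ℂ) (profileCurve₂ n₁ n₂ ϱ s) = profileSlope n₁ n₂ ϱ s := by
  have hp : ((s ^ 2 + Real.cosh ϱ ^ 2 : ℝ) : ℂ) ≠ 0 := by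
    have := cosh_sq_pos ϱ
    exact_mod_cast (by positivity : s ^ 2 + Real.cosh ϱ ^ 2 ≠ 0)
  rw [profileVel₂, div_mul_eq_mul_div, mul_assoc, profileCurve₂_mul_conj, mul_div_cancel_right₀ _ hp]

/-- Both terms are |μ|² / r_j², and 1 / r₁² - 1 / r₂² = 1 / (r₁² r₂²) because r₂² - r₁² = 1. -/
lemma profileSpeed_eq (s : ℝ) :
    profileVel₁ n₁ n₂ ϱ s * (starRingEnd ℂ) (profileVel₁ n₁ n₂ ϱ s)
      - profileVel₂ n₁ n₂ ϱ s * (starRingEnd ℂ) (profileVel₂ n₁ n₂ ϱ s)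
      = (profileSpeed n₁ n₂ ϱ s : ℝ) := by
  have h1 : 0 < s ^ 2 + Real.sinh ϱ ^ 2 := by have := sinh_sq_pos hϱ; positivity
  have h2 : 0 < s ^ 2 + Real.cosh ϱ ^ 2 := by have := cosh_sq_pos ϱ; positivity
  have hq := profileRoot_pos n₁ n₂ hϱ s
  have e1 : profileVel₁ n₁ n₂ ϱ s * (starRingEnd ℂ) (profileVel₁ n₁ n₂ ϱ s)
      = profileSlope n₁ n₂ ϱ s * (starRingEnd ℂ) (profileSlope n₁ n₂ ϱ s)
        * (profileCurve₁ n₁ n₂ ϱ s * (starRingEnd ℂ) (profileCurve₁ n₁ n₂ ϱ s))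
        / ((s ^ 2 + Real.sinh ϱ ^ 2 : ℝ) : ℂ) ^ 2 := by
    simp only [profileVel₁, map_div₀, map_mul, Complex.conj_ofReal]
    ring
  have e2 : profileVel₂ n₁ n₂ ϱ s * (starRingEnd ℂ) (profileVel₂ n₁ n₂ ϱ s)
      = profileSlope n₁ n₂ ϱ s * (starRingEnd ℂ) (profileSlope n₁ n₂ ϱ s)
        * (profileCurve₂ n₁ n₂ ϱ s * (starRingEnd ℂ) (profileCurve₂ n₁ n₂ ϱ s))
        / ((s ^ 2 + Real.cosh ϱ ^ 2 : ℝ) : ℂ) ^ 2 := by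
    simp only [profileVel₂, map_div₀, map_mul, Complex.conj_ofReal]
    ring
  rw [e1, e2, profileSlope_mul_conj n₁ n₂ hϱ, profileCurve₁_mul_conj hϱ, profileCurve₂_mul_conj]
  norm_cast
  rw [profileSpeed]
  have h3 := Real.cosh_sq ϱ
  field_simp
  rw [h3]
  ring

lemma profileSpeed_pos (s : ℝ) : 0 < profileSpeed n₁ n₂ ϱ s := by
  have h1 : 0 < s ^ 2 + Real.sinh ϱ ^ 2 := by have := sinh_sq_pos hϱ; positivity
  have h2 : 0 < s ^ 2 + Real.cosh ϱ ^ 2 := by have := cosh_sq_pos ϱ; positivity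
  have hq := profileRoot_pos n₁ n₂ hϱ s
  have := profileVal_pos n₁ n₂ hϱ (sq_nonneg s)
  unfold profileSpeed
  positivity

/-- The equation of a minimal Legendre curve: `∑ D²Z(e, e)` is tangent to the complex cone. -/
lemma exists_profile_minimal (s : ℝ) : ∃ (γ₁' γ₂' α : ℂ) (β : ℝ),
    HasDerivAt (profileVel₁ n₁ n₂ ϱ) γ₁' s ∧ HasDerivAt (profileVel₂ n₁ n₂ ϱ) γ₂' s ∧
    γ₁' / (profileSpeed n₁ n₂ ϱ s : ℝ)
        - n₁ * (profileCurve₁ n₁ n₂ ϱ s / (s ^ 2 + Real.sinh ϱ ^ 2 : ℝ))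
      = α * profileCurve₁ n₁ n₂ ϱ s + β * profileVel₁ n₁ n₂ ϱ s ∧
    γ₂' / (profileSpeed n₁ n₂ ϱ s : ℝ)
        + n₂ * (profileCurve₂ n₁ n₂ ϱ s / (s ^ 2 + Real.cosh ϱ ^ 2 : ℝ))
      = α * profileCurve₂ n₁ n₂ ϱ s + β * profileVel₂ n₁ n₂ ϱ s := by
  obtain ⟨d, hd, he⟩ := exists_hasDerivAt_profileRoot n₁ n₂ hϱ s
  have hμ := hasDerivAt_profileSlope n₁ n₂ hϱ hd
  have hA := profileSpeed_pos (n₁ := n₁) (n₂ := n₂) hϱ s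
  have hP := profileVal_pos n₁ n₂ hϱ (sq_nonneg s)
  have hq := profileRoot_pos n₁ n₂ hϱ s
  have h1 : 0 < s ^ 2 + Real.sinh ϱ ^ 2 := by have := sinh_sq_pos hϱ; positivity
  have h2 : 0 < s ^ 2 + Real.cosh ϱ ^ 2 := by have := cosh_sq_pos ϱ; positivity
  have hR : s ^ 2 + Real.cosh ϱ ^ 2 = s ^ 2 + Real.sinh ϱ ^ 2 + 1 := by
    rw [Real.cosh_sq]; ring
  have hγ₁ := hasDerivAt_profileCurve_deriv n₁ n₂ hϱ (sinh_sq_pos hϱ)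
    (hasDerivAt_theta₁ n₁ n₂ hϱ s) hμ
  have hγ₂ := hasDerivAt_profileCurve_deriv n₁ n₂ hϱ (cosh_sq_pos ϱ)
    (hasDerivAt_theta₂ n₁ n₂ hϱ s) hμ
  rw [profileSlope_mul_conj n₁ n₂ hϱ] at hγ₁ hγ₂
  have hsl : profileSlope n₁ n₂ ϱ s
      = s + Complex.I * (curveConst n₁ n₂ ϱ / profileRoot n₁ n₂ ϱ s : ℝ) := rfl
  have hv₁ : profileVel₁ n₁ n₂ ϱ s = profileSlope n₁ n₂ ϱ s / (s ^ 2 + Real.sinh ϱ ^ 2 : ℝ)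
      * profileCurve₁ n₁ n₂ ϱ s := by rw [profileVel₁]; ring
  have hv₂ : profileVel₂ n₁ n₂ ϱ s = profileSlope n₁ n₂ ϱ s / (s ^ 2 + Real.cosh ϱ ^ 2 : ℝ)
      * profileCurve₂ n₁ n₂ ϱ s := by rw [profileVel₂]; ring
  have hA' : profileSpeed n₁ n₂ ϱ s = profileVal n₁ n₂ ϱ (s ^ 2) / profileRoot n₁ n₂ ϱ s ^ 2
    / ((s ^ 2 + Real.sinh ϱ ^ 2) * (s ^ 2 + Real.cosh ϱ ^ 2)) := rfl
  rw [hv₁, hv₂]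
  generalize profileSlope n₁ n₂ ϱ s = μ at *
  generalize profileVal n₁ n₂ ϱ (s ^ 2) = P at *
  generalize profileRoot n₁ n₂ ϱ s = q at *
  generalize curveConst n₁ n₂ ϱ = c at *
  generalize s ^ 2 + Real.sinh ϱ ^ 2 = R at *
  generalize s ^ 2 + Real.cosh ϱ ^ 2 = R' at *
  subst hR
  have hP0 : (P : ℂ) ≠ 0 := by exact_mod_cast hP.ne'
  have hq0 : (q : ℂ) ≠ 0 := by exact_mod_cast hq.ne'
  have hR0 : (R : ℂ) ≠ 0 := by exact_mod_cast h1.ne'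
  have hR1 : (R : ℂ) + 1 ≠ 0 := by exact_mod_cast h2.ne'
  have he' : (q * (q + s * d) * (R * (R + 1)) : ℂ) = P * ((n₁ + 1) * (R + 1) + (n₂ + 1) * R) := by
    have : q * (q + s * d) * (R * (R + 1)) = P * ((n₁ + 1) * (R + 1) + (n₂ + 1) * R) := by
      rw [he]; field_simp
    exact_mod_cast this
  -- Dividing each equation by its γ, the first one is solved for α. With R = r₁², R + 1 = r₂² and A
  -- the squared speed, subtracting the two leaves μ' / A - (n₁ + 1)(R + 1) - (n₂ + 1) R = β μ. Its
  -- imaginary part forces β = -d / (q A) = -R (R + 1) d q / P, and its real part is then `he'`.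
  refine ⟨_, _, ((1 - Complex.I * (c * d / q ^ 2 : ℝ)) / R - (P / q ^ 2 : ℝ) / (R : ℂ) ^ 2)
    / (profileSpeed n₁ n₂ ϱ s : ℝ) - n₁ / R - (-(R * (R + 1) * d * q / P) : ℝ) * (μ / R),
    -(R * (R + 1) * d * q / P), hγ₁, hγ₂, ?_, ?_⟩
  · change _ * profileCurve₁ n₁ n₂ ϱ s / _ - _ = _
    ring
  · change _ * profileCurve₂ n₁ n₂ ϱ s / _ + _ = _
    rw [hA', hsl]
    push_cast
    field_simp
    linear_combination (-profileCurve₂ n₁ n₂ ϱ s) * he'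

end

variable {X : EuclideanSpace ℝ (Fin n₁) → EuclideanSpace ℝ (Fin (n₁ + 1))}
  {Y : EuclideanSpace ℝ (Fin n₂) → EuclideanSpace ℝ (Fin (n₂ + 1))}
  (hX : IsQuadricParam (innerSL ℝ) 1 X) (hY : IsQuadricParam (lorentzForm n₂) (-1) Y)
  (e : ℝ × EuclideanSpace ℝ (Fin n₁) × EuclideanSpace ℝ (Fin n₂))

include hϱ hX hY

lemma contDiff_horizontalLift : ContDiff ℝ ∞ (horizontalLift n₁ n₂ ϱ X Y) := by
  have h1 := (contDiff_profileCurve (sinh_sq_pos hϱ) (contDiff_theta₁ n₁ n₂ hϱ))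
  have h2 := (contDiff_profileCurve (cosh_sq_pos ϱ) (contDiff_theta₂ n₁ n₂ hϱ))
  exact ((h1.comp contDiff_fst).smul ((blockLeft n₁ n₂).contDiff.comp
      (hX.contDiff.comp (contDiff_fst.comp contDiff_snd)))).add
    ((h2.comp contDiff_fst).smul ((blockRight n₁ n₂).contDiff.comp
      (hY.contDiff.comp (contDiff_snd.comp contDiff_snd))))

lemma fderiv_horizontalLift (a : ℝ × EuclideanSpace ℝ (Fin n₁) × EuclideanSpace ℝ (Fin n₂)) :
    fderiv ℝ (horizontalLift n₁ n₂ ϱ X Y) e a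
      = ((a.1 : ℂ) * profileVel₁ n₁ n₂ ϱ e.1) • blockLeft n₁ n₂ (X e.2.1)
        + profileCurve₁ n₁ n₂ ϱ e.1 • blockLeft n₁ n₂ (fderiv ℝ X e.2.1 a.2.1)
        + (((a.1 : ℂ) * profileVel₂ n₁ n₂ ϱ e.1) • blockRight n₁ n₂ (Y e.2.2)
        + profileCurve₂ n₁ n₂ ϱ e.1 • blockRight n₁ n₂ (fderiv ℝ Y e.2.2 a.2.2)) := by
  have hl : HasDerivAt (fun t : ℝ => e + t • a) a 0 := by
    simpa using ((hasDerivAt_id (0 : ℝ)).smul_const a).const_add e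
  have hs : HasDerivAt (fun t : ℝ => e.1 + t * a.1) a.1 0 := by
    simpa using ((hasDerivAt_id (0 : ℝ)).mul_const a.1).const_add e.1
  have h0 := (((contDiff_horizontalLift hϱ hX hY).differentiable (by simp)) e).hasFDerivAt
    |>.comp_hasDerivAt_of_eq 0 hl (by simp)
  have g1 := (hasDerivAt_profileCurve₁ (n₁ := n₁) (n₂ := n₂) hϱ e.1).scomp_of_eq (0 : ℝ) hs (by simp)
  have g2 := (hasDerivAt_profileCurve₂ (n₁ := n₁) (n₂ := n₂) hϱ e.1).scomp_of_eq (0 : ℝ) hs (by simp)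
  have x1 := (blockLeft n₁ n₂).hasFDerivAt.comp_hasDerivAt (0 : ℝ)
    (hX.hasDerivAt_line e.2.1 a.2.1)
  have y1 := (blockRight n₁ n₂).hasFDerivAt.comp_hasDerivAt (0 : ℝ)
    (hY.hasDerivAt_line e.2.2 a.2.2)
  have h1 := (g1.smul x1).add (g2.smul y1)
  have h2 := h0.unique h1
  rw [h2]
  simp only [Function.comp, zero_mul, add_zero, zero_smul, Complex.real_smul]
  abel

lemma hermForm_horizontalLift_self :
    hermForm (horizontalLift n₁ n₂ ϱ X Y e) (horizontalLift n₁ n₂ ϱ X Y e) = -1 := by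
  rw [horizontalLift, hermForm_block, hX.apply_self, hY.apply_self, profileCurve₁_mul_conj hϱ,
    profileCurve₂_mul_conj, Real.cosh_sq]
  push_cast
  ring

lemma hermForm_fderiv_horizontalLift
    (a : ℝ × EuclideanSpace ℝ (Fin n₁) × EuclideanSpace ℝ (Fin n₂)) :
    hermForm (fderiv ℝ (horizontalLift n₁ n₂ ϱ X Y) e a) (horizontalLift n₁ n₂ ϱ X Y e) = 0 := by
  rw [fderiv_horizontalLift hϱ hX hY, horizontalLift]
  simp only [hermForm_add_left, hermForm_add_right, hermForm_smul_left, hermForm_smul_right,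
    hermForm_blockLeft, hermForm_blockRight, hermForm_blockLeft_blockRight,
    hermForm_blockRight_blockLeft, hX.apply_self, hY.apply_self, hX.fderiv_orthogonal,
    hY.fderiv_orthogonal]
  have h1 := profileVel₁_mul_conj (n₁ := n₁) (n₂ := n₂) hϱ e.1
  have h2 := profileVel₂_mul_conj (n₁ := n₁) (n₂ := n₂) (ϱ := ϱ) e.1
  push_cast
  linear_combination (a.1 : ℂ) * h1 - (a.1 : ℂ) * h2

omit hϱ hX hY in
/-- The metric induced on `ℝ × ℝ^{n₁} × ℝ^{n₂}` by the horizontal lift. -/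
def liftMetric (n₁ n₂ : ℕ) (ϱ : ℝ)
    (X : EuclideanSpace ℝ (Fin n₁) → EuclideanSpace ℝ (Fin (n₁ + 1)))
    (Y : EuclideanSpace ℝ (Fin n₂) → EuclideanSpace ℝ (Fin (n₂ + 1)))
    (e a b : ℝ × EuclideanSpace ℝ (Fin n₁) × EuclideanSpace ℝ (Fin n₂)) : ℝ :=
  a.1 * b.1 * profileSpeed n₁ n₂ ϱ e.1
    + (e.1 ^ 2 + Real.sinh ϱ ^ 2) * innerSL ℝ (fderiv ℝ X e.2.1 a.2.1) (fderiv ℝ X e.2.1 b.2.1)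
    + (e.1 ^ 2 + Real.cosh ϱ ^ 2) * lorentzForm n₂ (fderiv ℝ Y e.2.2 a.2.2) (fderiv ℝ Y e.2.2 b.2.2)

/-- Every cross term between the position X or Y and its derivative vanishes, and what is left are
squared moduli times real forms. That the product is real is the Lagrangian condition; its value is
the induced metric. -/
lemma hermForm_fderiv_fderiv_horizontalLift
    (a b : ℝ × EuclideanSpace ℝ (Fin n₁) × EuclideanSpace ℝ (Fin n₂)) :
    hermForm (fderiv ℝ (horizontalLift n₁ n₂ ϱ X Y) e a)
      (fderiv ℝ (horizontalLift n₁ n₂ ϱ X Y) e b) = (liftMetric n₁ n₂ ϱ X Y e a b : ℝ) := by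
  have o1 : ∀ u, (innerSL ℝ (X e.2.1)) (fderiv ℝ X e.2.1 u) = 0 := fun u => by
    rw [hX.symm]; exact hX.fderiv_orthogonal _ _
  have o2 : ∀ u, (lorentzForm n₂ (Y e.2.2)) (fderiv ℝ Y e.2.2 u) = 0 := fun u => by
    rw [hY.symm]; exact hY.fderiv_orthogonal _ _
  rw [fderiv_horizontalLift hϱ hX hY, fderiv_horizontalLift hϱ hX hY]
  simp only [hermForm_add_left, hermForm_add_right, hermForm_smul_left, hermForm_smul_right,
    hermForm_blockLeft, hermForm_blockRight, hermForm_blockLeft_blockRight,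
    hermForm_blockRight_blockLeft, hX.apply_self, hY.apply_self, hX.fderiv_orthogonal,
    hY.fderiv_orthogonal, o1, o2, map_mul, Complex.conj_ofReal]
  have h1 := profileCurve₁_mul_conj (n₁ := n₁) (n₂ := n₂) hϱ e.1
  have h2 := profileCurve₂_mul_conj (n₁ := n₁) (n₂ := n₂) (ϱ := ϱ) e.1
  have h3 := profileSpeed_eq (n₁ := n₁) (n₂ := n₂) hϱ e.1
  rw [liftMetric]
  push_cast at h1 h2 h3 ⊢
  rw [← h1, ← h2, ← h3]
  ring

lemma liftMetric_pos {a : ℝ × EuclideanSpace ℝ (Fin n₁) × EuclideanSpace ℝ (Fin n₂)}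
    (ha : a ≠ 0) : 0 < liftMetric n₁ n₂ ϱ X Y e a a := by
  have h0 := profileSpeed_pos (n₁ := n₁) (n₂ := n₂) hϱ e.1
  have h1 : 0 < e.1 ^ 2 + Real.sinh ϱ ^ 2 := by have := sinh_sq_pos hϱ; positivity
  have h2 : 0 < e.1 ^ 2 + Real.cosh ϱ ^ 2 := by have := cosh_sq_pos ϱ; positivity
  have p0 : 0 ≤ a.1 * a.1 * profileSpeed n₁ n₂ ϱ e.1 := mul_nonneg (mul_self_nonneg _) h0.le
  have p1 : 0 ≤ innerSL ℝ (fderiv ℝ X e.2.1 a.2.1) (fderiv ℝ X e.2.1 a.2.1) := by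
    by_cases h : a.2.1 = 0
    · simp [h]
    · exact (hX.pos _ _ h).le
  have p2 : 0 ≤ lorentzForm n₂ (fderiv ℝ Y e.2.2 a.2.2) (fderiv ℝ Y e.2.2 a.2.2) := by
    by_cases h : a.2.2 = 0
    · simp [h]
    · exact (hY.pos _ _ h).le
  have q1 := mul_nonneg h1.le p1
  have q2 := mul_nonneg h2.le p2
  rw [liftMetric]
  by_cases c0 : a.1 = 0
  · by_cases c1 : a.2.1 = 0
    · have c2 : a.2.2 ≠ 0 := fun c2 => ha (Prod.ext c0 (Prod.ext c1 c2))
      have := mul_pos h2 (hY.pos e.2.2 _ c2)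
      linarith
    · have := mul_pos h1 (hX.pos e.2.1 _ c1)
      linarith
  · have := mul_pos (mul_self_pos.2 c0) h0
    linarith

/-- Reduces second derivatives to one-variable derivatives, so that on each factor only the matching
part of the lift has to be differentiated. -/
lemma fderiv_fderiv_horizontalLift
    {a b : ℝ × EuclideanSpace ℝ (Fin n₁) × EuclideanSpace ℝ (Fin n₂)} {w : Fin (n₁ + 1 + n₂ + 1) → ℂ}
    (hw : HasDerivAt (fun t : ℝ => fderiv ℝ (horizontalLift n₁ n₂ ϱ X Y) (e + t • a) b) w 0) :
    fderiv ℝ (fderiv ℝ (horizontalLift n₁ n₂ ϱ X Y)) e a b = w := by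
  have hl : HasDerivAt (fun t : ℝ => e + t • a) a 0 := by
    simpa using ((hasDerivAt_id (0 : ℝ)).smul_const a).const_add e
  have h0 := ((((contDiff_horizontalLift hϱ hX hY).fderiv_right (m := ∞)
    (by simp)).differentiable (by simp)) e).hasFDerivAt |>.comp_hasDerivAt_of_eq 0 hl (by simp)
  have h1 := h0.clm_apply (hasDerivAt_const (0 : ℝ) b)
  simpa using h1.unique hw

lemma fderiv_fderiv_horizontalLift_profile {σ : ℝ} {γ₁' γ₂' : ℂ}
    (h₁ : HasDerivAt (profileVel₁ n₁ n₂ ϱ) γ₁' e.1) (h₂ : HasDerivAt (profileVel₂ n₁ n₂ ϱ) γ₂' e.1) :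
    fderiv ℝ (fderiv ℝ (horizontalLift n₁ n₂ ϱ X Y)) e (σ, 0, 0) (σ, 0, 0)
      = ((σ ^ 2 : ℝ) * γ₁') • blockLeft n₁ n₂ (X e.2.1)
        + ((σ ^ 2 : ℝ) * γ₂') • blockRight n₁ n₂ (Y e.2.2) := by
  refine fderiv_fderiv_horizontalLift hϱ hX hY e ?_
  simp only [fderiv_horizontalLift hϱ hX hY, map_zero, smul_zero, add_zero, Prod.fst_add,
    Prod.snd_add, Prod.smul_fst, Prod.smul_snd, smul_eq_mul]
  have hs : HasDerivAt (fun t : ℝ => e.1 + t * σ) σ 0 := by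
    simpa using ((hasDerivAt_id (0 : ℝ)).mul_const σ).const_add e.1
  have g1 := ((h₁.scomp_of_eq (0 : ℝ) hs (by simp)).const_mul (σ : ℂ)).smul_const
    (blockLeft n₁ n₂ (X e.2.1))
  have g2 := ((h₂.scomp_of_eq (0 : ℝ) hs (by simp)).const_mul (σ : ℂ)).smul_const
    (blockRight n₁ n₂ (Y e.2.2))
  refine (g1.add g2).congr_deriv ?_
  simp only [Complex.real_smul]
  push_cast
  simp only [sq, mul_assoc]

lemma fderiv_fderiv_horizontalLift_left (u : EuclideanSpace ℝ (Fin n₁)) :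
    fderiv ℝ (fderiv ℝ (horizontalLift n₁ n₂ ϱ X Y)) e (0, u, 0) (0, u, 0)
      = profileCurve₁ n₁ n₂ ϱ e.1 • blockLeft n₁ n₂ (fderiv ℝ (fderiv ℝ X) e.2.1 u u) := by
  refine fderiv_fderiv_horizontalLift hϱ hX hY e ?_
  simp only [fderiv_horizontalLift hϱ hX hY, map_zero, smul_zero, add_zero, Prod.fst_add,
    Prod.snd_add, Prod.smul_fst, Prod.smul_snd, Complex.ofReal_zero, zero_mul, zero_smul, zero_add]
  exact HasDerivAt.const_smul (profileCurve₁ n₁ n₂ ϱ e.1)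
    ((blockLeft n₁ n₂).hasFDerivAt.comp_hasDerivAt (0 : ℝ) (hX.hasDerivAt_fderiv_line e.2.1 u))

lemma fderiv_fderiv_horizontalLift_right (v : EuclideanSpace ℝ (Fin n₂)) :
    fderiv ℝ (fderiv ℝ (horizontalLift n₁ n₂ ϱ X Y)) e (0, 0, v) (0, 0, v)
      = profileCurve₂ n₁ n₂ ϱ e.1 • blockRight n₁ n₂ (fderiv ℝ (fderiv ℝ Y) e.2.2 v v) := by
  refine fderiv_fderiv_horizontalLift hϱ hX hY e ?_
  simp only [fderiv_horizontalLift hϱ hX hY, map_zero, smul_zero, add_zero, Prod.fst_add,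
    Prod.snd_add, Prod.smul_fst, Prod.smul_snd, Complex.ofReal_zero, zero_mul, zero_smul, zero_add]
  exact HasDerivAt.const_smul (profileCurve₂ n₁ n₂ ϱ e.1)
    ((blockRight n₁ n₂).hasFDerivAt.comp_hasDerivAt (0 : ℝ) (hY.hasDerivAt_fderiv_line e.2.2 v))

end HorizontalLift

/-! ## The explicit map in charts -/

section ExplicitMap

variable {n₁ n₂ : ℕ} {ϱ : ℝ}

/-- The lift of `explicitMap` in the preferred chart around `p`. -/
def chartLift (n₁ n₂ : ℕ) (ϱ : ℝ)
    (p : ℝ × sphere (0 : EuclideanSpace ℝ (Fin (n₁ + 1))) 1 × RealHyperbolicSpace n₂) :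
    ℝ × EuclideanSpace ℝ (Fin n₁) × EuclideanSpace ℝ (Fin n₂) → Fin (n₁ + 1 + n₂ + 1) → ℂ :=
  horizontalLift n₁ n₂ ϱ (sphereParam n₁ (-p.2.1)) (hyperboloidParam n₂)

lemma explicitLiftFun_eq
    (p : ℝ × sphere (0 : EuclideanSpace ℝ (Fin (n₁ + 1))) 1 × RealHyperbolicSpace n₂) :
    explicitLiftFun n₁ n₂ ϱ p = profileCurve₁ n₁ n₂ ϱ p.1 • blockLeft n₁ n₂ p.2.1.1
      + profileCurve₂ n₁ n₂ ϱ p.1 • blockRight n₁ n₂ p.2.2.1 := by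
  funext i
  rw [blockLeft_eq, blockRight_eq, explicitLiftFun]
  refine Fin.addCases (m := n₁ + 1) (n := n₂ + 1) (fun j => ?_) (fun j => ?_) i <;>
  simp [profileCurve₁, profileCurve₂, profileCurve]

variable (p : ℝ × sphere (0 : EuclideanSpace ℝ (Fin (n₁ + 1))) 1 × RealHyperbolicSpace n₂)

/-- The preferred chart of the sphere at x is stereographic projection from -x, which is why the
lift uses the pole -x; the hyperboloid has its single global chart. -/
lemma chartLift_eq (e : ℝ × EuclideanSpace ℝ (Fin n₁) × EuclideanSpace ℝ (Fin n₂)) :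
    chartLift n₁ n₂ ϱ p e = explicitLiftFun n₁ n₂ ϱ
      ((extChartAt (𝓘(ℝ, ℝ).prod ((𝓡 n₁).prod (𝓡 n₂))) p).symm e) := by
  rw [explicitLiftFun_eq]
  rfl

lemma writtenInExtChartAt_explicitMap :
    writtenInExtChartAt (𝓘(ℝ, ℝ).prod ((𝓡 n₁).prod (𝓡 n₂)))
      𝓘(ℝ, EuclideanSpace ℂ (Fin (n₁ + 1 + n₂))) p (explicitMap n₁ n₂ ϱ)
      = fun e => affineCoord (chartLift n₁ n₂ ϱ p e) := by
  funext e
  rw [chartLift_eq]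
  rfl

lemma chartLift_extChartAt :
    chartLift n₁ n₂ ϱ p (extChartAt (𝓘(ℝ, ℝ).prod ((𝓡 n₁).prod (𝓡 n₂))) p p)
      = explicitLiftFun n₁ n₂ ϱ p := by
  rw [chartLift_eq, extChartAt_to_inv]

lemma toBall_explicitMap :
    (explicitMap n₁ n₂ ϱ p).toBall = affineCoord (explicitLiftFun n₁ n₂ ϱ p) := rfl

lemma finrank_real_euclideanSpace_complex (n : ℕ) :
    Module.finrank ℝ (EuclideanSpace ℂ (Fin n)) = 2 * n := by
  rw [← Module.finrank_mul_finrank ℝ ℂ, Complex.finrank_real_complex, finrank_euclideanSpace_fin]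

variable (hϱ : 0 < ϱ)
include hϱ

lemma contDiff_chartLift : ContDiff ℝ ∞ (chartLift n₁ n₂ ϱ p) :=
  contDiff_horizontalLift hϱ (isQuadricParam_sphereParam n₁ _) (isQuadricParam_hyperboloidParam n₂)

lemma hermForm_chartLift (e : ℝ × EuclideanSpace ℝ (Fin n₁) × EuclideanSpace ℝ (Fin n₂)) :
    hermForm (chartLift n₁ n₂ ϱ p e) (chartLift n₁ n₂ ϱ p e) = -1 :=
  hermForm_horizontalLift_self hϱ (isQuadricParam_sphereParam n₁ _)
    (isQuadricParam_hyperboloidParam n₂) e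

lemma hermForm_fderiv_chartLift (e a : ℝ × EuclideanSpace ℝ (Fin n₁) × EuclideanSpace ℝ (Fin n₂)) :
    hermForm (fderiv ℝ (chartLift n₁ n₂ ϱ p) e a) (chartLift n₁ n₂ ϱ p e) = 0 :=
  hermForm_fderiv_horizontalLift hϱ (isQuadricParam_sphereParam n₁ _)
    (isQuadricParam_hyperboloidParam n₂) e a

lemma contDiff_affineCoord_chartLift :
    ContDiff ℝ ∞ fun e => affineCoord (chartLift n₁ n₂ ϱ p e) := by
  have h := contDiff_pi.1 (contDiff_chartLift p hϱ)
  rw [contDiff_piLp]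
  intro i
  simp only [affineCoord, div_eq_mul_inv]
  exact (h _).mul ((h _).inv fun e => AntiDeSitter.last_ne_zero ⟨_, hermForm_chartLift p hϱ e⟩)

lemma continuous_explicitLiftFun : Continuous (explicitLiftFun n₁ n₂ ϱ) := by
  have h1 := (contDiff_profileCurve (sinh_sq_pos hϱ) (contDiff_theta₁ n₁ n₂ hϱ)).continuous
  have h2 := (contDiff_profileCurve (cosh_sq_pos ϱ) (contDiff_theta₂ n₁ n₂ hϱ)).continuous
  have h3 : Continuous fun y : RealHyperbolicSpace n₂ => y.1 := continuous_subtype_val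
  rw [show explicitLiftFun n₁ n₂ ϱ = _ from funext explicitLiftFun_eq]
  exact ((h1.comp continuous_fst).smul ((blockLeft n₁ n₂).continuous.comp
      (continuous_subtype_val.comp (continuous_fst.comp continuous_snd)))).add
    ((h2.comp continuous_fst).smul ((blockRight n₁ n₂).continuous.comp
      (h3.comp (continuous_snd.comp continuous_snd))))

lemma continuous_explicitMap : Continuous (explicitMap n₁ n₂ ϱ) := by
  have hq : Continuous (hopf : AntiDeSitter (n₁ + 1 + n₂) → ComplexHyperbolicSpace _) :=
    continuous_quotient_mk'
  exact hq.comp ((continuous_explicitLiftFun hϱ).subtype_mk _)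

lemma contMDiff_explicitMap : ContMDiff (𝓘(ℝ, ℝ).prod ((𝓡 n₁).prod (𝓡 n₂)))
    𝓘(ℝ, EuclideanSpace ℂ (Fin (n₁ + 1 + n₂))) ∞ (explicitMap n₁ n₂ ϱ) := by
  intro p
  rw [contMDiffAt_iff]
  refine ⟨(continuous_explicitMap hϱ).continuousAt, ?_⟩
  have h := writtenInExtChartAt_explicitMap (ϱ := ϱ) p
  rw [writtenInExtChartAt] at h
  rw [h]
  exact (contDiff_affineCoord_chartLift p hϱ).contDiffWithinAt

lemma mfderiv_explicitMap (a : ℝ × EuclideanSpace ℝ (Fin n₁) × EuclideanSpace ℝ (Fin n₂)) :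
    mfderiv (𝓘(ℝ, ℝ).prod ((𝓡 n₁).prod (𝓡 n₂))) 𝓘(ℝ, EuclideanSpace ℂ (Fin (n₁ + 1 + n₂)))
      (explicitMap n₁ n₂ ϱ) p a
      = affineDiff (explicitLiftFun n₁ n₂ ϱ p) (fderiv ℝ (chartLift n₁ n₂ ϱ p)
        (extChartAt (𝓘(ℝ, ℝ).prod ((𝓡 n₁).prod (𝓡 n₂))) p p) a) := by
  have hd := (contMDiff_explicitMap hϱ p).mdifferentiableAt (by simp)
  rw [hd.mfderiv, writtenInExtChartAt_explicitMap, ModelWithCorners.range_eq_univ,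
    fderivWithin_univ]
  refine (fderiv_affineCoord_comp (((contDiff_chartLift p hϱ).differentiable (by simp)) _)
    (hermForm_chartLift p hϱ _) a).trans ?_
  rw [chartLift_extChartAt]

/-- The induced metric. -/
lemma inner_mfderiv_explicitMap (a b : ℝ × EuclideanSpace ℝ (Fin n₁) × EuclideanSpace ℝ (Fin n₂))
    (c : ℂ) :
    ballMetric (explicitMap n₁ n₂ ϱ p).toBall
      (c • (show EuclideanSpace ℂ (Fin (n₁ + 1 + n₂)) from
        mfderiv (𝓘(ℝ, ℝ).prod ((𝓡 n₁).prod (𝓡 n₂)))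
        𝓘(ℝ, EuclideanSpace ℂ (Fin (n₁ + 1 + n₂))) (explicitMap n₁ n₂ ϱ) p a))
      (mfderiv (𝓘(ℝ, ℝ).prod ((𝓡 n₁).prod (𝓡 n₂)))
        𝓘(ℝ, EuclideanSpace ℂ (Fin (n₁ + 1 + n₂))) (explicitMap n₁ n₂ ϱ) p b)
      = (c * (liftMetric n₁ n₂ ϱ (sphereParam n₁ (-p.2.1)) (hyperboloidParam n₂)
          (extChartAt (𝓘(ℝ, ℝ).prod ((𝓡 n₁).prod (𝓡 n₂))) p p) a b : ℝ)).re := by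
  have h0 := fun a => hermForm_fderiv_chartLift (ϱ := ϱ) p hϱ
    (extChartAt (𝓘(ℝ, ℝ).prod ((𝓡 n₁).prod (𝓡 n₂))) p p) a
  simp only [chartLift_extChartAt] at h0
  rw [mfderiv_explicitMap p hϱ, mfderiv_explicitMap p hϱ, toBall_explicitMap,
    ← hermForm_fderiv_fderiv_horizontalLift hϱ (isQuadricParam_sphereParam n₁ _)
    (isQuadricParam_hyperboloidParam n₂), ← hermForm_smul_left]
  have h := ballMetric_affineDiff ⟨_, explicitLiftFun_mem n₁ n₂ ϱ p⟩ _ _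
    (by rw [hermForm_smul_left, h0 a, mul_zero] :
      hermForm (c • fderiv ℝ (chartLift n₁ n₂ ϱ p)
        (extChartAt (𝓘(ℝ, ℝ).prod ((𝓡 n₁).prod (𝓡 n₂))) p p) a) _ = 0) (h0 b)
  rw [affineDiff_smul] at h
  exact h

lemma injective_mfderiv_explicitMap : Function.Injective
    (mfderiv (𝓘(ℝ, ℝ).prod ((𝓡 n₁).prod (𝓡 n₂))) 𝓘(ℝ, EuclideanSpace ℂ (Fin (n₁ + 1 + n₂)))
      (explicitMap n₁ n₂ ϱ) p) := by
  rw [injective_iff_map_eq_zero]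
  intro a ha
  by_contra hne
  have h := inner_mfderiv_explicitMap p hϱ a a 1
  have hpos := liftMetric_pos hϱ (isQuadricParam_sphereParam n₁ (-p.2.1))
    (isQuadricParam_hyperboloidParam n₂)
    (extChartAt (𝓘(ℝ, ℝ).prod ((𝓡 n₁).prod (𝓡 n₂))) p p) (a := a) hne
  rw [show mfderiv (𝓘(ℝ, ℝ).prod ((𝓡 n₁).prod (𝓡 n₂)))
    𝓘(ℝ, EuclideanSpace ℂ (Fin (n₁ + 1 + n₂))) (explicitMap n₁ n₂ ϱ) p a
    = (0 : EuclideanSpace ℂ (Fin (n₁ + 1 + n₂))) from ha] at h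
  rw [map_zero, one_mul, Complex.ofReal_re] at h
  exact hpos.ne h

lemma isImmersion_explicitMap : Manifold.IsImmersion (𝓘(ℝ, ℝ).prod ((𝓡 n₁).prod (𝓡 n₂)))
      𝓘(ℝ, EuclideanSpace ℂ (Fin (n₁ + 1 + n₂))) ∞ (explicitMap n₁ n₂ ϱ) := by
  have : IsManifold 𝓘(ℝ, EuclideanSpace ℂ (Fin (n₁ + 1 + n₂))) ∞
    (ComplexHyperbolicSpace (n₁ + 1 + n₂)) := IsManifold.of_le (n := ω) le_top
  have : IsManifold (𝓡 n₂) ∞ (RealHyperbolicSpace n₂) := IsManifold.of_le (n := ω) le_top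
  have : IsManifold (𝓡 n₁) ∞ (sphere (0 : EuclideanSpace ℝ (Fin (n₁ + 1))) 1) :=
    IsManifold.of_le (n := ω) le_top
  -- A Lagrangian tangent space has a complement of its own dimension n₁ + 1 + n₂.
  have hC : Module.finrank ℝ (ℝ × EuclideanSpace ℝ (Fin n₁) × EuclideanSpace ℝ (Fin n₂))
      + Module.finrank ℝ (EuclideanSpace ℝ (Fin (n₁ + 1 + n₂)))
      = Module.finrank ℝ (EuclideanSpace ℂ (Fin (n₁ + 1 + n₂))) := by
    rw [finrank_real_euclideanSpace_complex]
    simp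
    ring
  exact Manifold.IsImmersionOfComplement.isImmersion
    (F := EuclideanSpace ℝ (Fin (n₁ + 1 + n₂))) fun p =>
    isImmersionAtOfComplement_of_injective_mfderiv hC (contMDiff_explicitMap hϱ)
      (injective_mfderiv_explicitMap p hϱ)

theorem isLagrangianMap_explicitMap : IsLagrangianMap (complexHyperbolicMetric (n₁ + 1 + n₂))
    (𝓘(ℝ, ℝ).prod ((𝓡 n₁).prod (𝓡 n₂))) (complexHyperbolicJ (n₁ + 1 + n₂))
    (explicitMap n₁ n₂ ϱ) := by
  refine ⟨?_, fun p u v => ?_⟩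
  · rw [finrank_real_euclideanSpace_complex]
    simp
    ring
  · refine (inner_mfderiv_explicitMap p hϱ u v Complex.I).trans ?_
    simp

end ExplicitMap

/-! ## Minimality -/

section Minimal

variable {n₁ n₂ : ℕ} {ϱ : ℝ}

/-- In an orthonormal frame adapted to the product structure, the trace of the second derivative of
the horizontal lift is tangent, up to a complex multiple of the position vector. -/
lemma exists_frame_trace_horizontalLift (hϱ : 0 < ϱ)
    {X : EuclideanSpace ℝ (Fin n₁) → EuclideanSpace ℝ (Fin (n₁ + 1))}
    {Y : EuclideanSpace ℝ (Fin n₂) → EuclideanSpace ℝ (Fin (n₂ + 1))}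
    (hX : IsQuadricParam (innerSL ℝ) 1 X) (hY : IsQuadricParam (lorentzForm n₂) (-1) Y)
    (e : ℝ × EuclideanSpace ℝ (Fin n₁) × EuclideanSpace ℝ (Fin n₂)) :
    ∃ f : Unit ⊕ (Fin n₁ ⊕ Fin n₂) → ℝ × EuclideanSpace ℝ (Fin n₁) × EuclideanSpace ℝ (Fin n₂),
      (∀ i j, liftMetric n₁ n₂ ϱ X Y e (f i) (f j) = if i = j then 1 else 0) ∧
      ∃ (α : ℂ) (v : ℝ × EuclideanSpace ℝ (Fin n₁) × EuclideanSpace ℝ (Fin n₂)),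
        ∑ i, fderiv ℝ (fderiv ℝ (horizontalLift n₁ n₂ ϱ X Y)) e (f i) (f i)
          = α • horizontalLift n₁ n₂ ϱ X Y e + fderiv ℝ (horizontalLift n₁ n₂ ϱ X Y) e v := by
  have hA := profileSpeed_pos (n₁ := n₁) (n₂ := n₂) hϱ e.1
  have h1 : 0 < e.1 ^ 2 + Real.sinh ϱ ^ 2 := by have := sinh_sq_pos hϱ; positivity
  have h2 : 0 < e.1 ^ 2 + Real.cosh ϱ ^ 2 := by have := cosh_sq_pos ϱ; positivity
  have hsq : ∀ x : ℝ, 0 < x → (Real.sqrt x)⁻¹ * (Real.sqrt x)⁻¹ = x⁻¹ := fun x hx => by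
    rw [← mul_inv, Real.mul_self_sqrt hx.le]
  obtain ⟨f₁, hf₁⟩ := hX.exists_orthonormal (finrank_euclideanSpace_fin) e.2.1
  obtain ⟨f₂, hf₂⟩ := hY.exists_orthonormal (finrank_euclideanSpace_fin) e.2.2
  obtain ⟨γ₁', γ₂', α, β, hγ₁, hγ₂, e₁, e₂⟩ :=
    exists_profile_minimal (n₁ := n₁) (n₂ := n₂) hϱ e.1
  -- The unit vectors are rescaled by 1 / r₁ and 1 / r₂ for the warped induced metric. Hence Gauss's
  -- formula gives the normal terms -X / r₁² and +Y / r₂² for each vector, the opposite signs coming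
  -- from ε = 1 and ε = -1.
  choose u₁ hu₁ using fun k => hX.exists_gauss (by simp) (by norm_num) e.2.1
    ((Real.sqrt (e.1 ^ 2 + Real.sinh ϱ ^ 2))⁻¹ • f₁ k)
  choose u₂ hu₂ using fun k => hY.exists_gauss (by simp) (by norm_num) e.2.2
    ((Real.sqrt (e.1 ^ 2 + Real.cosh ϱ ^ 2))⁻¹ • f₂ k)
  refine ⟨Sum.elim (fun _ => ((Real.sqrt (profileSpeed n₁ n₂ ϱ e.1))⁻¹, 0, 0))
    (Sum.elim (fun k => (0, (Real.sqrt (e.1 ^ 2 + Real.sinh ϱ ^ 2))⁻¹ • f₁ k, 0))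
      fun k => (0, 0, (Real.sqrt (e.1 ^ 2 + Real.cosh ϱ ^ 2))⁻¹ • f₂ k)), ?_, α,
    (β, ∑ k, u₁ k, ∑ k, u₂ k), ?_⟩
  · rintro (i | i | i) (j | j | j)
    · simp [liftMetric, hsq _ hA, hA.ne']
    · simp [liftMetric]
    · simp [liftMetric]
    · simp [liftMetric]
    · simp only [liftMetric, Sum.elim_inr, Sum.elim_inl, map_smul, smul_apply,
        smul_eq_mul, hf₁, map_zero, mul_zero, zero_mul, zero_add, add_zero, Sum.inr.injEq,
        Sum.inl.injEq]
      rw [← mul_assoc (Real.sqrt _)⁻¹, hsq _ h1]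
      split_ifs <;> simp [h1.ne']
    · simp [liftMetric]
    · simp [liftMetric]
    · simp [liftMetric]
    · simp only [liftMetric, Sum.elim_inr, map_smul, smul_apply,
        smul_eq_mul, hf₂, map_zero, mul_zero, zero_mul, zero_add, Sum.inr.injEq]
      rw [← mul_assoc (Real.sqrt _)⁻¹, hsq _ h2]
      split_ifs <;> simp [h2.ne']
  · simp only [Fintype.sum_sum_type, Sum.elim_inl, Sum.elim_inr, Finset.univ_unique,
      Finset.sum_singleton, fderiv_fderiv_horizontalLift_profile hϱ hX hY e hγ₁ hγ₂,
      fderiv_fderiv_horizontalLift_left hϱ hX hY, fderiv_fderiv_horizontalLift_right hϱ hX hY,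
      hu₁, hu₂, fderiv_horizontalLift hϱ hX hY, horizontalLift]
    simp only [map_smul, smul_apply, smul_eq_mul, hf₁, hf₂, if_true, mul_one, map_sub, map_sum,
      hsq _ h1, hsq _ h2, one_mul, smul_sub, Finset.sum_sub_distrib, Finset.sum_const,
      Finset.card_univ, Fintype.card_fin, Finset.smul_sum]
    -- The tangential Gauss terms match the components of v along the two factors; the remaining
    -- multiples of X and of Y are the two profile equations.
    have e₁' := congrArg (fun c : ℂ => c • blockLeft n₁ n₂ (X e.2.1)) e₁
    have e₂' := congrArg (fun c : ℂ => c • blockRight n₁ n₂ (Y e.2.2)) e₂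
    funext i
    have e₁i := congrFun e₁' i
    have e₂i := congrFun e₂' i
    simp only [Pi.add_apply, Pi.sub_apply, Pi.smul_apply, Finset.sum_apply] at e₁i e₂i ⊢
    simp only [smul_eq_mul, Complex.real_smul, nsmul_eq_mul, inv_pow, Real.sq_sqrt hA.le]
      at e₁i e₂i ⊢
    push_cast at e₁i e₂i ⊢
    linear_combination e₁i + e₂i

/-- The bilinear form `(a, b) ↦ ⟨π(D(a, b)), ν⟩`, where `π` is the differential at `z` of the affine
coordinate. -/
def projForm {n : ℕ} {V : Type*} [NormedAddCommGroup V] [NormedSpace ℝ V]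
    (w : EuclideanSpace ℂ (Fin n)) (z : Fin (n + 1) → ℂ)
    (D : V →L[ℝ] V →L[ℝ] Fin (n + 1) → ℂ) (ν : EuclideanSpace ℂ (Fin n)) : V →ₗ[ℝ] V →ₗ[ℝ] ℝ :=
  LinearMap.mk₂ ℝ (fun a b => ballMetric w (affineDiff z (D a b)) ν)
    (fun a a' b => by simp only [map_add, add_apply, affineDiff_add])
    (fun c a b => by
      simp only [map_smul, smul_apply, ← Complex.coe_smul, affineDiff_smul]
      simp only [Complex.coe_smul, map_smul, smul_apply])
    (fun a b b' => by simp only [map_add, add_apply, affineDiff_add])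
    (fun c a b => by
      simp only [map_smul, ← Complex.coe_smul, affineDiff_smul]
      simp only [Complex.coe_smul, map_smul, smul_apply])

lemma sum_projForm {n : ℕ} {V : Type*} [NormedAddCommGroup V] [NormedSpace ℝ V]
    (w : EuclideanSpace ℂ (Fin n)) (z : Fin (n + 1) → ℂ)
    (D : V →L[ℝ] V →L[ℝ] Fin (n + 1) → ℂ) (ν : EuclideanSpace ℂ (Fin n)) {ι : Type*} [Fintype ι]
    (f : ι → V) :
    ∑ i, projForm w z D ν (f i) (f i) = ballMetric w (affineDiff z (∑ i, D (f i) (f i))) ν := by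
  change _ = ballMetric w (affineDiffₗ z _) ν
  rw [map_sum, map_sum, sum_apply]
  rfl

variable (hϱ : 0 < ϱ)
  (p : ℝ × sphere (0 : EuclideanSpace ℝ (Fin (n₁ + 1))) 1 × RealHyperbolicSpace n₂)
include hϱ

/-- The second fundamental form of `explicitMap` is the projection of the second derivative of its
horizontal lift. -/
lemma secondFundamentalForm_explicitMap
    (a b : ℝ × EuclideanSpace ℝ (Fin n₁) × EuclideanSpace ℝ (Fin n₂))
    (ν : EuclideanSpace ℂ (Fin (n₁ + 1 + n₂))) :
    secondFundamentalForm (complexHyperbolicMetric (n₁ + 1 + n₂))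
      (𝓘(ℝ, ℝ).prod ((𝓡 n₁).prod (𝓡 n₂))) (explicitMap n₁ n₂ ϱ) p a b ν
      = ballMetric (explicitMap n₁ n₂ ϱ p).toBall (affineDiff (explicitLiftFun n₁ n₂ ϱ p)
        (fderiv ℝ (fderiv ℝ (chartLift n₁ n₂ ϱ p))
          (extChartAt (𝓘(ℝ, ℝ).prod ((𝓡 n₁).prod (𝓡 n₂))) p p) a b)) ν := by
  have hn : ∀ e, ‖affineCoord (chartLift n₁ n₂ ϱ p e)‖ < 1 := fun e =>
    AntiDeSitter.norm_affineCoord_lt ⟨_, hermForm_chartLift p hϱ e⟩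
  have h := fderiv_fderiv_affineCoord_comp ((contDiff_chartLift p hϱ).of_le (by norm_cast))
    (hermForm_chartLift p hϱ) (hermForm_fderiv_chartLift p hϱ)
    (extChartAt (𝓘(ℝ, ℝ).prod ((𝓡 n₁).prod (𝓡 n₂))) p p) a b
  rw [chartLift_extChartAt] at h
  rw [← h, toBall_explicitMap, map_add, add_apply]
  unfold secondFundamentalForm
  rw [writtenInExtChartAt_explicitMap]
  simp only
  rw [metricInChart_complexHyperbolic _ (hn _), christoffel_complexHyperbolic _ (hn _),
    chartLift_extChartAt]

theorem isMinimalMap_explicitMap : IsMinimalMap (complexHyperbolicMetric (n₁ + 1 + n₂))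
    (𝓘(ℝ, ℝ).prod ((𝓡 n₁).prod (𝓡 n₂))) (explicitMap n₁ n₂ ϱ) := by
  refine fun p => ⟨fun v => map_zero _, fun e he ν hν => ?_⟩
  obtain ⟨f, hf, α, v, ht⟩ := exists_frame_trace_horizontalLift hϱ
    (isQuadricParam_sphereParam n₁ (-p.2.1)) (isQuadricParam_hyperboloidParam n₂)
    (extChartAt (𝓘(ℝ, ℝ).prod ((𝓡 n₁).prod (𝓡 n₂))) p p)
  let g := LinearMap.mk₂ ℝ (liftMetric n₁ n₂ ϱ (sphereParam n₁ (-p.2.1)) (hyperboloidParam n₂)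
      (extChartAt (𝓘(ℝ, ℝ).prod ((𝓡 n₁).prod (𝓡 n₂))) p p))
    (fun a a' b => by simp only [liftMetric, Prod.fst_add, Prod.snd_add, map_add, add_apply]; ring)
    (fun c a b => by
      simp only [liftMetric, Prod.smul_fst, Prod.smul_snd, map_smul, smul_apply, smul_eq_mul]; ring)
    (fun a b b' => by simp only [liftMetric, Prod.fst_add, Prod.snd_add, map_add]; ring)
    (fun c a b => by
      simp only [liftMetric, Prod.smul_fst, Prod.smul_snd, map_smul, smul_eq_mul]; ring)
  have hg : ∀ a b, g a b = g b a := fun a b => by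
    simp only [g, LinearMap.mk₂_apply, liftMetric]
    rw [(isQuadricParam_sphereParam n₁ (-p.2.1)).symm, (isQuadricParam_hyperboloidParam n₂).symm,
      mul_comm a.1]
  let B := projForm (explicitMap n₁ n₂ ϱ p).toBall (explicitLiftFun n₁ n₂ ϱ p)
    (fderiv ℝ (fderiv ℝ (chartLift n₁ n₂ ϱ p))
      (extChartAt (𝓘(ℝ, ℝ).prod ((𝓡 n₁).prod (𝓡 n₂))) p p)) ν
  -- The given frame and the adapted one are orthonormal for the same induced metric, so the trace
  -- may be taken in the adapted frame.
  have hge : ∀ i j, g (e i) (e j) = if i = j then 1 else 0 := by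
    intro i j
    have h := inner_mfderiv_explicitMap p hϱ (e i) (e j) 1
    rw [one_mul, one_smul, Complex.ofReal_re] at h
    exact h.symm.trans (he i j)
  have htr := sum_bilin_orthonormal g B hg hge hf (Fintype.card_fin _)
    (by simp)
  rw [show (complexHyperbolicMetric (n₁ + 1 + n₂)).inner (explicitMap n₁ n₂ ϱ p) 0 ν = 0 by
    rw [map_zero]; rfl, mul_zero]
  refine Eq.symm ((Finset.sum_congr rfl fun i _ =>
    secondFundamentalForm_explicitMap hϱ p (e i) (e i) ν).trans (htr.trans ?_))
  have ht' : ∑ i, fderiv ℝ (fderiv ℝ (chartLift n₁ n₂ ϱ p))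
      (extChartAt (𝓘(ℝ, ℝ).prod ((𝓡 n₁).prod (𝓡 n₂))) p p) (f i) (f i)
      = α • chartLift n₁ n₂ ϱ p (extChartAt (𝓘(ℝ, ℝ).prod ((𝓡 n₁).prod (𝓡 n₂))) p p)
        + fderiv ℝ (chartLift n₁ n₂ ϱ p)
          (extChartAt (𝓘(ℝ, ℝ).prod ((𝓡 n₁).prod (𝓡 n₂))) p p) v := ht
  refine (sum_projForm _ _ _ _ f).trans ?_
  -- The position vector is vertical, as is any complex multiple of it, and so projects to 0; what
  -- remains is the tangent vector dF(v), on which the normal ν vanishes.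
  rw [ht', chartLift_extChartAt, affineDiff_add, affineDiff_smul, affineDiff_self,
    smul_zero, zero_add, ← mfderiv_explicitMap p hϱ]
  exact hν v

end Minimal

/-! ## The embedding property -/

/-- The topology of X is already induced by g ∘ f, and continuity of g at the points of the image is
enough to pull neighbourhoods back through f. This allows a g that is discontinuous elsewhere. -/
lemma isEmbedding_of_comp_continuousAt {X Y Z : Type*} [TopologicalSpace X] [TopologicalSpace Y]
    [TopologicalSpace Z] {f : X → Y} {g : Y → Z} (hf : Continuous f)
    (hg : ∀ x, ContinuousAt g (f x)) (h : Topology.IsEmbedding (g ∘ f)) :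
    Topology.IsEmbedding f := by
  refine ⟨Topology.isInducing_iff_nhds.2 fun x => le_antisymm hf.continuousAt.le_comap ?_,
    h.injective.of_comp⟩
  rw [h.isInducing.nhds_eq_comap, ← Filter.comap_comap]
  exact Filter.comap_mono (hg x).le_comap

section Embedding

variable {n₁ n₂ : ℕ} {ϱ : ℝ}

/-- Recovers the angle `θ₁ - θ₂`, the point of the sphere and the chart coordinate of the point of
the hyperboloid from the affine coordinate of a point of the image of `explicitMap`. -/
def ballRetraction (n₁ n₂ : ℕ) (w : EuclideanSpace ℂ (Fin (n₁ + 1 + n₂))) :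
    ℝ × EuclideanSpace ℝ (Fin (n₁ + 1)) × EuclideanSpace ℝ (Fin n₂) :=
  (Real.arctan ((∑ i, (w (Fin.castAdd n₂ i)).im * (w (Fin.castAdd n₂ i)).re)
      / ∑ i, (w (Fin.castAdd n₂ i)).re ^ 2),
    WithLp.toLp 2 fun i => (w (Fin.castAdd n₂ i)).re
      / Real.sqrt (∑ i, (w (Fin.castAdd n₂ i)).re ^ 2),
    WithLp.toLp 2 fun j => (w (Fin.natAdd (n₁ + 1) j)).re
      / Real.sqrt (1 - ∑ j, (w (Fin.natAdd (n₁ + 1) j)).re ^ 2))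

lemma continuousAt_ballRetraction {w : EuclideanSpace ℂ (Fin (n₁ + 1 + n₂))}
    (h₁ : ∑ i, (w (Fin.castAdd n₂ i)).re ^ 2 ≠ 0)
    (h₂ : Real.sqrt (1 - ∑ j, (w (Fin.natAdd (n₁ + 1) j)).re ^ 2) ≠ 0) :
    ContinuousAt (ballRetraction n₁ n₂) w := by
  have hw : ∀ k, Continuous fun w : EuclideanSpace ℂ (Fin (n₁ + 1 + n₂)) => w k :=
    fun k => PiLp.continuous_apply 2 _ k
  have hre : ∀ k, Continuous fun w : EuclideanSpace ℂ (Fin (n₁ + 1 + n₂)) => (w k).re :=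
    fun k => Complex.continuous_re.comp (hw k)
  have him : ∀ k, Continuous fun w : EuclideanSpace ℂ (Fin (n₁ + 1 + n₂)) => (w k).im :=
    fun k => Complex.continuous_im.comp (hw k)
  have hs₁ : Continuous fun w : EuclideanSpace ℂ (Fin (n₁ + 1 + n₂)) =>
      ∑ i, (w (Fin.castAdd n₂ i)).re ^ 2 := continuous_finsetSum _ fun i _ => (hre _).pow 2
  have hs₂ : Continuous fun w : EuclideanSpace ℂ (Fin (n₁ + 1 + n₂)) =>
      ∑ j, (w (Fin.natAdd (n₁ + 1) j)).re ^ 2 := continuous_finsetSum _ fun i _ => (hre _).pow 2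
  have h₁' : Real.sqrt (∑ i, (w (Fin.castAdd n₂ i)).re ^ 2) ≠ 0 :=
    (Real.sqrt_pos.2 ((Finset.sum_nonneg fun i _ => sq_nonneg _).lt_of_ne' h₁)).ne'
  refine ContinuousAt.prodMk ?_ (ContinuousAt.prodMk ?_ ?_)
  · exact Real.continuous_arctan.continuousAt.comp ((continuous_finsetSum _ fun i _ =>
      (him _).mul (hre _)).continuousAt.div hs₁.continuousAt h₁)
  · exact (PiLp.continuous_toLp 2 _).continuousAt.comp (continuousAt_pi.2 fun i =>
      (hre _).continuousAt.div hs₁.sqrt.continuousAt h₁')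
  · exact (PiLp.continuous_toLp 2 _).continuousAt.comp (continuousAt_pi.2 fun j =>
      (hre _).continuousAt.div (continuous_const.sub hs₂).sqrt.continuousAt h₂)

variable (p : ℝ × sphere (0 : EuclideanSpace ℝ (Fin (n₁ + 1))) 1 × RealHyperbolicSpace n₂)

/-- Dividing by the last coordinate removes the phase of γ₂, so only θ₁ - θ₂ survives: the first
block is a real vector times a common phase. -/
lemma toBall_explicitMap_castAdd (i : Fin (n₁ + 1)) :
    (explicitMap n₁ n₂ ϱ p).toBall (Fin.castAdd n₂ i)
      = ((Real.sqrt (p.1 ^ 2 + Real.sinh ϱ ^ 2) / Real.sqrt (p.1 ^ 2 + Real.cosh ϱ ^ 2)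
          / p.2.2.1 (Fin.last n₂) * p.2.1.1 i : ℝ) : ℂ)
        * Complex.exp ((theta₁ n₁ n₂ ϱ p.1 - theta₂ n₁ n₂ ϱ p.1 : ℝ) * Complex.I) := by
  have hl : explicitLiftFun n₁ n₂ ϱ p (Fin.castSucc (Fin.castAdd n₂ i))
        = Real.sqrt (p.1 ^ 2 + Real.sinh ϱ ^ 2)
          * Complex.exp (Complex.I * theta₁ n₁ n₂ ϱ p.1) * (p.2.1.1 i : ℂ) :=
    Fin.append_left (m := n₁ + 1) (n := n₂ + 1) _ _ i
  have hrl : explicitLiftFun n₁ n₂ ϱ p (Fin.last (n₁ + 1 + n₂))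
        = Real.sqrt (p.1 ^ 2 + Real.cosh ϱ ^ 2)
          * Complex.exp (Complex.I * theta₂ n₁ n₂ ϱ p.1) * (p.2.2.1 (Fin.last n₂) : ℂ) :=
    Fin.append_right (m := n₁ + 1) (n := n₂ + 1) _ _ (Fin.last n₂)
  change explicitLiftFun n₁ n₂ ϱ p _ / explicitLiftFun n₁ n₂ ϱ p _ = _
  rw [hl, hrl, Complex.ofReal_sub, sub_mul, Complex.exp_sub, mul_comm Complex.I, mul_comm Complex.I]
  push_cast
  simp only [div_eq_mul_inv, mul_inv]
  ring

/-- Modulus and phase of γ₂ both cancel: the second block is the real projective (Klein) coordinate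
of y and does not involve s or x. -/
lemma toBall_explicitMap_natAdd (j : Fin n₂) :
    (explicitMap n₁ n₂ ϱ p).toBall (Fin.natAdd (n₁ + 1) j)
      = ((p.2.2.1 j.castSucc / p.2.2.1 (Fin.last n₂) : ℝ) : ℂ) := by
  have hr : explicitLiftFun n₁ n₂ ϱ p (Fin.castSucc (Fin.natAdd (n₁ + 1) j))
        = Real.sqrt (p.1 ^ 2 + Real.cosh ϱ ^ 2)
          * Complex.exp (Complex.I * theta₂ n₁ n₂ ϱ p.1) * (p.2.2.1 j.castSucc : ℂ) :=
    Fin.append_right (m := n₁ + 1) (n := n₂ + 1) _ _ j.castSucc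
  have hrl : explicitLiftFun n₁ n₂ ϱ p (Fin.last (n₁ + 1 + n₂))
        = Real.sqrt (p.1 ^ 2 + Real.cosh ϱ ^ 2)
          * Complex.exp (Complex.I * theta₂ n₁ n₂ ϱ p.1) * (p.2.2.1 (Fin.last n₂) : ℂ) :=
    Fin.append_right (m := n₁ + 1) (n := n₂ + 1) _ _ (Fin.last n₂)
  have h2 : (Real.sqrt (p.1 ^ 2 + Real.cosh ϱ ^ 2) : ℂ) ≠ 0 := by
    have := cosh_sq_pos ϱ
    exact_mod_cast (Real.sqrt_pos.2 (by positivity : 0 < p.1 ^ 2 + Real.cosh ϱ ^ 2)).ne'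
  change explicitLiftFun n₁ n₂ ϱ p _ / explicitLiftFun n₁ n₂ ϱ p _ = _
  rw [hr, hrl, mul_div_mul_left _ _ (mul_ne_zero h2 (Complex.exp_ne_zero _)), Complex.ofReal_div]

theorem isEmbedding_explicitMap (hϱ : 0 < ϱ) : Topology.IsEmbedding (explicitMap n₁ n₂ ϱ) := by
  have hsph : ∀ x : sphere (0 : EuclideanSpace ℝ (Fin (n₁ + 1))) 1, ∑ i, x.1 i ^ 2 = 1 := by
    intro x
    have h := EuclideanSpace.norm_sq_eq x.1
    rw [mem_sphere_zero_iff_norm.1 x.2] at h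
    simpa using h.symm
  have hrad : ∀ p : ℝ × sphere (0 : EuclideanSpace ℝ (Fin (n₁ + 1))) 1 × RealHyperbolicSpace n₂,
      0 < Real.sqrt (p.1 ^ 2 + Real.sinh ϱ ^ 2) / Real.sqrt (p.1 ^ 2 + Real.cosh ϱ ^ 2)
          / p.2.2.1 (Fin.last n₂) := fun p => by
    have h1 := sinh_sq_pos hϱ
    have h2 := cosh_sq_pos ϱ
    have h3 := p.2.2.2.2
    positivity
  have hcos : ∀ s, 0 < Real.cos (theta₁ n₁ n₂ ϱ s - theta₂ n₁ n₂ ϱ s) := fun s =>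
    Real.cos_pos_of_mem_Ioo (abs_lt.1 (abs_thetaDiff_lt n₁ n₂ hϱ s))
  -- As |x| = 1, the squared length of the real part of the first block is a known square. Its root
  -- is the factor itself and not its negative because the cosine is positive.
  have hsum₁ : ∀ p, ∑ i, ((explicitMap n₁ n₂ ϱ p).toBall (Fin.castAdd n₂ i)).re ^ 2
      = (Real.sqrt (p.1 ^ 2 + Real.sinh ϱ ^ 2) / Real.sqrt (p.1 ^ 2 + Real.cosh ϱ ^ 2)
          / p.2.2.1 (Fin.last n₂) * Real.cos (theta₁ n₁ n₂ ϱ p.1 - theta₂ n₁ n₂ ϱ p.1)) ^ 2 := by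
    intro p
    simp only [toBall_explicitMap_castAdd, Complex.re_ofReal_mul, Complex.exp_ofReal_mul_I_re,
      mul_pow]
    rw [← Finset.sum_mul, ← Finset.mul_sum, hsph, mul_one]
  have hsum₂ : ∀ p, 1 - ∑ j, ((explicitMap n₁ n₂ ϱ p).toBall (Fin.natAdd (n₁ + 1) j)).re ^ 2
      = ((p.2.2.1 (Fin.last n₂))⁻¹) ^ 2 := by
    intro p
    have h3 := p.2.2.2.2
    simp only [toBall_explicitMap_natAdd, Complex.ofReal_re, div_pow]
    rw [← Finset.sum_div, show ∑ j : Fin n₂, p.2.2.1 j.castSucc ^ 2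
      = p.2.2.1 (Fin.last n₂) ^ 2 - 1 by linarith [p.2.2.2.1]]
    field_simp
    ring
  refine Topology.IsEmbedding.of_comp (continuous_explicitMap hϱ)
    ComplexHyperbolicSpace.continuous_toBall (isEmbedding_of_comp_continuousAt
      (ComplexHyperbolicSpace.continuous_toBall.comp (continuous_explicitMap hϱ))
      (g := ballRetraction n₁ n₂) (fun p => ?_) ?_)
  · refine continuousAt_ballRetraction ?_ ?_
    · rw [Function.comp_apply, hsum₁]
      exact pow_ne_zero 2 (mul_pos (hrad p) (hcos _)).ne'
    · have h3 := p.2.2.2.2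
      rw [Function.comp_apply, hsum₂, Real.sqrt_sq (by positivity)]
      positivity
  · have hδ : Continuous fun s => theta₁ n₁ n₂ ϱ s - theta₂ n₁ n₂ ϱ s :=
      (contDiff_theta₁ n₁ n₂ hϱ).continuous.sub (contDiff_theta₂ n₁ n₂ hϱ).continuous
    have hemb : Topology.IsEmbedding fun s => theta₁ n₁ n₂ ϱ s - theta₂ n₁ n₂ ϱ s :=
      (strictMono_thetaDiff n₁ n₂ hϱ).isEmbedding_of_ordConnected
        (isPreconnected_range hδ).ordConnected
    -- The retraction turns the map into (s, x, y) ↦ (θ₁ - θ₂, x, chart of y), a product of three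
    -- embeddings.
    convert hemb.prodMap ((Topology.IsEmbedding.subtypeVal (p := fun x =>
      x ∈ sphere (0 : EuclideanSpace ℝ (Fin (n₁ + 1))) 1)).prodMap
      (RealHyperbolicSpace.chart n₂).isEmbedding) using 1
    funext p
    refine Prod.ext ?_ (Prod.ext (PiLp.ext fun i => ?_) (PiLp.ext fun j => ?_))
    · change Real.arctan _ = theta₁ n₁ n₂ ϱ p.1 - theta₂ n₁ n₂ ϱ p.1
      have hb := abs_lt.1 (abs_thetaDiff_lt n₁ n₂ hϱ p.1)
      -- The quotient inside the arctangent is tan(θ₁ - θ₂), and the bound by π/2 puts the angle on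
      -- the principal branch.
      rw [← Real.arctan_tan hb.1 hb.2, Real.tan_eq_sin_div_cos, Function.comp_apply, hsum₁]
      congr 1
      simp only [toBall_explicitMap_castAdd, Complex.re_ofReal_mul, Complex.im_ofReal_mul,
        Complex.exp_ofReal_mul_I_re, Complex.exp_ofReal_mul_I_im]
      rw [div_eq_div_iff (pow_ne_zero 2 (mul_pos (hrad p) (hcos _)).ne') (hcos _).ne',
        Finset.sum_congr rfl fun i _ => mul_mul_mul_comm _ _ _ _, ← Finset.sum_mul]
      simp only [← pow_two, mul_pow]
      rw [← Finset.mul_sum, hsph]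
      ring
    · change _ / Real.sqrt _ = p.2.1.1 i
      rw [Function.comp_apply, hsum₁, Real.sqrt_sq (mul_pos (hrad p) (hcos _)).le,
        toBall_explicitMap_castAdd, Complex.re_ofReal_mul, Complex.exp_ofReal_mul_I_re,
        div_eq_iff (mul_pos (hrad p) (hcos _)).ne']
      ring
    · change _ / Real.sqrt _ = p.2.2.1 j.castSucc
      have h3 := p.2.2.2.2
      rw [Function.comp_apply, hsum₂, Real.sqrt_sq (by positivity), toBall_explicitMap_natAdd,
        Complex.ofReal_re, div_inv_eq_mul, div_mul_cancel₀ _ h3.ne']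

end Embedding

end

theorem corollary10 (n₁ n₂ : ℕ) (ϱ : ℝ) (hϱ : 0 < ϱ) :
    Manifold.IsSmoothEmbedding (𝓘(ℝ, ℝ).prod ((𝓡 n₁).prod (𝓡 n₂)))
        𝓘(ℝ, EuclideanSpace ℂ (Fin (n₁ + 1 + n₂))) ∞ (explicitMap n₁ n₂ ϱ) ∧
      IsLagrangianMap (complexHyperbolicMetric (n₁ + 1 + n₂))
        (𝓘(ℝ, ℝ).prod ((𝓡 n₁).prod (𝓡 n₂))) (complexHyperbolicJ (n₁ + 1 + n₂))
        (explicitMap n₁ n₂ ϱ) ∧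
      IsMinimalMap (complexHyperbolicMetric (n₁ + 1 + n₂))
        (𝓘(ℝ, ℝ).prod ((𝓡 n₁).prod (𝓡 n₂))) (explicitMap n₁ n₂ ϱ) :=
  ⟨⟨isImmersion_explicitMap hϱ, isEmbedding_explicitMap hϱ⟩, isLagrangianMap_explicitMap hϱ,
    isMinimalMap_explicitMap hϱ⟩
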